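/- Let $M$ be a compact smooth manifold without boundary (Hausdorff, of dimension $n\ge 0$), with a smooth Riemannian metric $\langle\cdot,\cdot\rangle^M$ and a smooth volume form $\mu$ of total volume $1$; $M$ is oriented by $\mu$. Let $\mathcal D$ be the group of orientation-preserving $C^\infty$ diffeomorphisms of $M$. Its tangent bundle $T\mathcal D$ consists of the maps $X\circ\phi\colon M\to TM$ with $X$ a smooth vector field and $\phi\in\mathcal D$; a family in $T\mathcal D$ is smooth if it is jointly smooth in the parameters and the point of $M$, and a tangent vector to $T\mathcal D$ at $V$ is a smooth map $W\colon M\to T(TM)$ over $V$. Let $\pi\colon TM\to M$ be the projection. Let $\omega^{TM}=-d\theta^{M}$ and $\omega^{T\mathcal D}=-d\theta^{\mathcal D}$ be the canonical symplectic forms, pulled back from the cotangent bundles by $\langle\cdot,\cdot\rangle^M$ and by the $L^2$ metric $\langle A,B\rangle^{\mathcal D}=\int_M\langle A(x),B(x)\rangle^M\,\mu(x)$ on $T_\phi\mathcal D$, i.e. $\theta^M_v(w)=\langle v,d\pi(w)\rangle^M$ and $\theta^{\mathcal D}_V(W)=\langle V,d\pi\circ W\rangle^{\mathcal D}$. Let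 $H^M\colon TM\to\mathbb R$ be smooth and let $H^{\mathcal D}(X\circ\phi)=\int_M H^M(X(\phi(x)))\,\mu(x)$. A Hamiltonian trajectory of $H$ is a curve whose velocity $Z$ satisfies $\omega(Z,\cdot)=dH$ at every time (curves in $T\mathcal D$ being smooth), and $\Psi^{H}_t(p)$ is the value at time $t$ of the Hamiltonian trajectory that starts at $p$, defined when there is a trajectory on an open interval containing $0$ and $t$ that starts at $p$. Then: (1) $\Psi^{H^M}_t$ and $\Psi^{H^{\mathcal D}}_t$ are well-defined partial maps (each point has at most one image), and for every $X\circ\phi\in T\mathcal D$ there is $\varepsilon>0$ such that $\Psi^{H^{\mathcal D}}_t(X\circ\phi)$ is defined for $|t|<\varepsilon$. (2) If $c$ is a Hamiltonian trajectory of $H^{\mathcal D}$ on an open set of times, then for every $x\in M$ the curve $t\mapsto c(t)(x)$ is a Hamiltonian trajectory of $H^M$ in $TM$. (3) Let $X\circ\phi\in T\mathcal D$ and $t\in\mathbb R$. Then $\Psi^{H^{\mathcal D}}_t(X\circ\phi)$ is defined if and only if for every $s$ between $0$ and $t$ (inclusive) the value $\Psi^{H^M}_s(X(\phi(x)))$ is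 defined for all $x\in M$ and the map $x\mapsto\Psi^{H^M}_s(X(\phi(x)))$ belongs to $T\mathcal D$; in that case $$\Psi^{H^{\mathcal D}}_t(X\circ\phi)(x)=\Psi^{H^M}_t(X(\phi(x)))\qquad\text{for all }x\in M.$$ -/

import Mathlib

open scoped Manifold ContDiff Bundle
open MeasureTheory Set

noncomputable section

namespace AveragedHamiltonian

variable {n : ℕ} {M : Type*} [TopologicalSpace M] [ChartedSpace (EuclideanSpace ℝ (Fin n)) M]

/-! ### Volume forms and the measures they define -/

variable (n) in
/-- The `i`-th coordinate vector of the preferred chart at `x₀`, at the point with coordinates `y`. -/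
def coordVector (x₀ : M) (y : EuclideanSpace ℝ (Fin n)) (i : Fin n) :
    TangentSpace (𝓡 n) ((extChartAt (𝓡 n) x₀).symm y) :=
  mfderiv 𝓘(ℝ, EuclideanSpace ℝ (Fin n)) (𝓡 n) (extChartAt (𝓡 n) x₀).symm y
    (EuclideanSpace.single i (1 : ℝ) : EuclideanSpace ℝ (Fin n))

variable (n M) in
/-- A volume form: a nowhere vanishing `n`-form whose coefficient in every chart is smooth. -/
structure VolumeForm where
  form : ∀ x : M, (TangentSpace (𝓡 n) x) [⋀^Fin n]→ₗ[ℝ] ℝ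
  form_ne_zero : ∀ x, form x ≠ 0
  smooth_coeff : ∀ x₀ : M, ContDiffOn ℝ ∞
    (fun y ↦ form ((extChartAt (𝓡 n) x₀).symm y) (coordVector n x₀ y)) (extChartAt (𝓡 n) x₀).target

/-- The coefficient of a volume form with respect to `dy₁ ∧ … ∧ dyₙ` in the chart at `x₀`. -/
def VolumeForm.coeff (vol : VolumeForm n M) (x₀ : M) (y : EuclideanSpace ℝ (Fin n)) : ℝ :=
  vol.form ((extChartAt (𝓡 n) x₀).symm y) (coordVector n x₀ y)

/-- The measure `A ↦ ∫_A vol` on `M`, where `M` is oriented by `vol`. In the domain of a chart it is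
`|coeff| dy₁ ⋯ dyₙ`; these local measures agree on overlaps, and the global measure is their
supremum (the least measure that dominates each of them). -/
def VolumeForm.measure [MeasurableSpace M] (vol : VolumeForm n M) : Measure M :=
  ⨆ x₀ : M, Measure.map (extChartAt (𝓡 n) x₀).symm
    ((volume.withDensity fun y ↦ ENNReal.ofReal |vol.coeff x₀ y|).restrict
      (extChartAt (𝓡 n) x₀).target)

/-- A diffeomorphism preserving the orientation defined by `vol`. -/
def IsOrientationPreserving (vol : VolumeForm n M) (φ : M ≃ₘ^∞⟮𝓡 n, 𝓡 n⟯ M) : Prop :=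
  ∀ (x : M) (w : Fin n → TangentSpace (𝓡 n) x),
    0 < vol.form x w ↔ 0 < vol.form (φ x) (fun i ↦ mfderiv (𝓡 n) (𝓡 n) φ x (w i))

variable [IsManifold (𝓡 n) ∞ M]

variable (n M) in
/-- Smooth Riemannian metrics on `M`. -/
abbrev Metric :=
  Bundle.ContMDiffRiemannianMetric (𝓡 n) ∞ (EuclideanSpace ℝ (Fin n))
    (fun x : M ↦ TangentSpace (𝓡 n) x)

variable (n M) in
/-- The second tangent bundle `T(TM)`. -/
abbrev TTM := TangentBundle (𝓡 n).tangent (TangentBundle (𝓡 n) M)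

/-- The differential `T(TM) → TM` of the projection `TM → M`, on the fibre over `v`. -/
def projDeriv (v : TangentBundle (𝓡 n) M) :
    TangentSpace (𝓡 n).tangent v →L[ℝ] TangentSpace (𝓡 n) v.proj :=
  mfderiv (𝓡 n).tangent (𝓡 n) (fun w : TangentBundle (𝓡 n) M ↦ w.proj) v

/-! ### The symplectic structure and Hamiltonian flows on `TM` -/

/-- The pull-back to `TM` of the canonical one-form `p dq` of `T*M` by the metric:
`θ_v(w) = ⟨v, dπ(w)⟩`. -/
def liouville (g : Metric n M) (v : TangentBundle (𝓡 n) M) :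
    TangentSpace (𝓡 n).tangent v →L[ℝ] ℝ :=
  (g.inner v.proj v.snd).comp (projDeriv v)

/-- The one-form `θ` in the coordinates of the preferred chart of `TM` at `v₀`. -/
def liouvilleInChart (g : Metric n M) (v₀ : TangentBundle (𝓡 n) M)
    (z : EuclideanSpace ℝ (Fin n) × EuclideanSpace ℝ (Fin n)) :
    EuclideanSpace ℝ (Fin n) × EuclideanSpace ℝ (Fin n) →L[ℝ] ℝ :=
  (liouville g ((extChartAt (𝓡 n).tangent v₀).symm z)).comp
    (mfderiv 𝓘(ℝ, EuclideanSpace ℝ (Fin n) × EuclideanSpace ℝ (Fin n)) (𝓡 n).tangent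
      (extChartAt (𝓡 n).tangent v₀).symm z)

/-- The symplectic form `ω = -dθ` (that is, `dq ∧ dp`) on `TM`. The exterior derivative at `v` is
computed in the preferred chart at `v`, which is the one that identifies the tangent space at `v`
with the model space. -/
def symplecticForm (g : Metric n M) (v : TangentBundle (𝓡 n) M)
    (a b : TangentSpace (𝓡 n).tangent v) : ℝ :=
  -(fderiv ℝ (liouvilleInChart g v) (extChartAt (𝓡 n).tangent v v) a b
    - fderiv ℝ (liouvilleInChart g v) (extChartAt (𝓡 n).tangent v v) b a)

/-- `Z` is the value of the Hamiltonian vector field of `H` at its base point: `ω(Z, ·) = dH`. -/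
def IsHamiltonianVector (g : Metric n M) (H : TangentBundle (𝓡 n) M → ℝ) (Z : TTM n M) : Prop :=
  ∀ w : TangentSpace (𝓡 n).tangent Z.proj,
    symplecticForm g Z.proj Z.snd w = mfderiv (𝓡 n).tangent 𝓘(ℝ, ℝ) H Z.proj w

/-- `γ` is a Hamiltonian trajectory of `H` in `TM` on the open set `J` of times. -/
def IsTrajectory (g : Metric n M) (H : TangentBundle (𝓡 n) M → ℝ) (J : Set ℝ)
    (γ : ℝ → TangentBundle (𝓡 n) M) : Prop :=
  ∀ t ∈ J, MDifferentiableAt 𝓘(ℝ, ℝ) (𝓡 n).tangent γ t ∧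
    IsHamiltonianVector g H ⟨γ t, mfderiv 𝓘(ℝ, ℝ) (𝓡 n).tangent γ t (1 : ℝ)⟩

/-- The (partially defined) flow of a system with the given trajectories: the trajectory that starts
at `p` exists up to time `t`, and is at `q` at time `t`. -/
def FlowsTo {P : Type*} (trajectory : Set ℝ → (ℝ → P) → Prop) (t : ℝ) (p q : P) : Prop :=
  ∃ (J : Set ℝ) (γ : ℝ → P), IsOpen J ∧ J.OrdConnected ∧ 0 ∈ J ∧ t ∈ J ∧
    trajectory J γ ∧ γ 0 = p ∧ γ t = q

/-- `HamFlow g H t v w`: the Hamiltonian flow `Ψ_t` of `H` on `TM` is defined at `v`, and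
`Ψ_t(v) = w`. -/
def HamFlow (g : Metric n M) (H : TangentBundle (𝓡 n) M → ℝ) :
    ℝ → TangentBundle (𝓡 n) M → TangentBundle (𝓡 n) M → Prop :=
  FlowsTo (IsTrajectory g H)

/-! ### The tangent bundle of the diffeomorphism group -/

variable (n M) in
/-- Smooth vector fields on `M`. -/
abbrev SmoothVectorField :=
  Cₛ^∞⟮𝓡 n; EuclideanSpace ℝ (Fin n), (fun x : M ↦ TangentSpace (𝓡 n) x)⟯

/-- `X ∘ φ`, regarded as a tangent vector to the diffeomorphism group at `φ`. -/
def rightTranslate (X : SmoothVectorField n M) (φ : M ≃ₘ^∞⟮𝓡 n, 𝓡 n⟯ M) :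
    M → TangentBundle (𝓡 n) M :=
  fun x ↦ ⟨φ x, X (φ x)⟩

/-- The tangent bundle `TD` of the group `D` of orientation preserving diffeomorphisms, as a set of
maps `M → TM`. -/
def TDiff (vol : VolumeForm n M) : Set (M → TangentBundle (𝓡 n) M) :=
  {V | ∃ (X : SmoothVectorField n M) (φ : M ≃ₘ^∞⟮𝓡 n, 𝓡 n⟯ M),
    IsOrientationPreserving vol φ ∧ V = rightTranslate X φ}

/-- `c` restricts to a smooth map from `S ⊆ F` to the infinite-dimensional manifold `TD`. For compact
`M` a map into a space of smooth maps on `M`, with the `C^∞` topology, is smooth exactly when it is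
jointly smooth in the parameter and the point of `M`. -/
structure IsSmoothFamily {F : Type*} [NormedAddCommGroup F] [NormedSpace ℝ F]
    (vol : VolumeForm n M) (S : Set F) (c : F → M → TangentBundle (𝓡 n) M) : Prop where
  mem : ∀ a ∈ S, c a ∈ TDiff vol
  smooth : ContMDiffOn (𝓘(ℝ, F).prod (𝓡 n)) (𝓡 n).tangent ∞
    (fun p : F × M ↦ c p.1 p.2) (S ×ˢ univ)

/-- The derivative of the family `c` at `a` in the direction `h`: a tangent vector to `TD` at `c a`,
that is, a map `M → T(TM)` over `c a`. -/
def velocity {F : Type*} [NormedAddCommGroup F] [NormedSpace ℝ F]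
    (c : F → M → TangentBundle (𝓡 n) M) (a h : F) : M → TTM n M :=
  fun x ↦ ⟨c a x, mfderiv 𝓘(ℝ, F) (𝓡 n).tangent (fun b ↦ c b x) a h⟩

variable [MeasurableSpace M]

/-- The `L²` metric on `D`: the inner product of two tangent vectors `A`, `B` at `φ`. -/
def metricD (g : Metric n M) (vol : VolumeForm n M) (φ : M → M)
    (A B : ∀ x, TangentSpace (𝓡 n) (φ x)) : ℝ :=
  ∫ x, g.inner (φ x) (A x) (B x) ∂vol.measure

/-- The pull-back to `TD` of the canonical one-form of `T*D` by the `L²` metric: for a tangent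
vector `W` to `TD` at `V = X ∘ φ` it is `θ(W) = ⟨V, dπ ∘ W⟩`. -/
def liouvilleD (g : Metric n M) (vol : VolumeForm n M) (W : M → TTM n M) : ℝ :=
  metricD g vol (fun x ↦ (W x).proj.proj) (fun x ↦ (W x).proj.snd)
    (fun x ↦ projDeriv (W x).proj (W x).snd)

/-- The canonical symplectic form `ω = -dθ` of `TD`, evaluated on the two partial derivatives
`∂₁σ`, `∂₂σ` at `(0, 0)` of a smooth two-parameter family `σ` in `TD`:
`dθ(∂₁σ, ∂₂σ) = ∂₁(θ(∂₂σ)) - ∂₂(θ(∂₁σ))`. -/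
def symplecticD (g : Metric n M) (vol : VolumeForm n M)
    (σ : ℝ × ℝ → M → TangentBundle (𝓡 n) M) : ℝ :=
  -(deriv (fun s : ℝ ↦ liouvilleD g vol (velocity σ (s, 0) (0, 1))) 0
    - deriv (fun t : ℝ ↦ liouvilleD g vol (velocity σ (0, t) (1, 0))) 0)

/-- The averaged Hamiltonian `X ∘ φ ↦ ∫_M H(X(φ(x))) vol(x)`. -/
def averagedHamiltonian (vol : VolumeForm n M) (H : TangentBundle (𝓡 n) M → ℝ)
    (V : M → TangentBundle (𝓡 n) M) : ℝ :=
  ∫ x, H (V x) ∂vol.measure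

/-- The tangent vector `Z` to `TD` is the value at its base point of the Hamiltonian vector field of
the function `K` on `TD`: `ω(Z, W) = dK(W)` for all tangent vectors `W` at the same point. The pairs
`(Z, W)` are represented as `(∂₁σ, ∂₂σ)` at `(0, 0)` for smooth two-parameter families `σ`. -/
def IsHamiltonianVectorD (g : Metric n M) (vol : VolumeForm n M)
    (K : (M → TangentBundle (𝓡 n) M) → ℝ) (Z : M → TTM n M) : Prop :=
  ∀ σ : ℝ × ℝ → M → TangentBundle (𝓡 n) M, IsSmoothFamily vol univ σ →
    velocity σ (0, 0) (1, 0) = Z →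
      HasDerivAt (fun t : ℝ ↦ K (σ (0, t))) (symplecticD g vol σ) 0

/-- `c` is a Hamiltonian trajectory of `K` in `TD` on the open set `J` of times. -/
def IsTrajectoryD (g : Metric n M) (vol : VolumeForm n M)
    (K : (M → TangentBundle (𝓡 n) M) → ℝ) (J : Set ℝ)
    (c : ℝ → M → TangentBundle (𝓡 n) M) : Prop :=
  IsSmoothFamily vol J c ∧ ∀ t ∈ J, IsHamiltonianVectorD g vol K (velocity c t 1)

/-- `HamFlowD g vol K t V W`: the Hamiltonian flow `Ψ_t` of `K` on `TD` is defined at `V`, and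
`Ψ_t(V) = W`. -/
def HamFlowD (g : Metric n M) (vol : VolumeForm n M) (K : (M → TangentBundle (𝓡 n) M) → ℝ) :
    ℝ → (M → TangentBundle (𝓡 n) M) → (M → TangentBundle (𝓡 n) M) → Prop :=
  FlowsTo (IsTrajectoryD g vol K)

end AveragedHamiltonian

end

/-! A tangent vector to `TD` at `V` is a field of tangent vectors of `TM` along `V`, and the
canonical one-form and the averaged Hamiltonian `K` are integrals over `M` of the corresponding
objects on `TM`. Differentiation under the integral, and the fact that exterior derivatives commute
with pull-backs along each slice `z ↦ σ z x`, give `ω(Z, W) - dK(W) = ∫ (ω(Z x, W x) - dH(W x))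
dμ(x)` (`integral_hamDefect`, `hasDerivAt_averagedHamiltonian_iff`). If `Z x` is Hamiltonian at
every `x`, the integrand vanishes and `Z` is Hamiltonian (`isTrajectoryD_of_isTrajectory`).
Conversely `W` may be multiplied by bump functions on `M`, and `μ` charges every nonempty open set,
so the fundamental lemma of the calculus of variations makes the integrand vanish pointwise
(`chartDefect_eq_zero`, `IsTrajectoryD.isTrajectory`). Trajectories in `TD` are thus smooth curves
in `TD` that are trajectories of `H` at every point, and uniqueness is inherited from `TM`.

No differential equation is solved on `TD`. On `TM` the form `ω` is nondegenerate, so `H` has a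
smooth Hamiltonian field `hamField`, whose flow has an open domain and is smooth there
(`FieldFlowsTo.exists_smooth_flow`). By compactness of `M`, a pointwise flow defined at time `s` for
all `x` is defined and smooth for all times near `s`. Moreover `TD` is open
(`eventually_mem_tDiff`): small smooth perturbations of a diffeomorphism are diffeomorphisms, and
the orientation cannot flip on the way. Hence a pointwise flow that stays in `TD` on a closed
segment of times does so on an open interval around it, where it is a trajectory in `TD`
(`exists_isTrajectoryD`). The segment `{0}` gives short-time existence.

Smooth dependence of flows on initial values comes from the implicit function theorem in the Banach
space `C([0, 1], E)`. -/

noncomputable section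

set_option synthInstance.maxHeartbeats 200000

namespace AveragedHamiltonian

/-! ### Smooth flows of vector fields on a Banach space -/

section ODE

open Filter Topology ContinuousMap

universe u

variable {K : Type} [TopologicalSpace K] [CompactSpace K]
variable {E F : Type u} [NormedAddCommGroup E] [NormedSpace ℝ E]
  [NormedAddCommGroup F] [NormedSpace ℝ F]

/-- The superposition operator `u ↦ f ∘ u` on continuous maps. -/
def superpos (K : Type) [TopologicalSpace K] {f : E → F} (hf : Continuous f) (u : C(K, E)) :
    C(K, F) :=
  ContinuousMap.comp ⟨f, hf⟩ u

omit [CompactSpace K] [NormedSpace ℝ E] [NormedSpace ℝ F] in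
@[simp]
lemma superpos_apply {f : E → F} (hf : Continuous f) (u : C(K, E)) (t : K) :
    superpos K hf u t = f (u t) := rfl

/-- The pointwise action of a continuous family of operators on a continuous map. -/
def pointwiseApply (K : Type) [TopologicalSpace K] [CompactSpace K] (E F : Type u)
    [NormedAddCommGroup E] [NormedSpace ℝ E] [NormedAddCommGroup F] [NormedSpace ℝ F] :
    C(K, E →L[ℝ] F) →L[ℝ] C(K, E) →L[ℝ] C(K, F) :=
  LinearMap.mkContinuous₂
    (LinearMap.mk₂ ℝ (fun (A : C(K, E →L[ℝ] F)) (u : C(K, E)) ↦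
        (⟨fun t ↦ A t (u t), A.continuous.clm_apply u.continuous⟩ : C(K, F)))
      (fun _ _ _ ↦ by ext; simp) (fun _ _ _ ↦ by ext; simp)
      (fun _ _ _ ↦ by ext; simp) (fun _ _ _ ↦ by ext; simp)) 1
    (fun A u ↦ by
      rw [ContinuousMap.norm_le _ (by positivity)]
      intro t
      simpa using ((A t).le_opNorm (u t)).trans
        (mul_le_mul (A.norm_coe_le_norm t) (u.norm_coe_le_norm t) (norm_nonneg _)
          (norm_nonneg _)))

/-- The first-order Taylor remainder of `f` is small uniformly along the image of `u`, because that
image is compact; this turns the pointwise derivative into a derivative for the sup norm. -/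
lemma hasFDerivAt_superpos {f : E → F} {f' : E → E →L[ℝ] F} (hf : ContDiff ℝ 1 f)
    (hf' : Continuous f') (h : ∀ x, HasFDerivAt f (f' x) x) (u : C(K, E)) :
    HasFDerivAt (superpos K hf.continuous)
      (pointwiseApply K E F (superpos K hf' u)) u := by
  rw [hasFDerivAt_iff_isLittleO_nhds_zero, Asymptotics.isLittleO_iff]
  intro ε hε
  -- Near each `t₀`, strict differentiability at `u t₀` and continuity of `f'` cost `ε / 2` each;
  -- compactness of `K` makes the neighbourhood of `w = 0` independent of `t`.
  have key : ∀ᶠ w in 𝓝 (0 : E), ∀ t ∈ (univ : Set K),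
      ‖f (u t + w) - f (u t) - f' (u t) w‖ ≤ ε * ‖w‖ := by
    refine isCompact_univ.eventually_forall_of_forall_eventually
      (P := fun w t ↦ ‖f (u t + w) - f (u t) - f' (u t) w‖ ≤ ε * ‖w‖) fun t₀ _ ↦ ?_
    have h1 : HasStrictFDerivAt f (f' (u t₀)) (u t₀) := by
      have := hf.hasStrictFDerivAt (x := u t₀) one_ne_zero
      rwa [(h (u t₀)).fderiv] at this
    have h2 := (Asymptotics.isLittleO_iff.1 h1.isLittleO) (half_pos hε)
    have c1 : Tendsto (fun z : E × K ↦ (u z.2 + z.1, u z.2)) (𝓝 (0, t₀))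
        (𝓝 (u t₀, u t₀)) := by
      have : Continuous (fun z : E × K ↦ (u z.2 + z.1, u z.2)) := by fun_prop
      simpa using this.tendsto (0, t₀)
    have c2 : ∀ᶠ z : E × K in 𝓝 (0, t₀), ‖f' (u z.2) - f' (u t₀)‖ < ε / 2 := by
      have : Continuous (fun z : E × K ↦ ‖f' (u z.2) - f' (u t₀)‖) := by fun_prop
      exact this.continuousAt.eventually_lt continuousAt_const (by simpa using half_pos hε)
    filter_upwards [c1.eventually h2, c2] with z hz1 hz2
    simp only [add_sub_cancel_left] at hz1
    calc ‖f (u z.2 + z.1) - f (u z.2) - f' (u z.2) z.1‖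
        = ‖(f (u z.2 + z.1) - f (u z.2) - f' (u t₀) z.1) - (f' (u z.2) - f' (u t₀)) z.1‖ := by
          congr 1
          simp
      _ ≤ ε / 2 * ‖z.1‖ + ε / 2 * ‖z.1‖ := by
          refine (norm_sub_le _ _).trans (add_le_add hz1 ?_)
          exact (ContinuousLinearMap.le_opNorm _ _).trans (by gcongr)
      _ = ε * ‖z.1‖ := by ring
  obtain ⟨δ, hδ, hball⟩ := Metric.eventually_nhds_iff.1 key
  filter_upwards [Metric.ball_mem_nhds (0 : C(K, E)) hδ] with w hw
  rw [ContinuousMap.norm_le _ (by positivity)]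
  intro t
  have hwt : ‖w t‖ ≤ ‖w‖ := w.norm_coe_le_norm t
  have := hball (y := w t) (by
    rw [dist_zero_right]; exact hwt.trans_lt (by simpa using hw)) t trivial
  exact this.trans (by gcongr)

/-- Induction on the order: the derivative of superposition by `f` is superposition by `fderiv ℝ f`
followed by a continuous linear map. The target `F` is quantified inside because it changes to `E
→L[ℝ] F` at each step, which is also why `E` and `F` share a universe. -/
lemma contDiff_superpos_nat (m : ℕ) : ∀ {F : Type u} [NormedAddCommGroup F] [NormedSpace ℝ F]
    {f : E → F} (hf : ContDiff ℝ ∞ f), ContDiff ℝ m (superpos K hf.continuous) := by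
  induction m with
  | zero =>
    intro F _ _ f hf
    refine contDiff_zero.2 ?_
    exact continuous_postcomp _
  | succ m ih =>
    intro F _ _ f hf
    have hd : ContDiff ℝ ∞ (fderiv ℝ f) := hf.fderiv_right (by simp)
    rw [Nat.cast_succ, contDiff_succ_iff_hasFDerivAt]
    refine ⟨fun u ↦ pointwiseApply K E F (superpos K hd.continuous u),
      ContDiff.comp (g := ⇑(pointwiseApply K E F))
        (ContinuousLinearMap.contDiff _) (ih hd), fun u ↦ ?_⟩
    exact hasFDerivAt_superpos (hf.of_le (by simp)) hd.continuous
      (fun x ↦ (hf.differentiable (by simp) x).hasFDerivAt) u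

lemma contDiff_superpos {f : E → F} (hf : ContDiff ℝ ∞ f) :
    ContDiff ℝ ∞ (superpos K hf.continuous) :=
  contDiff_infty.2 fun m ↦ contDiff_superpos_nat m hf

variable (E) in
/-- The Volterra operator `u ↦ ∫₀ᵗ u` on `C([0, 1], E)`. -/
def volterra : C(unitInterval, E) →L[ℝ] C(unitInterval, E) :=
  LinearMap.mkContinuous
    -- `projIcc` extends `u` to the whole line by its end values, so that the interval integral has
    -- an integrand on `ℝ`.
    { toFun := fun u ↦ ⟨fun t ↦ ∫ s in (0 : ℝ)..t, u (projIcc 0 1 zero_le_one s), by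
        have : Continuous fun b : ℝ ↦ ∫ s in (0 : ℝ)..b, u (projIcc 0 1 zero_le_one s) :=
          intervalIntegral.continuous_primitive (fun a b ↦
            (u.continuous.comp continuous_projIcc).intervalIntegrable a b) 0
        exact this.comp continuous_subtype_val⟩
      map_add' := fun u v ↦ by
        ext t
        simp only [ContinuousMap.add_apply, ContinuousMap.coe_mk]
        exact intervalIntegral.integral_add
          ((u.continuous.comp continuous_projIcc).intervalIntegrable _ _)
          ((v.continuous.comp continuous_projIcc).intervalIntegrable _ _)
      map_smul' := fun c u ↦ by
        ext t
        simp [intervalIntegral.integral_smul] } 1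
    (fun u ↦ by
      rw [ContinuousMap.norm_le _ (by positivity)]
      intro t
      refine (intervalIntegral.norm_integral_le_of_norm_le_const
        (C := ‖u‖) fun s _ ↦ u.norm_coe_le_norm _).trans ?_
      rw [one_mul, sub_zero, abs_of_nonneg t.2.1]
      exact mul_le_of_le_one_right (norm_nonneg _) t.2.2)

lemma volterra_apply (u : C(unitInterval, E)) (t : unitInterval) :
    volterra E u t = ∫ s in (0 : ℝ)..t, u (projIcc 0 1 zero_le_one s) := rfl

lemma norm_volterra_le (u : C(unitInterval, E)) : ‖volterra E u‖ ≤ ‖u‖ := by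
  simpa using (volterra E).le_of_opNorm_le (LinearMap.mkContinuous_norm_le _ zero_le_one _) u

omit [NormedSpace ℝ E] in
lemma norm_superpos_sub_le {f : E → E} {κ : NNReal} (hf : LipschitzWith κ f)
    (u v : C(K, E)) :
    ‖superpos K hf.continuous u - superpos K hf.continuous v‖ ≤ κ * ‖u - v‖ := by
  rw [ContinuousMap.norm_le _ (by positivity)]
  intro t
  simpa [dist_eq_norm] using (hf.dist_le_mul (u t) (v t)).trans
    (mul_le_mul_of_nonneg_left (by simpa [dist_eq_norm] using (u - v).norm_coe_le_norm t) κ.2)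

/-! ### The initial value problem as a fixed point equation in `C([0, 1], E)` -/

variable [CompleteSpace E]

/-- The integral equation of `u' = τ f(u)`, `u(0) = x` on `[0, 1]`. -/
def IsScaledSolution {f : E → E} (hf : Continuous f) (τ : ℝ) (x : E) (u : C(unitInterval, E)) :
    Prop :=
  u = ContinuousLinearMap.const ℝ unitInterval x + τ • volterra E (superpos unitInterval hf u)

omit [CompleteSpace E] in
lemma dist_scaledMap_le {f : E → E} {κ : NNReal} (hf : LipschitzWith κ f) (τ : ℝ) (x : E)
    (u v : C(unitInterval, E)) :
    dist (ContinuousLinearMap.const ℝ unitInterval x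
        + τ • volterra E (superpos unitInterval hf.continuous u))
      (ContinuousLinearMap.const ℝ unitInterval x
        + τ • volterra E (superpos unitInterval hf.continuous v)) ≤ (|τ| * κ) * dist u v := by
  rw [dist_add_left, dist_eq_norm, dist_eq_norm, ← smul_sub, ← map_sub, norm_smul,
    Real.norm_eq_abs, mul_assoc]
  gcongr
  exact (norm_volterra_le _).trans (norm_superpos_sub_le hf u v)

/-- Banach's fixed point theorem. Time is rescaled so that all solutions live on `[0, 1]`, hence in
one Banach space, and the duration becomes the parameter `τ`, which also controls the contraction
constant `|τ| κ`. -/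
lemma exists_scaledSolution {f : E → E} {κ : NNReal} (hf : LipschitzWith κ f) {τ : ℝ}
    (hτ : |τ| * κ < 1) (x : E) : ∃ u, IsScaledSolution hf.continuous τ x u := by
  have hc : ContractingWith (⟨|τ| * κ, by positivity⟩ : NNReal)
      (fun u : C(unitInterval, E) ↦ ContinuousLinearMap.const ℝ unitInterval x
        + τ • volterra E (superpos unitInterval hf.continuous u)) :=
    ⟨by exact_mod_cast hτ, LipschitzWith.of_dist_le_mul fun u v ↦ dist_scaledMap_le hf τ x u v⟩
  exact ⟨hc.fixedPoint, hc.fixedPoint_isFixedPt.symm⟩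

omit [CompleteSpace E] in
lemma IsScaledSolution.unique {f : E → E} {κ : NNReal} (hf : LipschitzWith κ f) {τ : ℝ}
    (hτ : |τ| * κ < 1) {x : E} {u v : C(unitInterval, E)}
    (hu : IsScaledSolution hf.continuous τ x u) (hv : IsScaledSolution hf.continuous τ x v) :
    u = v := by
  have := dist_scaledMap_le hf τ x u v
  rw [← hu, ← hv] at this
  by_contra hne
  have hpos := dist_pos.2 hne
  nlinarith

/-- The solution of `IsScaledSolution`, for small `τ`. -/
def scaledSolution {f : E → E} (hf : Continuous f) (p : ℝ × E) : C(unitInterval, E) :=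
  Classical.epsilon fun u ↦ IsScaledSolution hf p.1 p.2 u

lemma isScaledSolution_scaledSolution {f : E → E} {κ : NNReal} (hf : LipschitzWith κ f) {τ : ℝ}
    (hτ : |τ| * κ < 1) (x : E) :
    IsScaledSolution hf.continuous τ x (scaledSolution hf.continuous (τ, x)) :=
  Classical.epsilon_spec (exists_scaledSolution hf hτ x)

/-- The implicit function theorem for the fixed point equation `G = 0`. The partial derivative in
`u` is `1 - A` with `‖A‖ ≤ |τ| κ < 1`, invertible by the Neumann series, and uniqueness of the fixed
point identifies the implicit function with `scaledSolution`. -/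
lemma contDiffAt_scaledSolution {f : E → E} (hs : ContDiff ℝ ∞ f) {κ : NNReal}
    (hf : LipschitzWith κ f) {p : ℝ × E} (hp : |p.1| * κ < 1) :
    ContDiffAt ℝ ∞ (scaledSolution hf.continuous) p := by
  let I := unitInterval
  let u₀ := scaledSolution hf.continuous p
  let G : (ℝ × E) × C(I, E) → C(I, E) := fun q ↦
    q.2 - (ContinuousLinearMap.const ℝ I q.1.2
      + q.1.1 • volterra E (superpos I hf.continuous q.2))
  have hG : ContDiff ℝ ∞ G := by
    have h1 : ContDiff ℝ ∞ (fun q : (ℝ × E) × C(I, E) ↦ superpos I hf.continuous q.2) :=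
      (contDiff_superpos hs).comp contDiff_snd
    have h2 : ContDiff ℝ ∞ (fun q : (ℝ × E) × C(I, E) ↦ ContinuousLinearMap.const ℝ I q.1.2) :=
      ContDiff.comp (g := ⇑(ContinuousLinearMap.const ℝ I : E →L[ℝ] C(I, E)))
        (ContinuousLinearMap.contDiff _) (contDiff_snd.comp contDiff_fst)
    exact contDiff_snd.sub (h2.add
      ((contDiff_fst.comp contDiff_fst).smul ((volterra E).contDiff.comp h1)))
  have hd : ContDiff ℝ ∞ (fderiv ℝ f) := hs.fderiv_right (by simp)
  let A : C(I, E) →L[ℝ] C(I, E) :=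
    p.1 • (volterra E).comp (pointwiseApply I E E (superpos I hd.continuous u₀))
  have hA : ‖A‖ < 1 := by
    refine lt_of_le_of_lt (ContinuousLinearMap.opNorm_le_bound _ (by positivity) fun w ↦ ?_) hp
    simp only [A, _root_.smul_apply, ContinuousLinearMap.comp_apply, norm_smul,
      Real.norm_eq_abs, mul_assoc]
    gcongr
    refine (norm_volterra_le _).trans ?_
    rw [ContinuousMap.norm_le _ (by positivity)]
    intro t
    exact (ContinuousLinearMap.le_opNorm _ _).trans (mul_le_mul
      (norm_fderiv_le_of_lipschitz ℝ hf) (w.norm_coe_le_norm t) (norm_nonneg _) κ.2)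
  have hder : fderiv ℝ G (p, u₀) ∘L .inr ℝ (ℝ × E) C(I, E) = 1 - A := by
    have h1 : HasFDerivAt (G ∘ fun u ↦ (p, u))
        (fderiv ℝ G (p, u₀) ∘L .inr ℝ (ℝ × E) C(I, E)) u₀ :=
      ((hG.differentiable (by simp)) (p, u₀)).hasFDerivAt.comp u₀ (hasFDerivAt_prodMk_right p u₀)
    have h2 : HasFDerivAt (G ∘ fun u ↦ (p, u)) (1 - A) u₀ := by
      have h3 := hasFDerivAt_superpos (K := I) (hs.of_le (by simp)) hd.continuous
        (fun x ↦ (hs.differentiable (by simp) x).hasFDerivAt) u₀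
      have h4 := (((volterra E).hasFDerivAt.comp u₀ h3).const_smul p.1).const_add
        (ContinuousLinearMap.const ℝ I p.2)
      exact (hasFDerivAt_id u₀).sub h4
    exact h1.unique h2
  have hinv : (fderiv ℝ G (p, u₀) ∘L .inr ℝ (ℝ × E) C(I, E)).IsInvertible := by
    rw [hder]
    obtain ⟨U, hU⟩ := isUnit_one_sub_of_norm_lt_one (R := C(I, E) →L[ℝ] C(I, E)) (x := A) hA
    exact ⟨ContinuousLinearEquiv.unitsEquiv ℝ _ U, by rw [← hU]; rfl⟩
  have hG0 : G (p, u₀) = 0 := sub_eq_zero.2 (isScaledSolution_scaledSolution hf hp p.2)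
  have hGa : ContDiffAt ℝ ∞ G (p, u₀) := hG.contDiffAt
  have hi := hGa.contDiffAt_implicitFunction (by simp) hinv
  refine hi.congr_of_eventuallyEq ?_
  have hnear : ∀ᶠ q : ℝ × E in 𝓝 p, |q.1| * κ < 1 :=
    (continuous_fst.abs.mul continuous_const).continuousAt.eventually_lt continuousAt_const hp
  filter_upwards [hGa.eventually_apply_implicitFunction (by simp) hinv, hnear] with q hq hq'
  refine (isScaledSolution_scaledSolution hf hq' q.2).unique hf hq' ?_
  exact sub_eq_zero.1 (hq.trans hG0)

/-- Substituting `s ↦ r s` in the integral shows that `t ↦ u (r t)` solves the equation with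
parameter `r τ`. At `t = 1` it follows that moving the parameter moves along one and the same
trajectory. -/
lemma scaledSolution_apply_mul {f : E → E} {κ : NNReal} (hf : LipschitzWith κ f) {τ : ℝ}
    (hτ : |τ| * κ < 1) (x : E) (r t : unitInterval) :
    scaledSolution hf.continuous (r * τ, x) t = scaledSolution hf.continuous (τ, x) (r * t) := by
  set u := scaledSolution hf.continuous (τ, x)
  have hr : |r * τ| * κ < 1 := by
    rw [abs_mul, abs_of_nonneg r.2.1, mul_assoc]
    exact (mul_le_of_le_one_left (by positivity) r.2.2).trans_lt hτ
  let v : C(unitInterval, E) := ⟨fun t ↦ u (r * t), by fun_prop⟩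
  have hv : IsScaledSolution hf.continuous (r * τ) x v := by
    ext t
    have h1 : v t = x + τ • ∫ s in (0 : ℝ)..(r * t), f (u (projIcc 0 1 zero_le_one s)) := by
      change u (r * t) = _
      conv_lhs => rw [show u = _ from isScaledSolution_scaledSolution hf hτ x]
      simp [volterra_apply, u]
    rw [h1]
    simp only [ContinuousMap.add_apply, ContinuousMap.smul_apply, volterra_apply]
    congr 1
    rw [mul_comm (r : ℝ) τ, mul_smul]
    congr 1
    have h2 := intervalIntegral.smul_integral_comp_mul_left
      (a := 0) (b := t) (fun s ↦ f (u (projIcc 0 1 zero_le_one s))) (r : ℝ)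
    rw [mul_zero] at h2
    rw [← h2]
    congr 1
    refine intervalIntegral.integral_congr fun s hs ↦ ?_
    rw [uIcc_of_le t.2.1] at hs
    have hs1 : s ∈ Icc (0 : ℝ) 1 := ⟨hs.1, hs.2.trans t.2.2⟩
    have hs2 : (r : ℝ) * s ∈ Icc (0 : ℝ) 1 :=
      ⟨mul_nonneg r.2.1 hs1.1, mul_le_one₀ r.2.2 hs1.1 hs1.2⟩
    simp only [superpos_apply, projIcc_of_mem zero_le_one hs1, projIcc_of_mem zero_le_one hs2]
    rfl
  exact congrArg (fun w : C(unitInterval, E) ↦ w t)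
    ((isScaledSolution_scaledSolution hf hr x).unique hf hr hv)

/-- A globally Lipschitz smooth vector field has a smooth flow for small times. -/
theorem exists_smooth_flow_of_lipschitz {f : E → E} (hs : ContDiff ℝ ∞ f) {κ : NNReal}
    (hf : LipschitzWith κ f) :
    ∃ φ : ℝ × E → E, ∃ ε > 0, ContDiffOn ℝ ∞ φ (Ioo (-ε) ε ×ˢ univ) ∧ (∀ x, φ (0, x) = x) ∧
      ∀ x, ∀ t ∈ Ioo (-ε) ε, HasDerivAt (fun s ↦ φ (s, x)) (f (φ (t, x))) t := by
  -- The summand `1` keeps the bound finite when `κ = 0`, and `|τ| (κ + 1) < 1` implies `|τ| κ < 1`.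
  have hε : (0 : ℝ) < 1 / (κ + 1) := by positivity
  have hlt : ∀ τ ∈ Ioo (-(1 / (κ + 1) : ℝ)) (1 / (κ + 1)), |τ| * κ < 1 := fun τ hτ ↦ by
    have h1 : |τ| < 1 / (κ + 1) := abs_lt.2 hτ
    rw [lt_div_iff₀ (by positivity)] at h1
    nlinarith [abs_nonneg τ]
  refine ⟨fun p ↦ scaledSolution hf.continuous p 1, 1 / (κ + 1), hε, ?_, ?_, ?_⟩
  · intro p hp
    exact ((ContinuousMap.evalCLM ℝ (1 : unitInterval)).contDiff.contDiffAt.comp p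
      (contDiffAt_scaledSolution hs hf (hlt _ hp.1))).contDiffWithinAt
  · intro x
    have h0 : |(0 : ℝ)| * κ < 1 := by simp
    change scaledSolution hf.continuous (0, x) 1 = x
    rw [isScaledSolution_scaledSolution hf h0 x]
    simp
  · intro x
    set φ : ℝ → E := fun s ↦ scaledSolution hf.continuous (s, x) 1
    have hφc : ContinuousOn φ (Ioo (-(1 / (κ + 1) : ℝ)) (1 / (κ + 1))) := by
      intro s hs'
      have h1 : ContinuousAt (scaledSolution hf.continuous) (s, x) :=
        (contDiffAt_scaledSolution hs hf (p := (s, x)) (hlt _ hs')).continuousAt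
      have h2 : ContinuousAt (fun s ↦ scaledSolution hf.continuous (s, x)) s :=
        h1.comp (f := fun s ↦ (s, x)) (by fun_prop)
      exact ((ContinuousMap.evalCLM ℝ (1 : unitInterval)).continuous.continuousAt.comp
        h2).continuousWithinAt
    -- Undoing the rescaling gives the integral equation in true time; the fundamental theorem of
    -- calculus then yields the derivative.
    have hint : ∀ τ ∈ Ioo (-(1 / (κ + 1) : ℝ)) (1 / (κ + 1)),
        φ τ = x + ∫ s in (0 : ℝ)..τ, f (φ s) := by
      intro τ hτ
      have h1 : φ τ = x + τ • ∫ s in (0 : ℝ)..1,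
          f (scaledSolution hf.continuous (τ, x) (projIcc 0 1 zero_le_one s)) := by
        change scaledSolution hf.continuous (τ, x) 1 = _
        conv_lhs => rw [isScaledSolution_scaledSolution hf (hlt τ hτ) x]
        simp [volterra_apply]
      have h2 := intervalIntegral.smul_integral_comp_mul_left
        (a := 0) (b := 1) (fun s ↦ f (φ s)) τ
      rw [mul_zero, mul_one] at h2
      rw [h1, ← h2]
      congr 2
      refine intervalIntegral.integral_congr fun s hs ↦ ?_
      rw [uIcc_of_le zero_le_one] at hs
      have := scaledSolution_apply_mul hf (hlt τ hτ) x ⟨s, hs⟩ 1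
      simp only [projIcc_of_mem zero_le_one hs, φ, mul_comm τ s]
      rw [this, mul_one]
    intro t ht
    have hnhds : Ioo (-(1 / (κ + 1) : ℝ)) (1 / (κ + 1)) ∈ 𝓝 t := isOpen_Ioo.mem_nhds ht
    have hcont : ContinuousOn (fun s ↦ f (φ s)) (Ioo (-(1 / (κ + 1) : ℝ)) (1 / (κ + 1))) :=
      hf.continuous.comp_continuousOn hφc
    have h0 : (0 : ℝ) ∈ Ioo (-(1 / (κ + 1) : ℝ)) (1 / (κ + 1)) := ⟨by linarith, hε⟩
    have hd : HasDerivAt (fun u ↦ ∫ s in (0 : ℝ)..u, f (φ s)) (f (φ t)) t := by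
      refine intervalIntegral.integral_hasDerivAt_right ?_ ?_ (hcont.continuousAt hnhds)
      · exact (hcont.mono (ordConnected_Ioo.uIcc_subset h0 ht)).intervalIntegrable
      · exact hcont.stronglyMeasurableAtFilter isOpen_Ioo t ht
    refine (hd.const_add x).congr_of_eventuallyEq ?_
    filter_upwards [hnhds] with τ hτ using hint τ hτ

/-- A smooth vector field on an open subset of a finite-dimensional space has a smooth local
flow. -/
theorem exists_smooth_local_flow [FiniteDimensional ℝ E] {f : E → E} {O : Set E} (hO : IsOpen O)
    (hf : ContDiffOn ℝ ∞ f O) {p : E} (hp : p ∈ O) :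
    ∃ φ : ℝ × E → E, ∃ ε > 0, ∃ U ⊆ O, IsOpen U ∧ p ∈ U ∧
      ContDiffOn ℝ ∞ φ (Ioo (-ε) ε ×ˢ U) ∧ (∀ x, φ (0, x) = x) ∧
      ∀ x ∈ U, ∀ t ∈ Ioo (-ε) ε, φ (t, x) ∈ O ∧
        HasDerivAt (fun s ↦ φ (s, x)) (f (φ (t, x))) t := by
  obtain ⟨r, hr, hrO⟩ := Metric.isOpen_iff.1 hO p hp
  -- The bump is `1` on the ball of radius `r / 3` and supported in the closed ball of radius `r /
  -- 2`, inside `O`. The product with `f` is smooth with compact support, hence globally Lipschitz.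
  let χ : ContDiffBump p := ⟨r / 3, r / 2, by positivity, by linarith⟩
  let F : E → E := fun x ↦ χ x • f x
  have hsupp : tsupport χ ⊆ O := by
    rw [χ.tsupport_eq]
    exact (Metric.closedBall_subset_ball (half_lt_self hr)).trans hrO
  have hF : ContDiff ℝ ∞ F := by
    rw [contDiff_iff_contDiffAt]
    intro x
    by_cases hx : x ∈ O
    · exact χ.contDiff.contDiffAt.smul (hf.contDiffAt (hO.mem_nhds hx))
    · have : x ∉ tsupport χ := fun h ↦ hx (hsupp h)
      refine (contDiffAt_const (c := (0 : E))).congr_of_eventuallyEq ?_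
      filter_upwards [notMem_tsupport_iff_eventuallyEq.1 this] with y hy
      simp [F, hy]
  have hFc : HasCompactSupport F := χ.hasCompactSupport.smul_right
  obtain ⟨κ, hκ⟩ := hF.lipschitzWith_of_hasCompactSupport hFc (by simp)
  obtain ⟨φ, ε, hε, hφ, hφ0, hφd⟩ := exists_smooth_flow_of_lipschitz hF hκ
  have hc : ContinuousAt φ (0, p) :=
    (hφ.contDiffAt ((isOpen_Ioo.prod isOpen_univ).mem_nhds
      ⟨⟨by simpa using hε, hε⟩, trivial⟩)).continuousAt
  -- As long as the flow of the cut-off field stays in the ball where `χ = 1`, it is a flow of `f`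
  -- itself.
  have hnear : ∀ᶠ q in 𝓝 ((0 : ℝ), p), φ q ∈ Metric.ball p (r / 3) :=
    hc.eventually_mem (by rw [hφ0]; exact Metric.ball_mem_nhds _ (by positivity))
  rw [nhds_prod_eq, Filter.eventually_prod_iff] at hnear
  obtain ⟨pa, ha, pb, hb, hab⟩ := hnear
  obtain ⟨δ, hδ, hδa⟩ := Metric.eventually_nhds_iff.1 ha
  obtain ⟨U, hUb, hU, hpU⟩ := eventually_nhds_iff.1 hb
  refine ⟨φ, min ε δ, lt_min hε hδ, U ∩ O, inter_subset_right, hU.inter hO, ⟨hpU, hp⟩,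
    hφ.mono ?_, hφ0, ?_⟩
  · exact prod_mono (Ioo_subset_Ioo (by simp) (by simp)) (subset_univ _)
  · intro x hx t ht
    have htδ : |t| < min ε δ := abs_lt.2 ht
    have h1 : φ (t, x) ∈ Metric.ball p (r / 3) :=
      hab (hδa (by simpa using htδ.trans_le (min_le_right _ _))) (hUb x hx.1)
    refine ⟨hrO (Metric.ball_subset_ball (by linarith) h1), ?_⟩
    have := hφd x t (abs_lt.1 (htδ.trans_le (min_le_left _ _)))
    have hχ : χ (φ (t, x)) = 1 := χ.one_of_mem_closedBall (Metric.ball_subset_closedBall h1)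
    simpa only [F, hχ, one_smul] using this

end ODE

/-! ### Smooth flows of vector fields on a manifold without boundary -/

section ManifoldFlow

open Filter Topology

universe u

variable {E : Type u} [NormedAddCommGroup E] [NormedSpace ℝ E]
  {B : Type*} [TopologicalSpace B] {I : ModelWithCorners ℝ E B} [I.Boundaryless]
  {N : Type*} [TopologicalSpace N] [ChartedSpace B N]

lemma mdifferentiableAt_extChartAt_symm [IsManifold I 1 N] {x : N} {y : E}
    (hy : y ∈ (extChartAt I x).target) :
    MDifferentiableAt 𝓘(ℝ, E) I (extChartAt I x).symm y := by
  have := mdifferentiableWithinAt_extChartAt_symm hy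
  rwa [I.range_eq_univ, mdifferentiableWithinAt_univ] at this

variable (I) in
/-- The differential at `x` of the preferred chart at `x₀`. -/
def chartDeriv (x₀ x : N) : TangentSpace I x →L[ℝ] E :=
  mfderiv I 𝓘(ℝ, E) (extChartAt I x₀) x

variable (I) in
/-- The differential of the inverse of the preferred chart at `x₀`. -/
def chartSymmDeriv (x₀ : N) (y : E) : E →L[ℝ] TangentSpace I ((extChartAt I x₀).symm y) :=
  mfderiv 𝓘(ℝ, E) I (extChartAt I x₀).symm y

lemma chartSymmDeriv_chartDeriv [IsManifold I 1 N] {x₀ : N} {y : E}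
    (hy : y ∈ (extChartAt I x₀).target) (w : TangentSpace I ((extChartAt I x₀).symm y)) :
    chartSymmDeriv I x₀ y (chartDeriv I x₀ _ w) = w := by
  have := mfderivWithin_extChartAt_symm_comp_mfderiv_extChartAt (I := I) hy
  rw [I.range_eq_univ, mfderivWithin_univ] at this
  exact DFunLike.congr_fun this w

lemma chartDeriv_chartSymmDeriv [IsManifold I 1 N] {x₀ : N} {y : E}
    (hy : y ∈ (extChartAt I x₀).target) (w : E) :
    chartDeriv I x₀ _ (chartSymmDeriv I x₀ y w) = w := by
  have := mfderiv_extChartAt_comp_mfderivWithin_extChartAt_symm (I := I) hy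
  rw [I.range_eq_univ, mfderivWithin_univ] at this
  exact DFunLike.congr_fun this w

variable [IsManifold I ∞ N]

omit [I.Boundaryless] in
lemma trivializationAt_tangent_snd {x₀ x : N} (hx : x ∈ (chartAt B x₀).source)
    (w : TangentSpace I x) :
    (trivializationAt E (TangentSpace I : N → Type _) x₀ ⟨x, w⟩).2 = chartDeriv I x₀ x w := by
  have h := Bundle.Trivialization.coe_linearMapAt_of_mem (R := ℝ)
    (trivializationAt E (TangentSpace I : N → Type _) x₀) (b := x) (by simpa using hx)
  have h2 := TangentBundle.continuousLinearMapAt_trivializationAt (I := I) hx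
  exact (congrFun h w).symm.trans (DFunLike.congr_fun h2 w)

omit [I.Boundaryless] in
/-- A vector field is smooth in the domain of a chart if and only if its coordinate expression
is. -/
lemma contMDiffOn_section_iff_chartDeriv (X : ∀ x : N, TangentSpace I x) (x₀ : N) :
    ContMDiffOn I I.tangent ∞ (fun x ↦ (⟨x, X x⟩ : TangentBundle I N)) (chartAt B x₀).source ↔
      ContMDiffOn I 𝓘(ℝ, E) ∞ (fun x ↦ chartDeriv I x₀ x (X x)) (chartAt B x₀).source := by
  have h := (trivializationAt E (TangentSpace I : N → Type _) x₀).contMDiffOn_section_baseSet_iff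
    (IB := I) (n := ∞) (s := X)
  rw [TangentBundle.trivializationAt_baseSet] at h
  exact h.trans (contMDiffOn_congr fun x hx ↦ trivializationAt_tangent_snd hx _)

omit [I.Boundaryless] in
lemma contDiffOn_chartDeriv_vectorField {X : ∀ x : N, TangentSpace I x}
    (hX : ContMDiff I I.tangent ∞ (fun x ↦ (⟨x, X x⟩ : TangentBundle I N))) (x₀ : N) :
    ContDiffOn ℝ ∞ (fun y ↦ chartDeriv I x₀ ((extChartAt I x₀).symm y)
      (X ((extChartAt I x₀).symm y))) (extChartAt I x₀).target := by
  rw [← contMDiffOn_iff_contDiffOn]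
  refine ((contMDiffOn_section_iff_chartDeriv X x₀).1 hX.contMDiffOn).comp
    (contMDiffOn_extChartAt_symm x₀) fun y hy ↦ ?_
  have := (extChartAt I x₀).map_target hy
  rwa [extChartAt_source] at this

/-- The trajectories of a vector field. -/
abbrev FieldFlowsTo (X : ∀ x : N, TangentSpace I x) : ℝ → N → N → Prop :=
  FlowsTo fun J γ ↦ IsMIntegralCurveOn γ X J

omit [I.Boundaryless] [IsManifold I ∞ N] in
lemma isMIntegralCurveOn_of_isOpen {X : ∀ x : N, TangentSpace I x} {J : Set ℝ} (hJ : IsOpen J)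
    {γ : ℝ → N} : IsMIntegralCurveOn γ X J ↔
      ∀ t ∈ J, HasMFDerivAt 𝓘(ℝ, ℝ) I γ t ((1 : ℝ →L[ℝ] ℝ).smulRight (X (γ t))) :=
  ⟨fun h t ht ↦ (h t ht).hasMFDerivAt (hJ.mem_nhds ht), fun h t ht ↦ (h t ht).hasMFDerivWithinAt⟩

omit [I.Boundaryless] [IsManifold I ∞ N] in
lemma isMIntegralCurveOn_congr_of_isOpen {X : ∀ x : N, TangentSpace I x} {J : Set ℝ}
    (hJ : IsOpen J) {γ γ' : ℝ → N} (h : IsMIntegralCurveOn γ X J) (hγ : EqOn γ' γ J) :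
    IsMIntegralCurveOn γ' X J := by
  rw [isMIntegralCurveOn_of_isOpen hJ] at h ⊢
  intro t ht
  have := (h t ht).congr_of_eventuallyEq (hγ.eventuallyEq_of_mem (hJ.mem_nhds ht))
  rwa [← hγ ht] at this

/-- Uniqueness of integral curves is applied on intervals `Ioo a b`; this fits two times of an open
order-connected set into such an interval. -/
lemma exists_Ioo_subset_of_ordConnected {J : Set ℝ} (hJ : IsOpen J) (hc : J.OrdConnected)
    {s t : ℝ} (hs : s ∈ J) (ht : t ∈ J) :
    ∃ a b, s ∈ Ioo a b ∧ t ∈ Ioo a b ∧ Ioo a b ⊆ J := by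
  have hmin : min s t ∈ J := by rcases min_choice s t with h | h <;> rw [h] <;> assumption
  have hmax : max s t ∈ J := by rcases max_choice s t with h | h <;> rw [h] <;> assumption
  obtain ⟨a, ha, haJ⟩ := exists_Ioc_subset_of_mem_nhds (hJ.mem_nhds hmin) ⟨_, sub_one_lt _⟩
  obtain ⟨b, hb, hbJ⟩ := exists_Ico_subset_of_mem_nhds (hJ.mem_nhds hmax) ⟨_, lt_add_one _⟩
  refine ⟨a, b, ⟨ha.trans_le (min_le_left _ _), (le_max_left _ _).trans_lt hb⟩,
    ⟨ha.trans_le (min_le_right _ _), (le_max_right _ _).trans_lt hb⟩, fun r hr ↦ ?_⟩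
  rcases le_or_gt r (min s t) with h1 | h1
  · exact haJ ⟨hr.1, h1⟩
  · rcases le_or_gt (max s t) r with h2 | h2
    · exact hbJ ⟨h2, hr.2⟩
    · exact hc.out hmin hmax ⟨h1.le, h2.le⟩

/-! ### Uniqueness and concatenation of trajectories -/

section Uniqueness

variable [T2Space N] {X : ∀ x : N, TangentSpace I x}
  (hX : ContMDiff I I.tangent ∞ (fun x ↦ (⟨x, X x⟩ : TangentBundle I N)))

include hX

omit [I.Boundaryless] in
lemma isMIntegralCurveOn_eqOn [BoundarylessManifold I N] {J₁ J₂ : Set ℝ} (h₁ : IsOpen J₁)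
    (hc₁ : J₁.OrdConnected) (h₂ : IsOpen J₂) (hc₂ : J₂.OrdConnected) {γ₁ γ₂ : ℝ → N}
    (hγ₁ : IsMIntegralCurveOn γ₁ X J₁)
    (hγ₂ : IsMIntegralCurveOn γ₂ X J₂) {s : ℝ} (hs₁ : s ∈ J₁) (hs₂ : s ∈ J₂)
    (hs : γ₁ s = γ₂ s) : EqOn γ₁ γ₂ (J₁ ∩ J₂) := by
  intro t ht
  obtain ⟨a, b, has, hat, hab⟩ := exists_Ioo_subset_of_ordConnected (h₁.inter h₂)
    (hc₁.inter hc₂) ⟨hs₁, hs₂⟩ ht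
  have : IsManifold I 1 N := IsManifold.of_le (n := ∞) (by simp)
  exact isMIntegralCurveOn_Ioo_eqOn_of_contMDiff_boundaryless has (hX.of_le (by simp))
    (hγ₁.mono (hab.trans inter_subset_left)) (hγ₂.mono (hab.trans inter_subset_right)) hs hat

lemma FieldFlowsTo.unique {t : ℝ} {p q q' : N} (h : FieldFlowsTo X t p q)
    (h' : FieldFlowsTo X t p q') : q = q' := by
  obtain ⟨J, γ, hJ, hc, h0, ht, hγ, rfl, rfl⟩ := h
  obtain ⟨J', γ', hJ', hc', h0', ht', hγ', he, rfl⟩ := h'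
  exact isMIntegralCurveOn_eqOn hX hJ hc hJ' hc' hγ hγ' h0 h0' he.symm ⟨ht, ht'⟩

lemma FieldFlowsTo.trans {s t : ℝ} {p q r : N} (h : FieldFlowsTo X s p q)
    (h' : FieldFlowsTo X t q r) : FieldFlowsTo X (s + t) p r := by
  obtain ⟨J, γ, hJ, hc, h0, hs, hγ, rfl, rfl⟩ := h
  obtain ⟨J', γ', hJ', hc', h0', ht', hγ', he, rfl⟩ := h'
  let J₂ : Set ℝ := {u | u + -s ∈ J'}
  have hJ₂ : IsOpen J₂ := hJ'.preimage (by fun_prop)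
  have hc₂ : J₂.OrdConnected := hc'.preimage_mono fun a b hab ↦ by simpa using hab
  have hs₂ : s ∈ J₂ := by simpa [J₂] using h0'
  have hγ₂ : IsMIntegralCurveOn (γ' ∘ (· + -s)) X J₂ := hγ'.comp_add (-s)
  have heq := isMIntegralCurveOn_eqOn hX hJ hc hJ₂ hc₂ hγ hγ₂ hs hs₂ (by simp [he])
  classical
  -- The two curves agree on `J ∩ J₂` by uniqueness, so the glued curve coincides with each of them
  -- on an open set.
  let γ₃ : ℝ → N := fun u ↦ if u ∈ J then γ u else γ' (u + -s)
  have e1 : EqOn γ₃ γ J := fun u hu ↦ if_pos hu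
  have e2 : EqOn γ₃ (γ' ∘ (· + -s)) J₂ := fun u hu ↦ by
    by_cases h : u ∈ J
    · rw [e1 h, heq ⟨h, hu⟩]
    · exact if_neg h
  refine ⟨J ∪ J₂, γ₃, hJ.union hJ₂, ?_, Or.inl h0, Or.inr ?_, ?_, e1 h0, ?_⟩
  · exact (IsPreconnected.union s hs hs₂ hc.isPreconnected hc₂.isPreconnected).ordConnected
  · simpa [J₂, add_comm s t] using ht'
  · have h1 := (isMIntegralCurveOn_of_isOpen hJ).1 (isMIntegralCurveOn_congr_of_isOpen hJ hγ e1)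
    have h2 := (isMIntegralCurveOn_of_isOpen hJ₂).1 (isMIntegralCurveOn_congr_of_isOpen hJ₂ hγ₂ e2)
    exact (isMIntegralCurveOn_of_isOpen (hJ.union hJ₂)).2 fun u hu ↦ hu.elim (h1 u) (h2 u)
  · have : s + t ∈ J₂ := by simpa [J₂, add_comm s t] using ht'
    rw [e2 this]
    simp [add_comm s t]

end Uniqueness

omit [I.Boundaryless] [IsManifold I ∞ N] in
lemma FieldFlowsTo.of_integralCurve {X : ∀ x : N, TangentSpace I x} {J : Set ℝ} (hJ : IsOpen J)
    (hc : J.OrdConnected) {γ : ℝ → N} (hγ : IsMIntegralCurveOn γ X J) {s t : ℝ} (hs : s ∈ J)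
    (ht : t ∈ J) : FieldFlowsTo X (t - s) (γ s) (γ t) := by
  refine ⟨{u | u + s ∈ J}, γ ∘ (· + s), hJ.preimage (by fun_prop),
    hc.preimage_mono fun a b hab ↦ by simpa using hab, by simpa using hs, by simpa using ht,
    hγ.comp_add s, by simp, by simp⟩

/-- The field is read in the chart at `p`, where the local flow on an open subset of `E` applies,
and the result is carried back by the inverse chart. -/
lemma exists_local_flow [FiniteDimensional ℝ E] {X : ∀ x : N, TangentSpace I x}
    (hX : ContMDiff I I.tangent ∞ (fun x ↦ (⟨x, X x⟩ : TangentBundle I N))) (p : N) :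
    ∃ ε > 0, ∃ U : Set N, IsOpen U ∧ p ∈ U ∧ ∃ Φ : ℝ × N → N,
      ContMDiffOn (𝓘(ℝ, ℝ).prod I) I ∞ Φ (Ioo (-ε) ε ×ˢ U) ∧
      ∀ x ∈ U, ∀ t ∈ Ioo (-ε) ε, FieldFlowsTo X t x (Φ (t, x)) := by
  have : IsManifold I 1 N := IsManifold.of_le (n := ∞) (by simp)
  have : CompleteSpace E := FiniteDimensional.complete ℝ E
  set e := extChartAt I p
  obtain ⟨φ, ε, hε, V, hVO, hV, hpV, hφ, hφ0, hφd⟩ := exists_smooth_local_flow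
    (isOpen_extChartAt_target (I := I) p) (contDiffOn_chartDeriv_vectorField hX p)
    (mem_extChartAt_target (I := I) p)
  refine ⟨ε, hε, e.source ∩ e ⁻¹' V, ?_, ⟨mem_extChartAt_source p, hpV⟩,
    fun z ↦ e.symm (φ (z.1, e z.2)), ?_, ?_⟩
  · exact (continuousOn_extChartAt p).isOpen_inter_preimage (isOpen_extChartAt_source p) hV
  · have h1 : ContMDiffOn (𝓘(ℝ, ℝ).prod I) 𝓘(ℝ, ℝ × E) ∞ (fun z : ℝ × N ↦ (z.1, e z.2))
        (Ioo (-ε) ε ×ˢ (e.source ∩ e ⁻¹' V)) := by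
      refine ContMDiffOn.prodMk_space contMDiffOn_fst ?_
      refine (contMDiffOn_extChartAt (x := p)).comp contMDiffOn_snd fun z hz ↦ ?_
      have := hz.2.1
      rwa [extChartAt_source] at this
    have h2 : ContMDiffOn (𝓘(ℝ, ℝ).prod I) 𝓘(ℝ, E) ∞ (fun z : ℝ × N ↦ φ (z.1, e z.2))
        (Ioo (-ε) ε ×ˢ (e.source ∩ e ⁻¹' V)) :=
      hφ.contMDiffOn.comp h1 fun z hz ↦ ⟨hz.1, hz.2.2⟩
    exact (contMDiffOn_extChartAt_symm p).comp h2 fun z hz ↦ (hφd _ hz.2.2 _ hz.1).1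
  · intro x hx t ht
    have h0 : (0 : ℝ) ∈ Ioo (-ε) ε := ⟨by simpa using hε, hε⟩
    refine ⟨Ioo (-ε) ε, fun s ↦ e.symm (φ (s, e x)), isOpen_Ioo, ordConnected_Ioo, h0, ht, ?_,
      ?_, rfl⟩
    · refine (isMIntegralCurveOn_of_isOpen isOpen_Ioo).2 fun s hs ↦ ?_
      obtain ⟨hO, hd⟩ := hφd _ hx.2 s hs
      have h1 := (mdifferentiableAt_extChartAt_symm (I := I) hO).hasMFDerivAt
      have h3 := h1.comp s hd.hasFDerivAt.hasMFDerivAt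
      refine h3.congr_mfderiv ?_
      ext
      have h5 := chartSymmDeriv_chartDeriv (I := I) hO (X (e.symm (φ (s, e x))))
      refine Eq.trans ?_ (h5.trans (one_smul ℝ _).symm)
      change chartSymmDeriv I p _ ((1 : ℝ) • _) = _
      rw [one_smul]
    · simp only [hφ0]
      exact e.left_inv hx.1

/-- The domain of the flow of a smooth vector field is open, and the flow is smooth on it. -/
theorem FieldFlowsTo.exists_smooth_flow [FiniteDimensional ℝ E] [T2Space N]
    {X : ∀ x : N, TangentSpace I x}
    (hX : ContMDiff I I.tangent ∞ (fun x ↦ (⟨x, X x⟩ : TangentBundle I N))) {t : ℝ} {p q : N}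
    (h : FieldFlowsTo X t p q) :
    ∃ A : Set ℝ, IsOpen A ∧ t ∈ A ∧ ∃ U : Set N, IsOpen U ∧ p ∈ U ∧ ∃ Φ : ℝ × N → N,
      ContMDiffOn (𝓘(ℝ, ℝ).prod I) I ∞ Φ (A ×ˢ U) ∧
      ∀ s ∈ A, ∀ x ∈ U, FieldFlowsTo X s x (Φ (s, x)) := by
  -- The times at which the conclusion holds are open by construction; they are shown to be closed
  -- in the connected set `J`.
  let good : Set ℝ := {t | ∃ A : Set ℝ, IsOpen A ∧ t ∈ A ∧ ∃ U : Set N, IsOpen U ∧ p ∈ U ∧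
    ∃ Φ : ℝ × N → N, ContMDiffOn (𝓘(ℝ, ℝ).prod I) I ∞ Φ (A ×ˢ U) ∧
      ∀ s ∈ A, ∀ x ∈ U, FieldFlowsTo X s x (Φ (s, x))}
  have hopen : IsOpen good := by
    rw [isOpen_iff_forall_mem_open]
    rintro t ⟨A, hA, htA, hU⟩
    exact ⟨A, fun s hs ↦ ⟨A, hA, hs, hU⟩, hA, htA⟩
  obtain ⟨J, γ, hJ, hc, h0, ht, hγ, rfl, rfl⟩ := h
  -- The radius depends on `s` only, so goodness passes from times near a limit point `s` to `s`
  -- itself. The flow at `r'` is the local flow at `γ s` for time `r' - r`, after the known flow for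
  -- time `r`.
  have step : ∀ s ∈ J, ∃ δ > 0, ∀ r ∈ Metric.ball s δ, ∀ r' ∈ Metric.ball s δ,
      r ∈ good → r' ∈ good := by
    intro s hs
    obtain ⟨ε, hε, U, hU, hsU, Φ, hΦ, hflow⟩ := exists_local_flow hX (γ s)
    have hcont : ContinuousAt γ s := (hγ s hs).1.continuousAt (hJ.mem_nhds hs)
    obtain ⟨δ, hδ, hδU⟩ := Metric.eventually_nhds_iff.1
      ((hcont.eventually_mem (hU.mem_nhds hsU)).and (hJ.mem_nhds hs))
    -- With `r` and `r'` both within `ε / 2` of `s`, the remaining time `r' - r` is below `ε`.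
    refine ⟨min δ (ε / 2), lt_min hδ (half_pos hε), fun r hr r' hr' hgood ↦ ?_⟩
    obtain ⟨A, hA, hrA, V, hV, hpV, Ψ, hΨ, hΨflow⟩ := hgood
    obtain ⟨hrU, hrJ⟩ := hδU (lt_of_lt_of_le (Metric.mem_ball.1 hr) (min_le_left _ _))
    have hrV : Ψ (r, γ 0) = γ r := by
      refine (hΨflow r hrA _ hpV).unique hX ?_
      have := FieldFlowsTo.of_integralCurve hJ hc hγ h0 hrJ
      rwa [sub_zero] at this
    have hΨr : ContMDiffOn I I ∞ (fun x ↦ Ψ (r, x)) V :=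
      hΨ.comp (contMDiffOn_const.prodMk contMDiffOn_id) fun x hx ↦ ⟨hrA, hx⟩
    let W : Set N := V ∩ (fun x ↦ Ψ (r, x)) ⁻¹' U
    have hW : IsOpen W := hΨr.continuousOn.isOpen_inter_preimage hV hU
    have hpW : γ 0 ∈ W := ⟨hpV, by rw [mem_preimage, hrV]; exact hrU⟩
    refine ⟨Metric.ball r ε, Metric.isOpen_ball, ?_, W, hW, hpW,
      fun z ↦ Φ (z.1 - r, Ψ (r, z.2)), ?_, ?_⟩
    · have h1 := lt_of_lt_of_le (Metric.mem_ball.1 hr) (min_le_right _ _)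
      have h2 := lt_of_lt_of_le (Metric.mem_ball.1 hr') (min_le_right _ _)
      rw [dist_comm] at h1
      exact Metric.mem_ball.2 ((dist_triangle r' s r).trans_lt (by linarith))
    · refine hΦ.comp ((contMDiffOn_fst.sub contMDiffOn_const).prodMk
        (hΨr.comp contMDiffOn_snd fun z hz ↦ hz.2.1)) fun z hz ↦ ⟨?_, hz.2.2⟩
      have := hz.1
      rw [Metric.mem_ball, Real.dist_eq] at this
      exact abs_lt.1 this
    · intro u hu x hx
      have h1 : u - r ∈ Ioo (-ε) ε := by
        rw [Metric.mem_ball, Real.dist_eq] at hu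
        exact abs_lt.1 hu
      have := (hΨflow r hrA x hx.1).trans hX (hflow _ hx.2 _ h1)
      rwa [add_sub_cancel] at this
  have hgood0 : (0 : ℝ) ∈ good := by
    obtain ⟨ε, hε, U, hU, hsU, Φ, hΦ, hflow⟩ := exists_local_flow hX (γ 0)
    exact ⟨Ioo (-ε) ε, isOpen_Ioo, ⟨by simpa using hε, hε⟩, U, hU, hsU, Φ, hΦ,
      fun s hs x hx ↦ hflow x hx s hs⟩
  have hsub : J ⊆ good := by
    refine hc.isPreconnected.subset_of_closure_inter_subset hopen ⟨0, h0, hgood0⟩ ?_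
    rintro s ⟨hscl, hs⟩
    obtain ⟨δ, hδ, hstep⟩ := step s hs
    obtain ⟨r, hr, hrs⟩ := Metric.mem_closure_iff.1 hscl δ hδ
    exact hstep r (by rwa [Metric.mem_ball, dist_comm]) s (Metric.mem_ball_self hδ) hr
  exact hsub ht

end ManifoldFlow

section

variable {n : ℕ} {M : Type*} [TopologicalSpace M] [ChartedSpace (EuclideanSpace ℝ (Fin n)) M]

/-! ### Exterior derivatives of one-forms -/

section OneForm

open Filter Topology

variable {W F : Type*} [NormedAddCommGroup W] [NormedSpace ℝ W] [NormedAddCommGroup F]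
  [NormedSpace ℝ F]

/-- The exterior derivative of a one-form on a normed space. -/
def oneFormDeriv (α : F → F →L[ℝ] ℝ) (z a b : F) : ℝ :=
  fderiv ℝ α z a b - fderiv ℝ α z b a

lemma oneFormDeriv_congr {α β : F → F →L[ℝ] ℝ} {z : F} (h : α =ᶠ[𝓝 z] β) (a b : F) :
    oneFormDeriv α z a b = oneFormDeriv β z a b := by
  simp only [oneFormDeriv, h.fderiv_eq]

/-- The exterior derivative commutes with pull-backs. -/
lemma oneFormDeriv_pullback {α : F → F →L[ℝ] ℝ} {G : W → F} {z : W} (hG : ContDiffAt ℝ 2 G z)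
    (hα : DifferentiableAt ℝ α (G z)) (a b : W) :
    oneFormDeriv (fun y ↦ (α (G y)).comp (fderiv ℝ G y)) z a b =
      oneFormDeriv α (G z) (fderiv ℝ G z a) (fderiv ℝ G z b) := by
  have h1 : HasFDerivAt (fun y ↦ α (G y)) ((fderiv ℝ α (G z)).comp (fderiv ℝ G z)) z :=
    hα.hasFDerivAt.comp z (hG.differentiableAt (by simp)).hasFDerivAt
  have h2 : HasFDerivAt (fderiv ℝ G) (fderiv ℝ (fderiv ℝ G) z) z :=
    ((hG.fderiv_right (m := 1) (by norm_num)).differentiableAt (by simp)).hasFDerivAt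
  have h3 := (h1.clm_comp h2).fderiv
  -- The terms with the second derivative of `G` cancel by symmetry under antisymmetrisation.
  have hsymm := hG.isSymmSndFDerivAt (by simp) a b
  simp only [oneFormDeriv, h3, add_apply, ContinuousLinearMap.comp_apply,
    ContinuousLinearMap.compL_apply, ContinuousLinearMap.flip_apply, hsymm]
  ring

lemma hasFDerivAt_comp_fst {V : Type*} [NormedAddCommGroup V] [NormedSpace ℝ V] {G : F → V}
    {q : F} (hG : DifferentiableAt ℝ G q) (p : W) :
    HasFDerivAt (fun z : F × W ↦ G z.1)
      ((fderiv ℝ G q).comp (ContinuousLinearMap.fst ℝ F W)) (q, p) :=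
  HasFDerivAt.comp (q, p) (g := G) (f := Prod.fst) hG.hasFDerivAt hasFDerivAt_fst

/-- The exterior derivative of the canonical one-form of a metric on a normed space. -/
lemma oneFormDeriv_metric {G : F → F →L[ℝ] F →L[ℝ] ℝ} {q : F} (hG : DifferentiableAt ℝ G q)
    (p : F) (u w : F × F) :
    oneFormDeriv (fun z : F × F ↦ (G z.1 z.2).comp (ContinuousLinearMap.fst ℝ F F)) (q, p) u w =
      (fderiv ℝ G q u.1 p w.1 + G q u.2 w.1) - (fderiv ℝ G q w.1 p u.1 + G q w.2 u.1) := by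
  have h0 := hasFDerivAt_comp_fst (F := F) (V := F →L[ℝ] F →L[ℝ] ℝ) (W := F) hG p
  have h1 := (h0.clm_apply (hasFDerivAt_snd (p := (q, p)))).clm_comp
    (hasFDerivAt_const (ContinuousLinearMap.fst ℝ F F) (q, p))
  rw [oneFormDeriv, h1.fderiv]
  simp
  ring

end OneForm

variable [IsManifold (𝓡 n) ∞ M]

/-- Points over different base points are separated by the projection, points of one fibre by a
local trivialization. The Hausdorff property is what makes integral curves in `TM` unique. -/
instance [T2Space M] : T2Space (TangentBundle (𝓡 n) M) := by
  refine ⟨fun p q hpq ↦ ?_⟩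
  have hproj : Continuous (fun v : TangentBundle (𝓡 n) M ↦ v.proj) :=
    FiberBundle.continuous_proj _ _
  by_cases h : p.proj = q.proj
  · let e := trivializationAt (EuclideanSpace ℝ (Fin n)) (TangentSpace (𝓡 n) : M → Type _) p.proj
    have hp : p ∈ e.source := FiberBundle.mem_trivializationAt_proj_source
    have hq : q ∈ e.source := by
      rw [e.mem_source, ← h]
      exact e.mem_source.1 hp
    obtain ⟨u, v, hu, hv, hpu, hqv, huv⟩ := t2_separation (e.injOn.ne hp hq hpq)
    refine ⟨e.source ∩ e ⁻¹' u, e.source ∩ e ⁻¹' v,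
      e.continuousOn.isOpen_inter_preimage e.open_source hu,
      e.continuousOn.isOpen_inter_preimage e.open_source hv, ⟨hp, hpu⟩, ⟨hq, hqv⟩, ?_⟩
    exact (huv.preimage e).mono inter_subset_right inter_subset_right
  · obtain ⟨u, v, hu, hv, hpu, hqv, huv⟩ := t2_separation h
    exact ⟨_, _, hu.preimage hproj, hv.preimage hproj, hpu, hqv, huv.preimage _⟩

/-! ### The preferred charts of the tangent bundle -/

section Charts

lemma extChartAt_tangent_target (v₀ : TangentBundle (𝓡 n) M) :
    (extChartAt (𝓡 n).tangent v₀).target = (extChartAt (𝓡 n) v₀.proj).target ×ˢ univ := by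
  rw [FiberBundle.extChartAt_target]
  ext z
  simp only [mem_inter_iff, mem_preimage, mem_prod, mem_univ, and_true, and_iff_left_iff_imp]
  intro hz
  have := (extChartAt (𝓡 n) v₀.proj).map_target hz
  rw [extChartAt_source] at this
  simpa using this

lemma mem_extChartAt_tangent_source {v₀ v : TangentBundle (𝓡 n) M} :
    v ∈ (extChartAt (𝓡 n).tangent v₀).source ↔ v.proj ∈ (extChartAt (𝓡 n) v₀.proj).source := by
  rw [extChartAt_source, extChartAt_source, TangentBundle.mem_chart_source_iff]

lemma extChartAt_tangent_apply {v₀ v : TangentBundle (𝓡 n) M}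
    (hv : v.proj ∈ (extChartAt (𝓡 n) v₀.proj).source) :
    extChartAt (𝓡 n).tangent v₀ v =
      (extChartAt (𝓡 n) v₀.proj v.proj, chartDeriv (𝓡 n) v₀.proj v.proj v.snd) := by
  rw [extChartAt_source] at hv
  have h1 : extChartAt (𝓡 n).tangent v₀ v = (extChartAt (𝓡 n) v₀.proj
      (trivializationAt (EuclideanSpace ℝ (Fin n)) (TangentSpace (𝓡 n)) v₀.proj v).1,
      (trivializationAt (EuclideanSpace ℝ (Fin n)) (TangentSpace (𝓡 n)) v₀.proj v).2) := by
    rw [FiberBundle.extChartAt]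
    rfl
  rw [h1, TangentBundle.trivializationAt_fst]
  exact Prod.ext rfl (trivializationAt_tangent_snd hv v.snd)

/-- The charts of `TM` are the coordinates `(q, p)` of position and velocity components induced by a
chart of `M`; in them the canonical one-form becomes explicit. -/
lemma extChartAt_tangent_symm_apply {v₀ : TangentBundle (𝓡 n) M} {q p : EuclideanSpace ℝ (Fin n)}
    (hq : q ∈ (extChartAt (𝓡 n) v₀.proj).target) :
    (extChartAt (𝓡 n).tangent v₀).symm (q, p) =
      ⟨(extChartAt (𝓡 n) v₀.proj).symm q, chartSymmDeriv (𝓡 n) v₀.proj q p⟩ := by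
  have hz : (q, p) ∈ (extChartAt (𝓡 n).tangent v₀).target := by
    rw [extChartAt_tangent_target]
    exact ⟨hq, trivial⟩
  have hs := (extChartAt (𝓡 n) v₀.proj).map_target hq
  refine (extChartAt (𝓡 n).tangent v₀).injOn ((extChartAt (𝓡 n).tangent v₀).map_target hz)
    (mem_extChartAt_tangent_source.2 hs) ?_
  rw [(extChartAt (𝓡 n).tangent v₀).right_inv hz, extChartAt_tangent_apply hs,
    (extChartAt (𝓡 n) v₀.proj).right_inv hq, chartDeriv_chartSymmDeriv hq]

/-- The metric at a point, on the model space. -/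
def metricAt (g : Metric n M) (x : M) :
    EuclideanSpace ℝ (Fin n) →L[ℝ] EuclideanSpace ℝ (Fin n) →L[ℝ] ℝ :=
  g.inner x

/-- The metric in the preferred chart at `x₀`. -/
def metricInChart (g : Metric n M) (x₀ : M) (q : EuclideanSpace ℝ (Fin n)) :
    EuclideanSpace ℝ (Fin n) →L[ℝ] EuclideanSpace ℝ (Fin n) →L[ℝ] ℝ :=
  (metricAt g ((extChartAt (𝓡 n) x₀).symm q)).bilinearComp
    (chartSymmDeriv (𝓡 n) x₀ q : EuclideanSpace ℝ (Fin n) →L[ℝ] EuclideanSpace ℝ (Fin n))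
    (chartSymmDeriv (𝓡 n) x₀ q : EuclideanSpace ℝ (Fin n) →L[ℝ] EuclideanSpace ℝ (Fin n))

/-- Positive definiteness of the metric, transported by the invertible differential of the chart.
The nondegeneracy of `ω` rests on it. -/
lemma metricInChart_self_eq_zero (g : Metric n M) {x₀ : M} {q p : EuclideanSpace ℝ (Fin n)}
    (hq : q ∈ (extChartAt (𝓡 n) x₀).target) (h : metricInChart g x₀ q p p = 0) : p = 0 := by
  rw [← chartDeriv_chartSymmDeriv (I := 𝓡 n) hq p]
  by_contra hne
  have : chartSymmDeriv (𝓡 n) x₀ q p ≠ 0 := fun h0 ↦ hne (by rw [h0]; exact map_zero _)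
  exact (g.pos _ _ this).ne' h

/-- Two smooth maps to the tangent bundle over the same map have a smooth inner product. -/
lemma contMDiffOn_inner (g : Metric n M) {EP HP P : Type*} [NormedAddCommGroup EP]
    [NormedSpace ℝ EP] [TopologicalSpace HP] {IP : ModelWithCorners ℝ EP HP} [TopologicalSpace P]
    [ChartedSpace HP P] {s : Set P} {b : P → M} {v w : ∀ p, TangentSpace (𝓡 n) (b p)}
    (hv : ContMDiffOn IP (𝓡 n).tangent ∞ (fun p ↦ (⟨b p, v p⟩ : TangentBundle (𝓡 n) M)) s)
    (hw : ContMDiffOn IP (𝓡 n).tangent ∞ (fun p ↦ (⟨b p, w p⟩ : TangentBundle (𝓡 n) M)) s) :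
    ContMDiffOn IP 𝓘(ℝ, ℝ) ∞ (fun p ↦ g.inner (b p) (v p) (w p)) s := by
  have hb : ContMDiffOn IP (𝓡 n) ∞ b s :=
    (Bundle.contMDiff_proj (IB := 𝓡 n) (F := EuclideanSpace ℝ (Fin n))
      (TangentSpace (𝓡 n) : M → Type _)).comp_contMDiffOn hv
  intro x hx
  have : ContMDiffWithinAt IP ((𝓡 n).prod 𝓘(ℝ)) ∞ (fun m ↦
      Bundle.TotalSpace.mk' ℝ (E := Bundle.Trivial M ℝ) (b m) (g.inner (b m) (v m) (w m))) s x := by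
    apply ContMDiffWithinAt.clm_bundle_apply₂ (F₁ := EuclideanSpace ℝ (Fin n))
      (F₂ := EuclideanSpace ℝ (Fin n))
    · exact ContMDiffAt.comp_contMDiffWithinAt x g.contMDiff.contMDiffAt (hb x hx)
    · exact hv x hx
    · exact hw x hx
  simp only [Bundle.contMDiffWithinAt_totalSpace] at this
  exact this.2

/-- In finite dimension it suffices to test on constant vectors `p`, `a`; these give two smooth maps
to `TM` over the same base map, whose inner product is smooth. -/
lemma contDiffOn_metricInChart (g : Metric n M) (x₀ : M) :
    ContDiffOn ℝ ∞ (metricInChart g x₀) (extChartAt (𝓡 n) x₀).target := by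
  have key : ∀ p : EuclideanSpace ℝ (Fin n), ContMDiffOn 𝓘(ℝ, EuclideanSpace ℝ (Fin n))
      (𝓡 n).tangent ∞ (fun q ↦ (⟨(extChartAt (𝓡 n) x₀).symm q, chartSymmDeriv (𝓡 n) x₀ q p⟩ :
        TangentBundle (𝓡 n) M)) (extChartAt (𝓡 n) x₀).target := by
    intro p
    have h1 := contMDiffOn_extChartAt_symm (I := (𝓡 n).tangent) (n := ∞)
      (⟨x₀, 0⟩ : TangentBundle (𝓡 n) M)
    have h2 : ContMDiffOn 𝓘(ℝ, EuclideanSpace ℝ (Fin n))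
        𝓘(ℝ, EuclideanSpace ℝ (Fin n) × EuclideanSpace ℝ (Fin n)) ∞
        (fun q : EuclideanSpace ℝ (Fin n) ↦ (q, p)) (extChartAt (𝓡 n) x₀).target :=
      (contDiff_id.prodMk contDiff_const).contMDiff.contMDiffOn
    refine (h1.comp h2 fun q hq ↦ ?_).congr fun q hq ↦ ?_
    · rw [mem_preimage, extChartAt_tangent_target]
      exact ⟨hq, trivial⟩
    · exact (extChartAt_tangent_symm_apply (v₀ := ⟨x₀, 0⟩) hq).symm
  refine contDiffOn_clm_apply.2 fun p ↦ contDiffOn_clm_apply.2 fun a ↦ ?_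
  rw [← contMDiffOn_iff_contDiffOn]
  exact contMDiffOn_inner g (key p) (key a)

end Charts

/-! ### The canonical one-form in a chart -/

section Liouville

lemma contMDiff_tangentBundle_proj : ContMDiff (𝓡 n).tangent (𝓡 n) ∞
    (fun w : TangentBundle (𝓡 n) M ↦ w.proj) :=
  Bundle.contMDiff_proj (TangentSpace (𝓡 n) : M → Type _)

lemma hasMFDerivAt_proj (v : TangentBundle (𝓡 n) M) :
    HasMFDerivAt (𝓡 n).tangent (𝓡 n) (fun w : TangentBundle (𝓡 n) M ↦ w.proj) v (projDeriv v) :=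
  ((contMDiff_tangentBundle_proj.mdifferentiable (by simp)) v).hasMFDerivAt

/-- In the coordinates `(q, p)` the projection is `(q, p) ↦ q`, so `θ` is `G_q(p, dq)`. The proof
compares two expressions for the differential of the projection composed with the inverse chart. -/
lemma liouvilleInChart_apply (g : Metric n M) (v₀ : TangentBundle (𝓡 n) M)
    {q : EuclideanSpace ℝ (Fin n)} (hq : q ∈ (extChartAt (𝓡 n) v₀.proj).target)
    (p : EuclideanSpace ℝ (Fin n)) :
    liouvilleInChart g v₀ (q, p) =
      (metricInChart g v₀.proj q p).comp (ContinuousLinearMap.fst ℝ _ _) := by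
  set e := extChartAt (𝓡 n).tangent v₀
  have hz : (q, p) ∈ e.target := by
    rw [extChartAt_tangent_target]
    exact ⟨hq, trivial⟩
  have h1 := (hasMFDerivAt_proj (e.symm (q, p))).comp (q, p)
    (mdifferentiableAt_extChartAt_symm (I := (𝓡 n).tangent) hz).hasMFDerivAt
  have h2 : HasMFDerivAt 𝓘(ℝ, EuclideanSpace ℝ (Fin n) × EuclideanSpace ℝ (Fin n)) (𝓡 n)
      (fun z : EuclideanSpace ℝ (Fin n) × EuclideanSpace ℝ (Fin n) ↦
        (extChartAt (𝓡 n) v₀.proj).symm z.1) (q, p)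
      ((chartSymmDeriv (𝓡 n) v₀.proj q).comp (ContinuousLinearMap.fst ℝ _ _)) :=
    (mdifferentiableAt_extChartAt_symm (I := 𝓡 n) hq).hasMFDerivAt.comp (q, p)
      (hasFDerivAt_fst (𝕜 := ℝ)).hasMFDerivAt
  have h3 : (fun z ↦ (extChartAt (𝓡 n) v₀.proj).symm z.1) =ᶠ[nhds (q, p)]
      (fun w : TangentBundle (𝓡 n) M ↦ w.proj) ∘ e.symm := by
    filter_upwards [(isOpen_extChartAt_target (I := (𝓡 n).tangent) v₀).mem_nhds hz] with z hz'
    rw [extChartAt_tangent_target] at hz'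
    rw [Function.comp_apply, ← Prod.mk.eta (p := z), extChartAt_tangent_symm_apply hz'.1]
  have h4 := hasMFDerivAt_unique (h1.congr_of_eventuallyEq h3) h2
  have h5 := extChartAt_tangent_symm_apply (v₀ := v₀) (p := p) hq
  refine ContinuousLinearMap.ext fun w ↦ ?_
  have h6 : liouvilleInChart g v₀ (q, p) w = metricAt g (e.symm (q, p)).proj (e.symm (q, p)).snd
      (((projDeriv (e.symm (q, p))).comp
        (mfderiv 𝓘(ℝ, EuclideanSpace ℝ (Fin n) × EuclideanSpace ℝ (Fin n)) (𝓡 n).tangent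
          e.symm (q, p))) w) := rfl
  rw [h6]
  refine (congrArg (fun u ↦ metricAt g (e.symm (q, p)).proj (e.symm (q, p)).snd u)
    (DFunLike.congr_fun h4 w)).trans ?_
  rw [h5]
  rfl

lemma contDiffOn_liouvilleInChart (g : Metric n M) (v₀ : TangentBundle (𝓡 n) M) :
    ContDiffOn ℝ ∞ (liouvilleInChart g v₀) (extChartAt (𝓡 n).tangent v₀).target := by
  rw [extChartAt_tangent_target]
  have h1 : ContDiffOn ℝ ∞ (fun z : EuclideanSpace ℝ (Fin n) × EuclideanSpace ℝ (Fin n) ↦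
      (metricInChart g v₀.proj z.1 z.2).comp (ContinuousLinearMap.fst ℝ
        (EuclideanSpace ℝ (Fin n)) (EuclideanSpace ℝ (Fin n))))
      ((extChartAt (𝓡 n) v₀.proj).target ×ˢ univ) :=
    (((contDiffOn_metricInChart g v₀.proj).comp contDiffOn_fst fun z hz ↦ hz.1).clm_apply
      contDiffOn_snd).clm_comp contDiffOn_const
  exact h1.congr fun z hz ↦ liouvilleInChart_apply g v₀ hz.1 z.2

lemma oneFormDeriv_liouvilleInChart (g : Metric n M) (v₀ : TangentBundle (𝓡 n) M)
    {q : EuclideanSpace ℝ (Fin n)} (hq : q ∈ (extChartAt (𝓡 n) v₀.proj).target)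
    (p : EuclideanSpace ℝ (Fin n)) (u w : EuclideanSpace ℝ (Fin n) × EuclideanSpace ℝ (Fin n)) :
    oneFormDeriv (liouvilleInChart g v₀) (q, p) u w =
      (fderiv ℝ (metricInChart g v₀.proj) q u.1 p w.1 + metricInChart g v₀.proj q u.2 w.1) -
      (fderiv ℝ (metricInChart g v₀.proj) q w.1 p u.1 + metricInChart g v₀.proj q w.2 u.1) := by
  have hd : DifferentiableAt ℝ (metricInChart g v₀.proj) q :=
    ((contDiffOn_metricInChart g v₀.proj).contDiffAt
      ((isOpen_extChartAt_target v₀.proj).mem_nhds hq)).differentiableAt (by simp)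
  have h3 : liouvilleInChart g v₀ =ᶠ[nhds (q, p)] fun z ↦
      (metricInChart g v₀.proj z.1 z.2).comp (ContinuousLinearMap.fst ℝ _ _) := by
    filter_upwards [((isOpen_extChartAt_target v₀.proj).prod isOpen_univ).mem_nhds
      (show (q, p) ∈ _ ×ˢ univ from ⟨hq, trivial⟩)] with z hz
    exact liouvilleInChart_apply g v₀ hz.1 z.2
  rw [oneFormDeriv_congr h3, oneFormDeriv_metric hd]

end Liouville

end

section

variable {n : ℕ} {M : Type*} [TopologicalSpace M] [ChartedSpace (EuclideanSpace ℝ (Fin n)) M]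
  [IsManifold (𝓡 n) ∞ M]

/-! ### The symplectic form in a chart and along families -/

section Symplectic

open Filter Topology

variable {W : Type*} [NormedAddCommGroup W] [NormedSpace ℝ W]

/-- The canonical one-form, on the model space of the tangent bundle. -/
def liouvilleAt (g : Metric n M) (v : TangentBundle (𝓡 n) M) :
    EuclideanSpace ℝ (Fin n) × EuclideanSpace ℝ (Fin n) →L[ℝ] ℝ :=
  liouville g v

/-- The differential of a family in the tangent bundle, with values in the model space. -/
def familyDeriv (τ : W → TangentBundle (𝓡 n) M) (y : W) :
    W →L[ℝ] EuclideanSpace ℝ (Fin n) × EuclideanSpace ℝ (Fin n) :=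
  mfderiv 𝓘(ℝ, W) (𝓡 n).tangent τ y

/-- The pull-back of the canonical one-form by a family in the tangent bundle. -/
def pullbackLiouville (g : Metric n M) (τ : W → TangentBundle (𝓡 n) M) (y : W) : W →L[ℝ] ℝ :=
  (liouvilleAt g (τ y)).comp (familyDeriv τ y)

lemma liouvilleInChart_eq_pullback (g : Metric n M) (v : TangentBundle (𝓡 n) M) :
    liouvilleInChart g v = pullbackLiouville g (extChartAt (𝓡 n).tangent v).symm := rfl

lemma mdifferentiableAt_extChartAt_of_mem {v₀ v : TangentBundle (𝓡 n) M}
    (hv : v ∈ (extChartAt (𝓡 n).tangent v₀).source) :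
    MDifferentiableAt (𝓡 n).tangent 𝓘(ℝ, EuclideanSpace ℝ (Fin n) × EuclideanSpace ℝ (Fin n))
      (extChartAt (𝓡 n).tangent v₀) v :=
  mdifferentiableAt_extChartAt (by rwa [extChartAt_source] at hv)

lemma hasFDerivAt_extChartAt_comp {τ : W → TangentBundle (𝓡 n) M} {z : W}
    (hτ : MDifferentiableAt 𝓘(ℝ, W) (𝓡 n).tangent τ z) {v₀ v : TangentBundle (𝓡 n) M}
    (hz : τ z = v) (hv : v ∈ (extChartAt (𝓡 n).tangent v₀).source) :
    HasFDerivAt (extChartAt (𝓡 n).tangent v₀ ∘ τ)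
      ((chartDeriv (𝓡 n).tangent v₀ v :
        EuclideanSpace ℝ (Fin n) × EuclideanSpace ℝ (Fin n) →L[ℝ] _).comp (familyDeriv τ z)) z := by
  subst hz
  exact ((mdifferentiableAt_extChartAt_of_mem hv).hasMFDerivAt.comp z hτ.hasMFDerivAt).hasFDerivAt

/-- Near `z` the family factors as the inverse chart after its coordinate expression, and the chain
rule applies. -/
lemma pullbackLiouville_eq (g : Metric n M) {τ : W → TangentBundle (𝓡 n) M} {z : W}
    (hτ : MDifferentiableAt 𝓘(ℝ, W) (𝓡 n).tangent τ z) {v₀ : TangentBundle (𝓡 n) M}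
    (hz : τ z ∈ (extChartAt (𝓡 n).tangent v₀).source) :
    pullbackLiouville g τ z = (liouvilleInChart g v₀ (extChartAt (𝓡 n).tangent v₀ (τ z))).comp
      (fderiv ℝ (extChartAt (𝓡 n).tangent v₀ ∘ τ) z) := by
  set e := extChartAt (𝓡 n).tangent v₀
  have hG := hasFDerivAt_extChartAt_comp hτ rfl hz
  have h1 : HasMFDerivAt 𝓘(ℝ, W) (𝓡 n).tangent (e.symm ∘ (e ∘ τ)) z
      ((familyDeriv e.symm (e (τ z))).comp (fderiv ℝ (e ∘ τ) z)) :=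
    (mdifferentiableAt_extChartAt_symm (e.map_source hz)).hasMFDerivAt.comp z
      hG.differentiableAt.hasFDerivAt.hasMFDerivAt
  have h2 : τ =ᶠ[𝓝 z] e.symm ∘ (e ∘ τ) := by
    filter_upwards [hτ.continuousAt.eventually_mem
      ((isOpen_extChartAt_source v₀).mem_nhds hz)] with y hy
    exact (e.left_inv hy).symm
  have h3 : familyDeriv τ z = (familyDeriv e.symm (e (τ z))).comp (fderiv ℝ (e ∘ τ) z) :=
    (h1.congr_of_eventuallyEq h2).mfderiv
  rw [pullbackLiouville, h3, liouvilleInChart_eq_pullback, pullbackLiouville,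
    e.left_inv hz, ContinuousLinearMap.comp_assoc]

lemma oneFormDeriv_pullbackLiouville (g : Metric n M) {τ : W → TangentBundle (𝓡 n) M} {z : W}
    (hτ : ContMDiffAt 𝓘(ℝ, W) (𝓡 n).tangent 2 τ z) {v₀ : TangentBundle (𝓡 n) M}
    (hz : τ z ∈ (extChartAt (𝓡 n).tangent v₀).source) (a b : W) :
    oneFormDeriv (pullbackLiouville g τ) z a b =
      oneFormDeriv (liouvilleInChart g v₀) (extChartAt (𝓡 n).tangent v₀ (τ z))
        (fderiv ℝ (extChartAt (𝓡 n).tangent v₀ ∘ τ) z a)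
        (fderiv ℝ (extChartAt (𝓡 n).tangent v₀ ∘ τ) z b) := by
  set e := extChartAt (𝓡 n).tangent v₀
  have hG : ContDiffAt ℝ 2 (e ∘ τ) z := by
    rw [← contMDiffAt_iff_contDiffAt]
    exact (contMDiffAt_extChartAt' (by rwa [extChartAt_source] at hz)).comp z hτ
  have hα : DifferentiableAt ℝ (liouvilleInChart g v₀) ((e ∘ τ) z) :=
    ((contDiffOn_liouvilleInChart g v₀).contDiffAt
      ((isOpen_extChartAt_target v₀).mem_nhds (e.map_source hz))).differentiableAt (by simp)
  have h1 : pullbackLiouville g τ =ᶠ[𝓝 z]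
      fun y ↦ (liouvilleInChart g v₀ ((e ∘ τ) y)).comp (fderiv ℝ (e ∘ τ) y) := by
    have : IsManifold (𝓡 n).tangent 2 (TangentBundle (𝓡 n) M) := inferInstance
    filter_upwards [(contMDiffAt_iff_contMDiffAt_nhds (by simp)).1 hτ,
      hτ.continuousAt.eventually_mem
        ((isOpen_extChartAt_source v₀).mem_nhds hz)] with y hy hy'
    exact pullbackLiouville_eq g (hy.mdifferentiableAt (by simp)) hy'
  rw [oneFormDeriv_congr h1, oneFormDeriv_pullback hG hα]
  rfl

lemma chartDeriv_self (v : TangentBundle (𝓡 n) M) (w : TangentSpace (𝓡 n).tangent v) :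
    chartDeriv (𝓡 n).tangent v v w = w :=
  DFunLike.congr_fun (mfderiv_extChartAt_self (I := (𝓡 n).tangent) (x := v)) w

/-- Independence of the chart. The inverse of the preferred chart at `v` is itself a family in `TM`,
with identity differential at the point over `v`; pulling `θ` back along it and computing in the
chart at `v₀` compares the two charts. -/
lemma symplecticForm_eq_chart (g : Metric n M) {v₀ v : TangentBundle (𝓡 n) M}
    (hv : v ∈ (extChartAt (𝓡 n).tangent v₀).source) (a b : TangentSpace (𝓡 n).tangent v) :
    symplecticForm g v a b =
      -oneFormDeriv (liouvilleInChart g v₀) (extChartAt (𝓡 n).tangent v₀ v)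
        (chartDeriv (𝓡 n).tangent v₀ v a) (chartDeriv (𝓡 n).tangent v₀ v b) := by
  set e := extChartAt (𝓡 n).tangent v
  have hev : e.symm (e v) = v := extChartAt_to_inv v
  have ht : e v ∈ e.target := mem_extChartAt_target v
  have hτ : ContMDiffAt 𝓘(ℝ, EuclideanSpace ℝ (Fin n) × EuclideanSpace ℝ (Fin n))
      (𝓡 n).tangent 2 e.symm (e v) :=
    (contMDiffOn_extChartAt_symm v).contMDiffAt ((isOpen_extChartAt_target v).mem_nhds ht)
  have hid : familyDeriv e.symm (e v) = ContinuousLinearMap.id ℝ _ := by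
    have := mfderivWithin_range_extChartAt_symm (I := (𝓡 n).tangent) (x := v)
    rw [ModelWithCorners.range_eq_univ, mfderivWithin_univ] at this
    exact this
  have h1 := oneFormDeriv_pullbackLiouville g hτ (v₀ := v₀) (by rwa [hev]) a b
  rw [(hasFDerivAt_extChartAt_comp (hτ.mdifferentiableAt (by simp)) hev hv).fderiv, hid, hev] at h1
  exact congrArg Neg.neg h1

/-- The exterior derivative of the pull-back of `θ` by a family is the pull-back of `-ω`. -/
lemma oneFormDeriv_pullbackLiouville_eq_symplecticForm (g : Metric n M)
    {τ : W → TangentBundle (𝓡 n) M} {z : W} (hτ : ContMDiffAt 𝓘(ℝ, W) (𝓡 n).tangent 2 τ z)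
    (a b : W) :
    oneFormDeriv (pullbackLiouville g τ) z a b =
      -symplecticForm g (τ z) (mfderiv 𝓘(ℝ, W) (𝓡 n).tangent τ z a)
        (mfderiv 𝓘(ℝ, W) (𝓡 n).tangent τ z b) := by
  have hs := mem_extChartAt_source (I := (𝓡 n).tangent) (τ z)
  rw [symplecticForm_eq_chart g hs, oneFormDeriv_pullbackLiouville g hτ hs, neg_neg,
    (hasFDerivAt_extChartAt_comp (hτ.mdifferentiableAt (by simp)) rfl hs).fderiv]
  rfl

end Symplectic

/-! ### The Hamiltonian vector field on `TM` -/

section HamiltonianField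

/-- The isomorphism `u ↦ ω(u, ·)` in the preferred chart at `v₀`. -/
def symplecticFlat (g : Metric n M) (v₀ : TangentBundle (𝓡 n) M)
    (z : EuclideanSpace ℝ (Fin n) × EuclideanSpace ℝ (Fin n)) :
    (EuclideanSpace ℝ (Fin n) × EuclideanSpace ℝ (Fin n)) →L[ℝ]
      (EuclideanSpace ℝ (Fin n) × EuclideanSpace ℝ (Fin n)) →L[ℝ] ℝ :=
  (fderiv ℝ (liouvilleInChart g v₀) z).flip - fderiv ℝ (liouvilleInChart g v₀) z

lemma symplecticFlat_apply (g : Metric n M) (v₀ : TangentBundle (𝓡 n) M)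
    (z u w : EuclideanSpace ℝ (Fin n) × EuclideanSpace ℝ (Fin n)) :
    symplecticFlat g v₀ z u w = -oneFormDeriv (liouvilleInChart g v₀) z u w := by
  simp only [symplecticFlat, oneFormDeriv, sub_apply, ContinuousLinearMap.flip_apply, neg_sub]

/-- Pairing `u` with the vertical vector `(0, u.1)` leaves `G(u.1, u.1)` up to sign, so `u.1 = 0`;
pairing with `(u.2, 0)` then leaves `G(u.2, u.2)`. -/
lemma symplecticFlat_injective (g : Metric n M) {v₀ : TangentBundle (𝓡 n) M}
    {z : EuclideanSpace ℝ (Fin n) × EuclideanSpace ℝ (Fin n)}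
    (hz : z ∈ (extChartAt (𝓡 n).tangent v₀).target) :
    Function.Injective (symplecticFlat g v₀ z) := by
  rw [extChartAt_tangent_target] at hz
  obtain ⟨q, p⟩ := z
  rw [injective_iff_map_eq_zero]
  intro u hu
  have key : ∀ w, oneFormDeriv (liouvilleInChart g v₀) (q, p) u w = 0 := fun w ↦ by
    have := symplecticFlat_apply g v₀ (q, p) u w
    rw [hu] at this
    simpa using this.symm
  simp only [oneFormDeriv_liouvilleInChart g v₀ hz.1 p] at key
  have h1 : u.1 = 0 := metricInChart_self_eq_zero g hz.1 (by simpa using key (0, u.1))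
  have h2 : u.2 = 0 := metricInChart_self_eq_zero g hz.1 (by simpa [h1] using key (u.2, 0))
  exact Prod.ext h1 h2

lemma isInvertible_of_injective_dual {V : Type*} [NormedAddCommGroup V] [NormedSpace ℝ V]
    [FiniteDimensional ℝ V] {A : V →L[ℝ] V →L[ℝ] ℝ} (hA : Function.Injective A) :
    A.IsInvertible := by
  have hfin : Module.finrank ℝ V = Module.finrank ℝ (V →L[ℝ] ℝ) := by
    rw [← LinearEquiv.finrank_eq (LinearMap.toContinuousLinearMap (𝕜 := ℝ) (E := V) (F' := ℝ))]
    exact Subspace.dual_finrank_eq.symm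
  refine ⟨(LinearEquiv.ofInjectiveOfFinrankEq A.toLinearMap hA hfin).toContinuousLinearEquiv, ?_⟩
  ext
  rfl

lemma isInvertible_symplecticFlat (g : Metric n M) {v₀ : TangentBundle (𝓡 n) M}
    {z : EuclideanSpace ℝ (Fin n) × EuclideanSpace ℝ (Fin n)}
    (hz : z ∈ (extChartAt (𝓡 n).tangent v₀).target) : (symplecticFlat g v₀ z).IsInvertible :=
  isInvertible_of_injective_dual (symplecticFlat_injective g hz)

lemma contDiff_flip {V : Type*} [NormedAddCommGroup V] [NormedSpace ℝ V] :
    ContDiff ℝ ∞ (fun A : V →L[ℝ] V →L[ℝ] ℝ ↦ A.flip) := by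
  exact ContinuousLinearEquiv.contDiff (𝕜 := ℝ) (E := V →L[ℝ] V →L[ℝ] ℝ)
    (F := V →L[ℝ] V →L[ℝ] ℝ)
    (ContinuousLinearMap.flipₗᵢ ℝ V V ℝ).toContinuousLinearEquiv

lemma contDiffOn_symplecticFlat (g : Metric n M) (v₀ : TangentBundle (𝓡 n) M) :
    ContDiffOn ℝ ∞ (symplecticFlat g v₀) (extChartAt (𝓡 n).tangent v₀).target := by
  have h : ContDiffOn ℝ ∞ (fderiv ℝ (liouvilleInChart g v₀))
      (extChartAt (𝓡 n).tangent v₀).target :=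
    (contDiffOn_liouvilleInChart g v₀).fderiv_of_isOpen (isOpen_extChartAt_target v₀) (by simp)
  refine ContDiffOn.sub ?_ h
  exact contDiff_flip.comp_contDiffOn h

/-- The Hamiltonian vector field of `H` in the preferred chart at `v₀`. -/
def hamInChart (g : Metric n M) (H : TangentBundle (𝓡 n) M → ℝ) (v₀ : TangentBundle (𝓡 n) M)
    (z : EuclideanSpace ℝ (Fin n) × EuclideanSpace ℝ (Fin n)) :
    EuclideanSpace ℝ (Fin n) × EuclideanSpace ℝ (Fin n) :=
  (symplecticFlat g v₀ z).inverse (fderiv ℝ (H ∘ (extChartAt (𝓡 n).tangent v₀).symm) z)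

/-- Inversion of operators is smooth at invertible operators, so solving `ω(u, ·) = dH` preserves
smoothness. -/
lemma contDiffOn_hamInChart (g : Metric n M) {H : TangentBundle (𝓡 n) M → ℝ}
    (hH : ContMDiff (𝓡 n).tangent 𝓘(ℝ, ℝ) ∞ H) (v₀ : TangentBundle (𝓡 n) M) :
    ContDiffOn ℝ ∞ (hamInChart g H v₀) (extChartAt (𝓡 n).tangent v₀).target := by
  have h1 : ContDiffOn ℝ ∞ (H ∘ (extChartAt (𝓡 n).tangent v₀).symm)
      (extChartAt (𝓡 n).tangent v₀).target := by
    rw [← contMDiffOn_iff_contDiffOn]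
    exact hH.comp_contMDiffOn (contMDiffOn_extChartAt_symm v₀)
  have h2 := h1.fderiv_of_isOpen (m := ∞) (isOpen_extChartAt_target v₀) (by simp)
  refine ContDiffOn.clm_apply (fun z hz ↦ ?_) h2
  obtain ⟨e, he⟩ := isInvertible_symplecticFlat g hz
  have h3 := contDiffAt_map_inverse (𝕜 := ℝ) (n := ∞) e
  rw [he] at h3
  exact h3.comp_contDiffWithinAt z (contDiffOn_symplecticFlat g v₀ z hz)

/-- The Hamiltonian vector field of `H`. -/
def hamField (g : Metric n M) (H : TangentBundle (𝓡 n) M → ℝ) (v : TangentBundle (𝓡 n) M) :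
    TangentSpace (𝓡 n).tangent v :=
  hamInChart g H v (extChartAt (𝓡 n).tangent v v)

lemma isInvertible_chartDeriv {v₀ v : TangentBundle (𝓡 n) M}
    (hv : v ∈ (extChartAt (𝓡 n).tangent v₀).source) :
    (chartDeriv (𝓡 n).tangent v₀ v).IsInvertible :=
  isInvertible_mfderiv_extChartAt hv

lemma mfderiv_eq_fderiv_chartDeriv {H : TangentBundle (𝓡 n) M → ℝ}
    (hH : MDifferentiable (𝓡 n).tangent 𝓘(ℝ, ℝ) H) {v₀ v : TangentBundle (𝓡 n) M}
    (hv : v ∈ (extChartAt (𝓡 n).tangent v₀).source) (w : TangentSpace (𝓡 n).tangent v) :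
    mfderiv (𝓡 n).tangent 𝓘(ℝ, ℝ) H v w =
      fderiv ℝ (H ∘ (extChartAt (𝓡 n).tangent v₀).symm) (extChartAt (𝓡 n).tangent v₀ v)
        (chartDeriv (𝓡 n).tangent v₀ v w) := by
  set e := extChartAt (𝓡 n).tangent v₀
  have h1 : HasMFDerivAt 𝓘(ℝ, EuclideanSpace ℝ (Fin n) × EuclideanSpace ℝ (Fin n)) 𝓘(ℝ, ℝ)
      (H ∘ e.symm) (e v) (fderiv ℝ (H ∘ e.symm) (e v)) := by
    have := (hH (e.symm (e v))).comp (e v)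
      (mdifferentiableAt_extChartAt_symm (I := (𝓡 n).tangent) (e.map_source hv))
    exact this.differentiableAt.hasFDerivAt.hasMFDerivAt
  have h2 := h1.comp v (mdifferentiableAt_extChartAt_of_mem hv).hasMFDerivAt
  have h3 : H =ᶠ[nhds v] (H ∘ e.symm) ∘ e := by
    filter_upwards [(isOpen_extChartAt_source v₀).mem_nhds hv] with y hy
    exact (congrArg H (e.left_inv hy)).symm
  exact DFunLike.congr_fun (h2.congr_of_eventuallyEq h3).mfderiv w

lemma isHamiltonianVector_iff_chart (g : Metric n M) {H : TangentBundle (𝓡 n) M → ℝ}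
    (hH : MDifferentiable (𝓡 n).tangent 𝓘(ℝ, ℝ) H) {v₀ v : TangentBundle (𝓡 n) M}
    (hv : v ∈ (extChartAt (𝓡 n).tangent v₀).source) (Z : TangentSpace (𝓡 n).tangent v) :
    IsHamiltonianVector g H ⟨v, Z⟩ ↔
      chartDeriv (𝓡 n).tangent v₀ v Z = hamInChart g H v₀ (extChartAt (𝓡 n).tangent v₀ v) := by
  set e := extChartAt (𝓡 n).tangent v₀
  have hinv := isInvertible_symplecticFlat g (e.map_source hv)
  rw [eq_comm, hamInChart, hinv.inverse_apply_eq]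
  have key : ∀ w : TangentSpace (𝓡 n).tangent v, (symplecticForm g v Z w =
      mfderiv (𝓡 n).tangent 𝓘(ℝ, ℝ) H v w ↔
      fderiv ℝ (H ∘ e.symm) (e v) (chartDeriv (𝓡 n).tangent v₀ v w) =
      symplecticFlat g v₀ (e v) (chartDeriv (𝓡 n).tangent v₀ v Z)
        (chartDeriv (𝓡 n).tangent v₀ v w)) := fun w ↦ by
    rw [symplecticForm_eq_chart g hv, mfderiv_eq_fderiv_chartDeriv hH hv, symplecticFlat_apply,
      eq_comm]
  constructor
  · intro h
    refine ContinuousLinearMap.ext fun w ↦ ?_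
    obtain ⟨w', rfl⟩ := (isInvertible_chartDeriv hv).bijective.surjective w
    exact (key w').1 (h w')
  · intro h w
    exact (key w).2 (by rw [h])

/-- By nondegeneracy there is exactly one Hamiltonian vector at each point. This turns Hamiltonian
trajectories into integral curves of `hamField`. -/
lemma isHamiltonianVector_iff (g : Metric n M) {H : TangentBundle (𝓡 n) M → ℝ}
    (hH : MDifferentiable (𝓡 n).tangent 𝓘(ℝ, ℝ) H) (v : TangentBundle (𝓡 n) M)
    (Z : TangentSpace (𝓡 n).tangent v) :
    IsHamiltonianVector g H ⟨v, Z⟩ ↔ Z = hamField g H v := by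
  rw [isHamiltonianVector_iff_chart g hH (mem_extChartAt_source v), chartDeriv_self]
  rfl

/-- The definition of `hamField` uses a chart that varies with the point. The equation `ω(Z, ·) =
dH` does not depend on a chart, so near `v₀` the components in the fixed chart at `v₀` are
`hamInChart g H v₀`. -/
lemma contMDiff_hamField (g : Metric n M) {H : TangentBundle (𝓡 n) M → ℝ}
    (hH : ContMDiff (𝓡 n).tangent 𝓘(ℝ, ℝ) ∞ H) :
    ContMDiff (𝓡 n).tangent (𝓡 n).tangent.tangent ∞
      (fun v ↦ (⟨v, hamField g H v⟩ : TTM n M)) := by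
  intro v₀
  have hd := hH.mdifferentiable (by simp)
  have hs : v₀ ∈ (chartAt (ModelProd (EuclideanSpace ℝ (Fin n)) (EuclideanSpace ℝ (Fin n)))
    v₀).source := mem_chart_source _ v₀
  refine ContMDiffOn.contMDiffAt ?_ ((chartAt _ v₀).open_source.mem_nhds hs)
  refine (contMDiffOn_section_iff_chartDeriv (I := (𝓡 n).tangent) (hamField g H) v₀).2 ?_
  refine (((contDiffOn_hamInChart g hH v₀).contMDiffOn).comp
    (contMDiffOn_extChartAt (I := (𝓡 n).tangent) (x := v₀)) fun v hv ↦ ?_).congr fun v hv ↦ ?_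
  · exact (extChartAt (𝓡 n).tangent v₀).map_source (by rwa [extChartAt_source])
  · refine (isHamiltonianVector_iff_chart g hd (by rwa [extChartAt_source]) _).1 ?_
    exact (isHamiltonianVector_iff g hd v _).2 rfl

lemma isTrajectory_iff (g : Metric n M) {H : TangentBundle (𝓡 n) M → ℝ}
    (hH : ContMDiff (𝓡 n).tangent 𝓘(ℝ, ℝ) ∞ H) {J : Set ℝ} (hJ : IsOpen J)
    (γ : ℝ → TangentBundle (𝓡 n) M) :
    IsTrajectory g H J γ ↔ IsMIntegralCurveOn γ (hamField g H) J := by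
  rw [isMIntegralCurveOn_of_isOpen hJ]
  refine forall₂_congr fun t _ ↦ ?_
  rw [isHamiltonianVector_iff g (hH.mdifferentiable (by simp))]
  constructor
  · rintro ⟨h1, h2⟩
    refine h1.hasMFDerivAt.congr_mfderiv ?_
    ext
    exact h2.trans (one_smul ℝ _).symm
  · intro h
    refine ⟨h.mdifferentiableAt, ?_⟩
    rw [h.mfderiv]
    exact one_smul ℝ _

lemma hamFlow_iff (g : Metric n M) {H : TangentBundle (𝓡 n) M → ℝ}
    (hH : ContMDiff (𝓡 n).tangent 𝓘(ℝ, ℝ) ∞ H) (t : ℝ) (v w : TangentBundle (𝓡 n) M) :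
    HamFlow g H t v w ↔ FieldFlowsTo (hamField g H) t v w := by
  constructor
  · rintro ⟨J, γ, hJ, h1, h2, h3, h4, h5⟩
    exact ⟨J, γ, hJ, h1, h2, h3, (isTrajectory_iff g hH hJ γ).1 h4, h5⟩
  · rintro ⟨J, γ, hJ, h1, h2, h3, h4, h5⟩
    exact ⟨J, γ, hJ, h1, h2, h3, (isTrajectory_iff g hH hJ γ).2 h4, h5⟩

end HamiltonianField

end

/-! ### Smooth perturbations of diffeomorphisms -/

section Perturbation

open Filter Topology

universe u

variable {E : Type u} [NormedAddCommGroup E] [NormedSpace ℝ E] [FiniteDimensional ℝ E]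
  {B : Type*} [TopologicalSpace B] {I : ModelWithCorners ℝ E B} [I.Boundaryless]
  {N : Type*} [TopologicalSpace N] [ChartedSpace B N] [IsManifold I ∞ N]
  {P : Type*} [NormedAddCommGroup P] [NormedSpace ℝ P]

lemma hasMFDerivAt_comp_of_eq {E₁ E₂ E₃ B₁ B₂ B₃ N₁ N₂ N₃ : Type*}
    [NormedAddCommGroup E₁] [NormedSpace ℝ E₁] [NormedAddCommGroup E₂] [NormedSpace ℝ E₂]
    [NormedAddCommGroup E₃] [NormedSpace ℝ E₃] [TopologicalSpace B₁] [TopologicalSpace B₂]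
    [TopologicalSpace B₃] {I₁ : ModelWithCorners ℝ E₁ B₁} {I₂ : ModelWithCorners ℝ E₂ B₂}
    {I₃ : ModelWithCorners ℝ E₃ B₃} [TopologicalSpace N₁] [ChartedSpace B₁ N₁]
    [TopologicalSpace N₂] [ChartedSpace B₂ N₂] [TopologicalSpace N₃] [ChartedSpace B₃ N₃]
    {f : N₁ → N₂} {h : N₂ → N₃} {x : N₁} {y : N₂} {f' : E₁ →L[ℝ] E₂} {h' : E₂ →L[ℝ] E₃}
    (hh : HasMFDerivAt I₂ I₃ h y h') (hf : HasMFDerivAt I₁ I₂ f x f') (hy : f x = y) :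
    HasMFDerivAt I₁ I₃ (h ∘ f) x (h'.comp f') := by
  subst hy
  exact hh.comp x hf

omit [FiniteDimensional ℝ E] in
lemma hasMFDerivAt_extChartAt_symm_self (x : N) :
    HasMFDerivAt 𝓘(ℝ, E) I (extChartAt I x).symm (extChartAt I x x)
      (ContinuousLinearMap.id ℝ E) := by
  have : IsManifold I 1 N := IsManifold.of_le (n := ∞) (by simp)
  have h := mfderivWithin_range_extChartAt_symm (I := I) (x := x)
  rw [ModelWithCorners.range_eq_univ, mfderivWithin_univ] at h
  have h2 := (mdifferentiableAt_extChartAt_symm (I := I) (mem_extChartAt_target x)).hasMFDerivAt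
  rw [h] at h2
  exact h2

omit [FiniteDimensional ℝ E] [I.Boundaryless] in
lemma hasMFDerivAt_chartDeriv {x₀ x : N} (hx : x ∈ (extChartAt I x₀).source) :
    HasMFDerivAt I 𝓘(ℝ, E) (extChartAt I x₀) x (chartDeriv I x₀ x) := by
  have : IsManifold I 1 N := IsManifold.of_le (n := ∞) (by simp)
  exact (mdifferentiableAt_extChartAt (by rwa [extChartAt_source] at hx)).hasMFDerivAt

variable (I) in
/-- A family of maps in the preferred charts at `x₀` and `y₀`. -/
def familyInChart (f : P × N → N) (x₀ y₀ : N) (z : P × E) : E :=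
  extChartAt I y₀ (f (z.1, (extChartAt I x₀).symm z.2))

omit [FiniteDimensional ℝ E] in
lemma contDiffAt_familyInChart {k : ℕ∞ω} (hk : k ≤ ∞) {f : P × N → N} {a : P} {x₀ y₀ : N}
    (hf : ContMDiffAt (𝓘(ℝ, P).prod I) I k f (a, x₀))
    (hy : f (a, x₀) ∈ (extChartAt I y₀).source) :
    ContDiffAt ℝ k (familyInChart I f x₀ y₀) (a, extChartAt I x₀ x₀) := by
  have : IsManifold I k N := IsManifold.of_le (n := ∞) hk
  rw [← contMDiffAt_iff_contDiffAt]
  have h1 : ContMDiffAt 𝓘(ℝ, E) I k (extChartAt I x₀).symm (extChartAt I x₀ x₀) :=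
    (contMDiffOn_extChartAt_symm x₀).contMDiffAt
      ((isOpen_extChartAt_target x₀).mem_nhds (mem_extChartAt_target x₀))
  have h2 : ContMDiffAt 𝓘(ℝ, P × E) (𝓘(ℝ, P).prod I) k
      (fun z : P × E ↦ (z.1, (extChartAt I x₀).symm z.2)) (a, extChartAt I x₀ x₀) :=
    (contDiffAt_fst.contMDiffAt).prodMk
      (h1.comp (a, extChartAt I x₀ x₀) contDiffAt_snd.contMDiffAt)
  have h0 : (extChartAt I x₀).symm (extChartAt I x₀ x₀) = x₀ := extChartAt_to_inv x₀
  have h3 : ContMDiffAt 𝓘(ℝ, P × E) I k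
      (fun z : P × E ↦ f (z.1, (extChartAt I x₀).symm z.2)) (a, extChartAt I x₀ x₀) :=
    ContMDiffAt.comp (g := f) (a, extChartAt I x₀ x₀) (by simpa only [h0] using hf) h2
  have h4 : ContMDiffAt I 𝓘(ℝ, E) k (extChartAt I y₀) (f (a, x₀)) :=
    contMDiffAt_extChartAt' (by rwa [extChartAt_source] at hy)
  exact ContMDiffAt.comp (g := extChartAt I y₀) (a, extChartAt I x₀ x₀)
    (by simpa only [h0] using h4) h3

omit [FiniteDimensional ℝ E] in
lemma fderiv_familyInChart {f : P × N → N} {a : P} {x₀ y₀ : N}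
    (hf : ContMDiffAt (𝓘(ℝ, P).prod I) I 1 f (a, x₀))
    (hy : f (a, x₀) ∈ (extChartAt I y₀).source) (w : E) :
    fderiv ℝ (familyInChart I f x₀ y₀) (a, extChartAt I x₀ x₀) (0, w) =
      chartDeriv I y₀ (f (a, x₀)) (mfderiv I I (fun x ↦ f (a, x)) x₀ w) := by
  have h1 := ((contDiffAt_familyInChart (by simp) hf hy).differentiableAt (by simp)).hasFDerivAt
  have h2 := h1.comp (extChartAt I x₀ x₀) (hasFDerivAt_prodMk_right a (extChartAt I x₀ x₀))
  have hfa : MDifferentiableAt I I (fun x ↦ f (a, x)) x₀ :=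
    (hf.comp x₀ (contMDiffAt_const.prodMk contMDiffAt_id)).mdifferentiableAt (by simp)
  have h3 := hasMFDerivAt_comp_of_eq (hasMFDerivAt_chartDeriv (I := I) hy)
    (hasMFDerivAt_comp_of_eq hfa.hasMFDerivAt (hasMFDerivAt_extChartAt_symm_self x₀)
      (extChartAt_to_inv x₀)) (by simp)
  exact DFunLike.congr_fun (h2.unique h3.hasFDerivAt) w

/-- The inverse function theorem with parameters, on manifolds. -/
theorem exists_local_inverse_family [CompleteSpace P] {f : P × N → N} {a₀ : P} {x₀ : N}
    (hf : ContMDiffAt (𝓘(ℝ, P).prod I) I ∞ f (a₀, x₀))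
    (hinj : Function.Injective (mfderiv I I (fun x ↦ f (a₀, x)) x₀)) :
    ∃ ψ : P × N → N, ContMDiffAt (𝓘(ℝ, P).prod I) I ∞ ψ (a₀, f (a₀, x₀)) ∧
      ψ (a₀, f (a₀, x₀)) = x₀ ∧
      (∀ᶠ z in 𝓝 (a₀, f (a₀, x₀)), f (z.1, ψ z) = z.2) ∧
      ∀ᶠ z in 𝓝 (a₀, x₀), ψ (z.1, f z) = z.2 := by
  have : CompleteSpace E := FiniteDimensional.complete ℝ E
  have : IsManifold I 1 N := IsManifold.of_le (n := ∞) (by simp)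
  set y₀ := f (a₀, x₀) with hy₀
  set e := extChartAt I x₀
  set e' := extChartAt I y₀
  have hys : f (a₀, x₀) ∈ e'.source := mem_extChartAt_source y₀
  -- In charts the equation to be solved for `x` is `f(a, x) - y = 0`, with parameters `(a, y)`.
  let F : (P × E) × E → E := fun v ↦ familyInChart I f x₀ y₀ (v.1.1, v.2) - v.1.2
  let u : (P × E) × E := ((a₀, e' y₀), e x₀)
  have hG := contDiffAt_familyInChart le_rfl hf hys
  have hF : ContDiffAt ℝ ∞ F u := by
    refine ContDiffAt.sub ?_ (contDiffAt_snd.comp u contDiffAt_fst)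
    exact ContDiffAt.comp (g := familyInChart I f x₀ y₀) u hG
      ((contDiffAt_fst.comp u contDiffAt_fst).prodMk contDiffAt_snd)
  have hFu : F u = 0 := by
    change e' (f (a₀, e.symm (e x₀))) - e' y₀ = 0
    rw [show e.symm (e x₀) = x₀ from extChartAt_to_inv x₀, sub_self]
  -- Preferred charts have identity differential at their centres, so the coordinate derivative in
  -- `x` is the manifold derivative itself.
  have hder : ∀ w : E, (fderiv ℝ F u ∘L .inr ℝ (P × E) E) w =
      mfderiv I I (fun x ↦ f (a₀, x)) x₀ w := by
    intro w
    have h1 : HasFDerivAt (fun x ↦ F ((a₀, e' y₀), x)) (fderiv ℝ F u ∘L .inr ℝ (P × E) E)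
        (e x₀) :=
      (hF.differentiableAt (by simp)).hasFDerivAt.comp (e x₀)
        (hasFDerivAt_prodMk_right (a₀, e' y₀) (e x₀))
    have h2 : HasFDerivAt (fun x ↦ familyInChart I f x₀ y₀ (a₀, x) - e' y₀)
        (fderiv ℝ (familyInChart I f x₀ y₀) (a₀, e x₀) ∘L .inr ℝ P E) (e x₀) :=
      ((hG.differentiableAt (by simp)).hasFDerivAt.comp (e x₀)
        (hasFDerivAt_prodMk_right a₀ (e x₀))).sub_const _
    have h3 := fderiv_familyInChart (hf.of_le (by simp)) hys w
    rw [h1.unique h2]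
    refine h3.trans ?_
    exact DFunLike.congr_fun (mfderiv_extChartAt_self (I := I) (x := y₀)) _
  have hinv : (fderiv ℝ F u ∘L .inr ℝ (P × E) E).IsInvertible := by
    have hinj' : Function.Injective (fderiv ℝ F u ∘L .inr ℝ (P × E) E) := by
      intro w w' h
      rw [hder, hder] at h
      exact hinj h
    refine ⟨(LinearEquiv.ofInjectiveEndo (fderiv ℝ F u ∘L .inr ℝ (P × E) E).toLinearMap
      hinj').toContinuousLinearEquiv, ?_⟩
    ext
    rfl
  set Ψ : P × E → E := hF.implicitFunction (by simp) hinv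
  have hΨ : ContDiffAt ℝ ∞ Ψ (a₀, e' y₀) := hF.contDiffAt_implicitFunction (by simp) hinv
  have hΨ0 : Ψ (a₀, e' y₀) = e x₀ := hF.implicitFunction_apply_self (by simp) hinv
  have hΨ1 : ∀ᶠ z in 𝓝 (a₀, e' y₀), F (z, Ψ z) = F u :=
    hF.eventually_apply_implicitFunction (by simp) hinv
  -- The local uniqueness of the implicit function gives the left inverse, while `hΨ1` gives the
  -- right inverse.
  have hΨ2 : ∀ᶠ v in 𝓝 u, F v = F u ↔ Ψ v.1 = v.2 :=
    hF.eventually_apply_eq_iff_implicitFunction (by simp) hinv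
  have hc' : ContMDiffAt (𝓘(ℝ, P).prod I) 𝓘(ℝ, P × E) ∞ (fun z : P × N ↦ (z.1, e' z.2))
      (a₀, y₀) :=
    contMDiffAt_fst.prodMk_space (contMDiffAt_extChartAt.comp (a₀, y₀) contMDiffAt_snd)
  have hψE : ContMDiffAt (𝓘(ℝ, P).prod I) 𝓘(ℝ, E) ∞ (fun z : P × N ↦ Ψ (z.1, e' z.2))
      (a₀, y₀) :=
    ContMDiffAt.comp (g := Ψ) (a₀, y₀) hΨ.contMDiffAt hc'
  have hψ : ContMDiffAt (𝓘(ℝ, P).prod I) I ∞ (fun z : P × N ↦ e.symm (Ψ (z.1, e' z.2)))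
      (a₀, y₀) := by
    have h1 : ContMDiffAt 𝓘(ℝ, E) I ∞ e.symm (Ψ (a₀, e' y₀)) := by
      rw [hΨ0]
      exact (contMDiffOn_extChartAt_symm x₀).contMDiffAt
        ((isOpen_extChartAt_target x₀).mem_nhds (mem_extChartAt_target x₀))
    exact ContMDiffAt.comp (g := e.symm) (a₀, y₀) h1 hψE
  have hψ0 : e.symm (Ψ (a₀, e' y₀)) = x₀ := by rw [hΨ0]; exact extChartAt_to_inv x₀
  refine ⟨fun z ↦ e.symm (Ψ (z.1, e' z.2)), hψ, hψ0, ?_, ?_⟩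
  · have hfc : ContinuousAt (fun z : P × N ↦ f (z.1, e.symm (Ψ (z.1, e' z.2)))) (a₀, y₀) := by
      refine ContinuousAt.comp (g := f) ?_ (continuousAt_fst.prodMk hψ.continuousAt)
      simp only [hψ0]
      exact hf.continuousAt
    have h1 : ∀ᶠ z in 𝓝 (a₀, y₀), f (z.1, e.symm (Ψ (z.1, e' z.2))) ∈ e'.source := by
      refine hfc.eventually_mem ((isOpen_extChartAt_source y₀).mem_nhds ?_)
      simp only [hψ0]
      exact hys
    have h2 : ∀ᶠ z : P × N in 𝓝 (a₀, y₀), z.2 ∈ e'.source :=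
      continuousAt_snd.eventually_mem ((isOpen_extChartAt_source y₀).mem_nhds hys)
    filter_upwards [h1, h2, hc'.continuousAt.eventually hΨ1] with z hz1 hz2 hz3
    rw [hFu] at hz3
    exact e'.injOn hz1 hz2 (sub_eq_zero.1 hz3)
  · have h1 : ContinuousAt (fun z : P × N ↦ (((z.1, e' (f z)), e z.2) : (P × E) × E))
        (a₀, x₀) := by
      refine (continuousAt_fst.prodMk ?_).prodMk ?_
      · exact ContinuousAt.comp (g := e') (continuousAt_extChartAt y₀) hf.continuousAt
      · exact ContinuousAt.comp (g := e) (continuousAt_extChartAt x₀) continuousAt_snd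
    have h2 : ∀ᶠ z : P × N in 𝓝 (a₀, x₀), z.2 ∈ e.source :=
      continuousAt_snd.eventually_mem
        ((isOpen_extChartAt_source x₀).mem_nhds (mem_extChartAt_source x₀))
    filter_upwards [h1.eventually hΨ2, h2] with z hz1 hz2
    have h3 : F ((z.1, e' (f z)), e z.2) = F u := by
      rw [hFu]
      change e' (f (z.1, e.symm (e z.2))) - e' (f z) = 0
      rw [e.left_inv hz2, sub_self]
    change e.symm (Ψ (z.1, e' (f z))) = z.2
    rw [hz1.1 h3]
    exact e.left_inv hz2

-- Differentiating the identity `ψ(a, f(a, x)) = x` in `x` gives the differential of `f(a, ·)` a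
-- left inverse.
omit [FiniteDimensional ℝ E] [I.Boundaryless] in
lemma eventually_injective_mfderiv {f ψ : P × N → N} {a₀ : P} {x₀ : N}
    (hf : ∀ᶠ z in 𝓝 (a₀, x₀), ContMDiffAt (𝓘(ℝ, P).prod I) I 1 f z)
    (hψ : ContMDiffAt (𝓘(ℝ, P).prod I) I ∞ ψ (a₀, f (a₀, x₀)))
    (hinv : ∀ᶠ z in 𝓝 (a₀, x₀), ψ (z.1, f z) = z.2) :
    ∀ᶠ z in 𝓝 (a₀, x₀), Function.Injective (mfderiv I I (fun x ↦ f (z.1, x)) z.2) := by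
  have : IsManifold I 1 N := IsManifold.of_le (n := ∞) (by simp)
  have h1 : ∀ᶠ z in 𝓝 (a₀, f (a₀, x₀)), ContMDiffAt (𝓘(ℝ, P).prod I) I 1 ψ z :=
    (contMDiffAt_iff_contMDiffAt_nhds (by simp)).1 (hψ.of_le (by simp))
  have h2 : ContinuousAt (fun z : P × N ↦ (z.1, f z)) (a₀, x₀) :=
    continuousAt_fst.prodMk hf.self_of_nhds.continuousAt
  filter_upwards [hf, h2.eventually h1, eventually_eventually_nhds.2 hinv] with z hz1 hz2 hz3
  have d1 : MDifferentiableAt I I (fun x ↦ f (z.1, x)) z.2 :=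
    (hz1.comp z.2 (contMDiffAt_const.prodMk contMDiffAt_id)).mdifferentiableAt (by simp)
  have d2 : MDifferentiableAt I I (fun y ↦ ψ (z.1, y)) (f (z.1, z.2)) :=
    (hz2.comp (f z) (contMDiffAt_const.prodMk contMDiffAt_id)).mdifferentiableAt (by simp)
  have h3 := d2.hasMFDerivAt.comp z.2 d1.hasMFDerivAt
  have hcur : Continuous fun x : N ↦ (z.1, x) := by fun_prop
  have h4 : id =ᶠ[𝓝 z.2] (fun y ↦ ψ (z.1, y)) ∘ fun x ↦ f (z.1, x) := by
    filter_upwards [(hcur.tendsto z.2).eventually hz3] with x hx using hx.symm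
  have h5 := (h3.congr_of_eventuallyEq h4).mfderiv
  rw [mfderiv_id] at h5
  intro w w' h
  have h6 := DFunLike.congr_fun h5 w
  have h7 := DFunLike.congr_fun h5 w'
  refine h6.trans (Eq.trans ?_ h7.symm)
  exact congrArg (mfderiv I I (fun y ↦ ψ (z.1, y)) (f (z.1, z.2))) h

/-- On a compact manifold, a small smooth perturbation of a diffeomorphism is a diffeomorphism. -/
theorem eventually_exists_diffeomorph [CompleteSpace P] [CompactSpace N] [T2Space N]
    {f : P × N → N} {a₀ : P}
    (hf : ∀ᶠ a in 𝓝 a₀, ∀ x, ContMDiffAt (𝓘(ℝ, P).prod I) I ∞ f (a, x))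
    (φ : N ≃ₘ^∞⟮I, I⟯ N) (hφ : ∀ x, f (a₀, x) = φ x) :
    ∀ᶠ a in 𝓝 a₀, ∃ ψ : N ≃ₘ^∞⟮I, I⟯ N, ∀ x, f (a, x) = ψ x := by
  have hf0 : ∀ x, ContMDiffAt (𝓘(ℝ, P).prod I) I ∞ f (a₀, x) := hf.self_of_nhds
  have hfn : ∀ x, ∀ᶠ z in 𝓝 (a₀, x), ContMDiffAt (𝓘(ℝ, P).prod I) I 1 f z := fun x ↦ by
    filter_upwards [(continuous_fst.tendsto (a₀, x)).eventually hf] with z hz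
    exact (hz z.2).of_le (by simp)
  have hinj0 : ∀ x, Function.Injective (mfderiv I I (fun x ↦ f (a₀, x)) x) := fun x ↦ by
    rw [show (fun x ↦ f (a₀, x)) = φ from funext hφ]
    exact (φ.mfderivToContinuousLinearEquiv (by simp) x).injective
  choose ψ hψ hψ0 hψ1 hψ2 using fun x ↦ exists_local_inverse_family (hf0 x) (hinj0 x)
  have c1 : ∀ᶠ a in 𝓝 a₀, ∀ x ∈ (univ : Set N),
      Function.Injective (mfderiv I I (fun x ↦ f (a, x)) x) :=
    isCompact_univ.eventually_forall_of_forall_eventually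
      (P := fun a x ↦ Function.Injective (mfderiv I I (fun x ↦ f (a, x)) x))
      fun x _ ↦ eventually_injective_mfderiv (hfn x) (hψ x) (hψ2 x)
  -- Local right inverses exist around every target point, and finitely many of their neighbourhoods
  -- cover `N`.
  have c2 : ∀ᶠ a in 𝓝 a₀, ∀ y ∈ (univ : Set N), ∃ x, f (a, x) = y := by
    refine isCompact_univ.eventually_forall_of_forall_eventually
      (P := fun a y ↦ ∃ x, f (a, x) = y) fun y _ ↦ ?_
    have h := hψ1 (φ.symm y)
    rw [hφ, φ.apply_symm_apply] at h
    filter_upwards [h] with z hz using ⟨_, hz⟩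
  -- Global injectivity by compactness of `N × N`: near the diagonal one local left inverse serves
  -- both points, and off the diagonal the values at `a₀` are separated by disjoint open sets.
  have c3 : ∀ᶠ a in 𝓝 a₀, ∀ q ∈ (univ : Set (N × N)), f (a, q.1) = f (a, q.2) → q.1 = q.2 := by
    refine isCompact_univ.eventually_forall_of_forall_eventually
      (P := fun a (q : N × N) ↦ f (a, q.1) = f (a, q.2) → q.1 = q.2) fun q _ ↦ ?_
    have t1 : Tendsto (fun z : P × (N × N) ↦ (z.1, z.2.1)) (𝓝 (a₀, q)) (𝓝 (a₀, q.1)) :=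
      Continuous.tendsto (by fun_prop) _
    have t2 : Tendsto (fun z : P × (N × N) ↦ (z.1, z.2.2)) (𝓝 (a₀, q)) (𝓝 (a₀, q.2)) :=
      Continuous.tendsto (by fun_prop) _
    by_cases hq : q.1 = q.2
    · rw [← hq] at t2
      filter_upwards [t1.eventually (hψ2 q.1), t2.eventually (hψ2 q.1)] with z h1 h2 h3
      rw [← h1, ← h2, h3]
    · have hne : f (a₀, q.1) ≠ f (a₀, q.2) := by
        rw [hφ, hφ]
        exact φ.injective.ne hq
      obtain ⟨u, v, hu, hv, hqu, hqv, huv⟩ := t2_separation hne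
      have e1 := ((hf0 q.1).continuousAt.tendsto.comp t1).eventually (hu.mem_nhds hqu)
      have e2 := ((hf0 q.2).continuousAt.tendsto.comp t2).eventually (hv.mem_nhds hqv)
      filter_upwards [e1, e2] with z h1 h2 h3
      exact absurd h3 (huv.ne_of_mem h1 h2)
  filter_upwards [hf, c1, c2, c3] with a ha h1 h2 h3
  have hbij : Function.Bijective fun x ↦ f (a, x) :=
    ⟨fun x x' h ↦ h3 (x, x') trivial h, fun y ↦ h2 y trivial⟩
  let eqv := Equiv.ofBijective _ hbij
  refine ⟨⟨eqv, fun x ↦ ?_, fun y ↦ ?_⟩, fun x ↦ rfl⟩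
  · exact (ha x).comp x (contMDiffAt_const.prodMk contMDiffAt_id)
  · obtain ⟨x, rfl⟩ := eqv.surjective y
    -- Near `f(a, x)` the inverse of the bijection coincides with the smooth local inverse.
    obtain ⟨χ, hχ, -, hχ1, -⟩ := exists_local_inverse_family (ha x) (h1 x trivial)
    have h4 : ContMDiffAt I I ∞ (fun y ↦ χ (a, y)) (f (a, x)) :=
      hχ.comp (f (a, x)) (contMDiffAt_const.prodMk contMDiffAt_id)
    refine h4.congr_of_eventuallyEq ?_
    have hcur : Continuous fun y : N ↦ (a, y) := by fun_prop
    filter_upwards [(hcur.tendsto (f (a, x))).eventually hχ1] with y hy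
    exact (Equiv.symm_apply_eq eqv).2 hy.symm

end Perturbation

section

variable {n : ℕ} {M : Type*} [TopologicalSpace M] [ChartedSpace (EuclideanSpace ℝ (Fin n)) M]
  [IsManifold (𝓡 n) ∞ M]

/-! ### Orientation and the openness of `TD` -/

section Orientation

open Filter Topology

lemma alternatingMap_ne_zero_iff_linearIndependent {V : Type*} [AddCommGroup V] [Module ℝ V]
    (hV : Module.finrank ℝ V = n) [FiniteDimensional ℝ V]
    {A : V [⋀^Fin n]→ₗ[ℝ] ℝ} (hA : A ≠ 0) (w : Fin n → V) :
    A w ≠ 0 ↔ LinearIndependent ℝ w := by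
  constructor
  · intro h
    by_contra hw
    exact h (A.map_linearDependent w hw)
  · intro h
    have hs : ⊤ ≤ Submodule.span ℝ (range w) :=
      (h.span_eq_top_of_card_eq_finrank' (by simp [hV])).ge
    have h2 := (AlternatingMap.map_basis_ne_zero_iff (Module.Basis.mk h hs) A).2 hA
    rwa [Module.Basis.coe_mk] at h2

/-- Forms of top degree are multiples of the determinant. Continuity of the volume form on moving
frames thereby reduces to that of a coefficient and a determinant. -/
lemma VolumeForm.apply_symm_eq_coeff_mul_det (vol : VolumeForm n M) {x₀ : M}
    {y : EuclideanSpace ℝ (Fin n)} (hy : y ∈ (extChartAt (𝓡 n) x₀).target)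
    (u : Fin n → TangentSpace (𝓡 n) ((extChartAt (𝓡 n) x₀).symm y)) :
    vol.form _ u = vol.coeff x₀ y *
      (EuclideanSpace.basisFun (Fin n) ℝ).toBasis.det (fun i ↦ chartDeriv (𝓡 n) x₀ _ (u i)) := by
  have : IsManifold (𝓡 n) 1 M := IsManifold.of_le (n := ∞) (by simp)
  let A : (EuclideanSpace ℝ (Fin n)) [⋀^Fin n]→ₗ[ℝ] ℝ :=
    (vol.form ((extChartAt (𝓡 n) x₀).symm y)).compLinearMap
      (chartSymmDeriv (𝓡 n) x₀ y).toLinearMap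
  have hA := A.eq_smul_basis_det (EuclideanSpace.basisFun (Fin n) ℝ).toBasis
  have h1 : A (EuclideanSpace.basisFun (Fin n) ℝ).toBasis = vol.coeff x₀ y := by
    change vol.form ((extChartAt (𝓡 n) x₀).symm y) _ = vol.form _ _
    congr 1
    funext i
    change chartSymmDeriv (𝓡 n) x₀ y ((EuclideanSpace.basisFun (Fin n) ℝ).toBasis i)
      = chartSymmDeriv (𝓡 n) x₀ y _
    simp
  have h2 : A (fun i ↦ chartDeriv (𝓡 n) x₀ _ (u i)) = vol.form _ u := by
    change vol.form ((extChartAt (𝓡 n) x₀).symm y) _ = vol.form _ _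
    congr 1
    funext i
    exact chartSymmDeriv_chartDeriv hy (u i)
  rw [← h2, hA, h1]
  rfl

lemma VolumeForm.apply_eq_coeff_mul_det (vol : VolumeForm n M) {x₀ z : M}
    (hz : z ∈ (extChartAt (𝓡 n) x₀).source) (u : Fin n → TangentSpace (𝓡 n) z) :
    vol.form z u = vol.coeff x₀ (extChartAt (𝓡 n) x₀ z) *
      (EuclideanSpace.basisFun (Fin n) ℝ).toBasis.det (fun i ↦ chartDeriv (𝓡 n) x₀ z (u i)) := by
  obtain ⟨y, hy, rfl⟩ : ∃ y ∈ (extChartAt (𝓡 n) x₀).target, (extChartAt (𝓡 n) x₀).symm y = z :=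
    ⟨_, (extChartAt (𝓡 n) x₀).map_source hz, (extChartAt (𝓡 n) x₀).left_inv hz⟩
  rw [(extChartAt (𝓡 n) x₀).right_inv hy]
  exact vol.apply_symm_eq_coeff_mul_det hy u

/-! ### Orientation and membership in `TD` along smooth families -/

variable {P : Type*} [NormedAddCommGroup P] [NormedSpace ℝ P]

lemma VolumeForm.continuousAt_apply_mfderiv (vol : VolumeForm n M) {f : P × M → M} {a : P} {x : M}
    (hf : ContMDiffAt (𝓘(ℝ, P).prod (𝓡 n)) (𝓡 n) ∞ f (a, x))
    (w : Fin n → TangentSpace (𝓡 n) x) :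
    ContinuousAt (fun b ↦ vol.form (f (b, x))
      (fun i ↦ mfderiv (𝓡 n) (𝓡 n) (fun z ↦ f (b, z)) x (w i))) a := by
  have : IsManifold (𝓡 n) 1 M := IsManifold.of_le (n := ∞) (by simp)
  set y := f (a, x) with hy
  have hcur : ContinuousAt (fun b : P ↦ (b, x)) a := by fun_prop
  have hfc : ContinuousAt (fun b ↦ f (b, x)) a :=
    ContinuousAt.comp (g := f) hf.continuousAt hcur
  have hs : ∀ᶠ b in 𝓝 a, f (b, x) ∈ (extChartAt (𝓡 n) y).source :=
    hfc.eventually_mem ((isOpen_extChartAt_source y).mem_nhds (mem_extChartAt_source y))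
  have h1 : ∀ᶠ z in 𝓝 (a, x), ContMDiffAt (𝓘(ℝ, P).prod (𝓡 n)) (𝓡 n) 1 f z :=
    (contMDiffAt_iff_contMDiffAt_nhds (by simp)).1 (hf.of_le (by simp))
  have hF := contDiffAt_familyInChart le_rfl hf (mem_extChartAt_source y)
  have hF' : ContinuousAt (fun b : P ↦ fderiv ℝ (familyInChart (𝓡 n) f x y)
      (b, extChartAt (𝓡 n) x x)) a := by
    refine ContinuousAt.comp (g := fderiv ℝ (familyInChart (𝓡 n) f x y)) ?_ (by fun_prop)
    exact (hF.fderiv_right (m := 0) (by simp)).continuousAt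
  have hcoeff : ContinuousAt (fun b ↦ vol.coeff y (extChartAt (𝓡 n) y (f (b, x)))) a := by
    refine ContinuousAt.comp (g := vol.coeff y) ?_
      (ContinuousAt.comp (g := extChartAt (𝓡 n) y) (continuousAt_extChartAt y) hfc)
    exact (vol.smooth_coeff y).continuousOn.continuousAt
      ((isOpen_extChartAt_target y).mem_nhds (mem_extChartAt_target y))
  have hdet : ContinuousAt (fun b ↦ (EuclideanSpace.basisFun (Fin n) ℝ).toBasis.det
      (fun i ↦ fderiv ℝ (familyInChart (𝓡 n) f x y) (b, extChartAt (𝓡 n) x x)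
        ((0, w i) : P × EuclideanSpace ℝ (Fin n)))) a := by
    have hd : Continuous fun v : Fin n → EuclideanSpace ℝ (Fin n) ↦
        (EuclideanSpace.basisFun (Fin n) ℝ).toBasis.det v := by
      simp only [Module.Basis.det_apply]
      refine Continuous.matrix_det (continuous_matrix fun i j ↦ ?_)
      simp only [Module.Basis.toMatrix_apply, OrthonormalBasis.coe_toBasis_repr_apply,
        EuclideanSpace.basisFun_repr]
      fun_prop
    refine hd.continuousAt.comp (f := fun b i ↦ fderiv ℝ (familyInChart (𝓡 n) f x y)
      (b, extChartAt (𝓡 n) x x) ((0, w i) : P × EuclideanSpace ℝ (Fin n))) ?_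
    exact continuousAt_pi.2 fun i ↦ hF'.clm_apply continuousAt_const
  refine (hcoeff.mul hdet).congr ?_
  filter_upwards [hs, hcur.eventually h1] with b hb hb1
  rw [vol.apply_eq_coeff_mul_det hb]
  exact congrArg (fun v ↦ vol.coeff y (extChartAt (𝓡 n) y (f (b, x))) *
    (EuclideanSpace.basisFun (Fin n) ℝ).toBasis.det v)
    (funext fun i ↦ fderiv_familyInChart hb1 hb (w i))

omit [IsManifold (𝓡 n) ∞ M] in
lemma VolumeForm.apply_mfderiv_ne_zero_iff (vol : VolumeForm n M) (φ : M ≃ₘ^∞⟮𝓡 n, 𝓡 n⟯ M)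
    (x : M) (w : Fin n → TangentSpace (𝓡 n) x) :
    vol.form (φ x) (fun i ↦ mfderiv (𝓡 n) (𝓡 n) φ x (w i)) ≠ 0 ↔ vol.form x w ≠ 0 := by
  have hfin : Module.finrank ℝ (EuclideanSpace ℝ (Fin n)) = n := by simp
  have h1 := alternatingMap_ne_zero_iff_linearIndependent (V := EuclideanSpace ℝ (Fin n)) hfin
    (vol.form_ne_zero x) w
  have h2 := alternatingMap_ne_zero_iff_linearIndependent (V := EuclideanSpace ℝ (Fin n)) hfin
    (vol.form_ne_zero (φ x)) (fun i ↦ mfderiv (𝓡 n) (𝓡 n) φ x (w i))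
  refine h2.trans (Iff.trans ?_ h1.symm)
  let L : EuclideanSpace ℝ (Fin n) ≃L[ℝ] EuclideanSpace ℝ (Fin n) :=
    φ.mfderivToContinuousLinearEquiv (by simp) x
  exact L.toLinearMap.linearIndependent_iff (v := w) (LinearMap.ker_eq_bot.2 L.injective)

/-- On a ball of parameters all maps are diffeomorphisms, so the volume of the image of a frame with
nonzero volume never vanishes there; being continuous on a connected set, it keeps its sign. Frames
of volume zero have images of volume zero. -/
theorem eventually_isOrientationPreserving [CompleteSpace P] [CompactSpace M] [T2Space M]
    (vol : VolumeForm n M) {f : P × M → M} {a₀ : P}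
    (hf : ∀ᶠ a in 𝓝 a₀, ∀ x, ContMDiffAt (𝓘(ℝ, P).prod (𝓡 n)) (𝓡 n) ∞ f (a, x))
    (φ : M ≃ₘ^∞⟮𝓡 n, 𝓡 n⟯ M) (hφ : ∀ x, f (a₀, x) = φ x) (hor : IsOrientationPreserving vol φ) :
    ∀ᶠ a in 𝓝 a₀, ∃ ψ : M ≃ₘ^∞⟮𝓡 n, 𝓡 n⟯ M, IsOrientationPreserving vol ψ ∧
      ∀ x, f (a, x) = ψ x := by
  obtain ⟨ε, hε, hball⟩ := Metric.eventually_nhds_iff_ball.1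
    (hf.and (eventually_exists_diffeomorph hf φ hφ))
  filter_upwards [Metric.ball_mem_nhds a₀ hε] with a ha
  obtain ⟨ψ, hψ⟩ := (hball a ha).2
  refine ⟨ψ, fun x w ↦ ?_, hψ⟩
  let r : P → ℝ := fun b ↦ vol.form (f (b, x))
      (fun i ↦ mfderiv (𝓡 n) (𝓡 n) (fun z ↦ f (b, z)) x (w i))
  have hr : ∀ (b : P) (χ : M ≃ₘ^∞⟮𝓡 n, 𝓡 n⟯ M), (∀ x, f (b, x) = χ x) →
      r b = vol.form (χ x) (fun i ↦ mfderiv (𝓡 n) (𝓡 n) χ x (w i)) := by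
    intro b χ hχ
    have : (fun z ↦ f (b, z)) = χ := funext hχ
    change vol.form ((fun z ↦ f (b, z)) x)
      (fun i ↦ mfderiv (𝓡 n) (𝓡 n) (fun z ↦ f (b, z)) x (w i)) = _
    rw [this]
    rfl
  rw [← hr a ψ hψ, hor x w, ← hr a₀ φ hφ]
  by_cases hw : vol.form x w = 0
  · have h1 : r a = 0 := by
      rw [hr a ψ hψ]
      exact not_not.1 (mt (vol.apply_mfderiv_ne_zero_iff ψ x w).1 (not_not.2 hw))
    have h2 : r a₀ = 0 := by
      rw [hr a₀ φ hφ]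
      exact not_not.1 (mt (vol.apply_mfderiv_ne_zero_iff φ x w).1 (not_not.2 hw))
    rw [h1, h2]
  · have hpre : IsPreconnected (Metric.ball a₀ ε) := (convex_ball a₀ ε).isPreconnected
    have hcont : ContinuousOn r (Metric.ball a₀ ε) := fun b hb ↦
      (vol.continuousAt_apply_mfderiv ((hball b hb).1 x) w).continuousWithinAt
    have hne : ∀ b ∈ Metric.ball a₀ ε, r b ≠ 0 := by
      intro b hb
      obtain ⟨χ, hχ⟩ := (hball b hb).2
      rw [hr b χ hχ]
      exact (vol.apply_mfderiv_ne_zero_iff χ x w).2 hw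
    have key : ∀ b ∈ Metric.ball a₀ ε, ∀ b' ∈ Metric.ball a₀ ε, 0 < r b → 0 < r b' := by
      intro b hb b' hb' h
      by_contra hn
      have := hpre.intermediate_value hb' hb hcont
      obtain ⟨b'', hb'', h0⟩ := this ⟨not_lt.1 hn, h.le⟩
      exact hne b'' hb'' h0
    exact ⟨key a₀ (Metric.mem_ball_self hε) a ha, key a ha a₀ (Metric.mem_ball_self hε)⟩

omit [IsManifold (𝓡 n) ∞ M] in
lemma tangentBundle_mk_snd {v : TangentBundle (𝓡 n) M} {y : M} (h : v.proj = y) :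
    (⟨y, v.snd⟩ : TangentBundle (𝓡 n) M) = v := by
  subst h
  rfl

/-- A smooth lift of an orientation preserving diffeomorphism to the tangent bundle is in `TD`. -/
lemma mem_tDiff {vol : VolumeForm n M} {V : M → TangentBundle (𝓡 n) M}
    (hV : ContMDiff (𝓡 n) (𝓡 n).tangent ∞ V) (ψ : M ≃ₘ^∞⟮𝓡 n, 𝓡 n⟯ M)
    (hor : IsOrientationPreserving vol ψ) (hψ : ∀ x, (V x).proj = ψ x) : V ∈ TDiff vol := by
  have hX : ∀ y, (⟨y, (V (ψ.symm y)).snd⟩ : TangentBundle (𝓡 n) M) = V (ψ.symm y) := fun y ↦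
    tangentBundle_mk_snd (by rw [hψ, ψ.apply_symm_apply])
  refine ⟨⟨fun y ↦ (V (ψ.symm y)).snd, ?_⟩, ψ, hor, ?_⟩
  · rw [show (fun y ↦ (⟨y, (V (ψ.symm y)).snd⟩ : TangentBundle (𝓡 n) M)) = V ∘ ψ.symm from
      funext hX]
    exact hV.comp ψ.symm.contMDiff
  · funext x
    refine Eq.trans ?_ (hX (ψ x)).symm
    rw [ψ.symm_apply_apply]

/-- `TD` is open: a small smooth perturbation of an element of `TD` is in `TD`. -/
theorem eventually_mem_tDiff [CompleteSpace P] [CompactSpace M] [T2Space M]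
    (vol : VolumeForm n M) {V : P → M → TangentBundle (𝓡 n) M} {a₀ : P}
    (hV : ∀ᶠ a in 𝓝 a₀, ∀ x, ContMDiffAt (𝓘(ℝ, P).prod (𝓡 n)) (𝓡 n).tangent ∞
      (fun p : P × M ↦ V p.1 p.2) (a, x)) (h₀ : V a₀ ∈ TDiff vol) :
    ∀ᶠ a in 𝓝 a₀, V a ∈ TDiff vol := by
  obtain ⟨X, φ, hor, hφ⟩ := h₀
  have hf : ∀ᶠ a in 𝓝 a₀, ∀ x, ContMDiffAt (𝓘(ℝ, P).prod (𝓡 n)) (𝓡 n) ∞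
      (fun p : P × M ↦ (V p.1 p.2).proj) (a, x) := by
    filter_upwards [hV] with a ha x
    exact (contMDiff_tangentBundle_proj _).comp (a, x) (ha x)
  filter_upwards [hV, eventually_isOrientationPreserving vol hf φ
    (fun x ↦ by simp only [hφ]; rfl) hor] with a ha ⟨ψ, hor', hψ⟩
  exact mem_tDiff (fun x ↦ (ha x).comp x (contMDiffAt_const.prodMk contMDiffAt_id)) ψ hor' hψ

lemma contMDiff_of_mem_tDiff {vol : VolumeForm n M} {V : M → TangentBundle (𝓡 n) M}
    (hV : V ∈ TDiff vol) : ContMDiff (𝓡 n) (𝓡 n).tangent ∞ V := by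
  obtain ⟨X, φ, -, rfl⟩ := hV
  exact X.contMDiff.comp φ.contMDiff

end Orientation

/-! ### Integrals of smooth families -/

section Integrals

open Filter Topology

lemma VolumeForm.coeff_ne_zero (vol : VolumeForm n M) {x₀ : M} {y : EuclideanSpace ℝ (Fin n)}
    (hy : y ∈ (extChartAt (𝓡 n) x₀).target) : vol.coeff x₀ y ≠ 0 := by
  intro h
  refine vol.form_ne_zero ((extChartAt (𝓡 n) x₀).symm y) ?_
  ext u
  rw [vol.apply_symm_eq_coeff_mul_det hy, h, zero_mul]
  rfl

/-- The measure dominates each local measure, and a local measure has a nowhere vanishing continuous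
density. This full support is what allows pointwise conclusions from vanishing integrals. -/
lemma VolumeForm.isOpenPosMeasure [MeasurableSpace M] [BorelSpace M] (vol : VolumeForm n M) :
    vol.measure.IsOpenPosMeasure := by
  refine ⟨fun U hU ⟨x₀, hx₀⟩ h0 ↦ ?_⟩
  set e := extChartAt (𝓡 n) x₀
  have hto : IsOpen e.target := isOpen_extChartAt_target x₀
  have hes : ContinuousOn e.symm e.target := continuousOn_extChartAt_symm x₀
  set f : EuclideanSpace ℝ (Fin n) → ENNReal := fun y ↦ ENNReal.ofReal |vol.coeff x₀ y|
  set ρ := (volume.withDensity f).restrict e.target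
  have hS : IsOpen (e.target ∩ e.symm ⁻¹' U) := hes.isOpen_inter_preimage hto hU
  have hS0 : e x₀ ∈ e.target ∩ e.symm ⁻¹' U :=
    ⟨mem_extChartAt_target x₀, by simpa [e] using hx₀⟩
  have h1 : ρ.map e.symm U = 0 :=
    le_antisymm ((Measure.le_iff'.1 (le_iSup (fun x₀ : M ↦ Measure.map (extChartAt (𝓡 n) x₀).symm
      ((volume.withDensity fun y ↦ ENNReal.ofReal |vol.coeff x₀ y|).restrict
      (extChartAt (𝓡 n) x₀).target)) x₀) U).trans h0.le) bot_le
  rw [Measure.map_apply_of_aemeasurable (hes.aemeasurable hto.measurableSet) hU.measurableSet,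
    Measure.restrict_apply' hto.measurableSet, inter_comm,
    withDensity_apply _ hS.measurableSet] at h1
  have hf : AEMeasurable f (volume.restrict (e.target ∩ e.symm ⁻¹' U)) := by
    refine ContinuousOn.aemeasurable ?_ hS.measurableSet
    exact ENNReal.continuous_ofReal.comp_continuousOn
      (((vol.smooth_coeff x₀).continuousOn.mono inter_subset_left).abs)
  rw [lintegral_eq_zero_iff' hf] at h1
  have h2 : ∀ᵐ y ∂volume.restrict (e.target ∩ e.symm ⁻¹' U), False := by
    filter_upwards [h1, ae_restrict_mem hS.measurableSet] with y hy hyS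
    have := abs_pos.2 (vol.coeff_ne_zero hyS.1)
    simp only [f, Pi.zero_apply, ENNReal.ofReal_eq_zero] at hy
    linarith
  rw [ae_restrict_iff' hS.measurableSet] at h2
  have h3 : volume (e.target ∩ e.symm ⁻¹' U) = 0 :=
    measure_mono_null (fun y hy ↦ by simpa using hy) h2
  exact (hS.measure_pos volume ⟨_, hS0⟩).ne' h3

variable {W V : Type*} [NormedAddCommGroup W] [NormedSpace ℝ W] [NormedAddCommGroup V]
  [NormedSpace ℝ V]

lemma contMDiffAt_fderiv_param {F : W × M → V} {p₀ : W × M}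
    (hF : ContMDiffAt (𝓘(ℝ, W).prod (𝓡 n)) 𝓘(ℝ, V) ∞ F p₀) :
    ContMDiffAt (𝓘(ℝ, W).prod (𝓡 n)) 𝓘(ℝ, W →L[ℝ] V) ∞
      (fun p ↦ fderiv ℝ (fun z ↦ F (z, p.2)) p.1) p₀ := by
  have h := ContMDiffAt.mfderiv (I := 𝓘(ℝ, W)) (I' := 𝓘(ℝ, V)) (J := 𝓘(ℝ, W).prod (𝓡 n))
    (m := ∞) (n := ∞) (x₀ := p₀) (fun (p : W × M) (z : W) ↦ F (z, p.2)) Prod.fst ?_ contMDiffAt_fst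
    (by simp)
  · have h2 := inTangentCoordinates_model_space (I := 𝓘(ℝ, W)) (I' := 𝓘(ℝ, V))
      (Prod.fst : W × M → W) F (fun p : W × M ↦ fderiv ℝ (fun z ↦ F (z, p.2)) p.1) p₀
    simp only [mfderiv_eq_fderiv] at h
    exact (congrArg (fun φ : W × M → W →L[ℝ] V ↦
      ContMDiffAt (𝓘(ℝ, W).prod (𝓡 n)) 𝓘(ℝ, W →L[ℝ] V) ∞ φ p₀) h2).mp h
  · have h2 : ContMDiffAt ((𝓘(ℝ, W).prod (𝓡 n)).prod 𝓘(ℝ, W)) (𝓘(ℝ, W).prod (𝓡 n)) ∞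
        (fun q : (W × M) × W ↦ (q.2, q.1.2)) (p₀, p₀.1) :=
      contMDiffAt_snd.prodMk (contMDiffAt_snd.comp (p₀, p₀.1) contMDiffAt_fst)
    exact ContMDiffAt.comp (g := F) (p₀, p₀.1) hF h2

omit [IsManifold (𝓡 n) ∞ M] in
lemma contMDiffAt_slice {EN HN N : Type*} [NormedAddCommGroup EN] [NormedSpace ℝ EN]
    [TopologicalSpace HN] {J : ModelWithCorners ℝ EN HN} [TopologicalSpace N] [ChartedSpace HN N]
    {k : ℕ∞ω} {F : W × M → N} {z : W} {x : M}
    (hF : ContMDiffAt (𝓘(ℝ, W).prod (𝓡 n)) J k F (z, x)) :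
    ContMDiffAt 𝓘(ℝ, W) J k (fun z ↦ F (z, x)) z :=
  hF.comp z (contMDiffAt_id.prodMk contMDiffAt_const)

/-- Differentiation under the integral sign; the dominating constant is the bound of the continuous
derivative on the compact set `[-1, 1] × M`. -/
lemma hasDerivAt_integral_of_contMDiff [CompactSpace M] [MeasurableSpace M] [BorelSpace M]
    {μ : Measure M} [IsFiniteMeasure μ] [FiniteDimensional ℝ W] {F : W × M → ℝ}
    (hF : ContMDiff (𝓘(ℝ, W).prod (𝓡 n)) 𝓘(ℝ, ℝ) ∞ F) (z a : W) :
    HasDerivAt (fun s : ℝ ↦ ∫ x, F (z + s • a, x) ∂μ)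
      (∫ x, fderiv ℝ (fun z ↦ F (z, x)) z a ∂μ) 0 := by
  have hD : Continuous fun p : W × M ↦ fderiv ℝ (fun z ↦ F (z, p.2)) p.1 :=
    ContMDiff.continuous (I := 𝓘(ℝ, W).prod (𝓡 n)) (I' := 𝓘(ℝ, W →L[ℝ] ℝ)) (n := ∞)
      fun p ↦ contMDiffAt_fderiv_param (hF p)
  have hG : Continuous fun p : ℝ × M ↦ fderiv ℝ (fun z ↦ F (z, p.2)) (z + p.1 • a) a :=
    (hD.comp (f := fun p : ℝ × M ↦ (z + p.1 • a, p.2)) (by fun_prop)).clm_apply continuous_const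
  obtain ⟨C, hC⟩ := ((isCompact_closedBall (0 : ℝ) 1).prod
    (isCompact_univ (X := M))).exists_bound_of_continuousOn hG.continuousOn
  have hFc : ∀ s : ℝ, Continuous fun x ↦ F (z + s • a, x) := fun s ↦
    hF.continuous.comp (by fun_prop)
  have key := (hasDerivAt_integral_of_dominated_loc_of_deriv_le (μ := μ) (x₀ := (0 : ℝ))
    (s := Metric.closedBall 0 1) (bound := fun _ ↦ C) (F := fun s x ↦ F (z + s • a, x))
    (F' := fun s x ↦ fderiv ℝ (fun z ↦ F (z, x)) (z + s • a) a)
    (Metric.closedBall_mem_nhds 0 one_pos)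
    (Eventually.of_forall fun s ↦ (hFc s).aestronglyMeasurable)
    ((hFc 0).integrable_of_hasCompactSupport (HasCompactSupport.of_compactSpace _))
    (Continuous.aestronglyMeasurable (hG.comp (f := fun x : M ↦ ((0 : ℝ), x)) (by fun_prop)))
    (ae_of_all _ fun x s hs ↦ hC (s, x) ⟨hs, trivial⟩) (integrable_const C)
    (ae_of_all _ fun x s _ ↦ ?_)).2
  · simpa only [zero_smul, add_zero] using key
  · have h1 : DifferentiableAt ℝ (fun z ↦ F (z, x)) (z + s • a) :=
      (contMDiffAt_slice (hF (z + s • a, x))).contDiffAt.differentiableAt (by simp)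
    have h2 : HasDerivAt (fun s : ℝ ↦ z + s • a) a s := by
      simpa using ((hasDerivAt_id s).smul_const a).const_add z
    exact h1.hasFDerivAt.comp_hasDerivAt s h2

lemma contMDiff_pullbackLiouville (g : Metric n M) {σ : W → M → TangentBundle (𝓡 n) M}
    (hσ : ContMDiff (𝓘(ℝ, W).prod (𝓡 n)) (𝓡 n).tangent ∞ (fun p : W × M ↦ σ p.1 p.2)) :
    ContMDiff (𝓘(ℝ, W).prod (𝓡 n)) 𝓘(ℝ, W →L[ℝ] ℝ) ∞
      (fun p : W × M ↦ pullbackLiouville g (fun z ↦ σ z p.2) p.1) := by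
  intro p₀
  set v₀ := σ p₀.1 p₀.2
  set e := extChartAt (𝓡 n).tangent v₀
  have hs : ∀ᶠ p in 𝓝 p₀, σ p.1 p.2 ∈ e.source :=
    (hσ p₀).continuousAt.eventually_mem
      ((isOpen_extChartAt_source v₀).mem_nhds (mem_extChartAt_source v₀))
  have hE : ContMDiffAt (𝓘(ℝ, W).prod (𝓡 n))
      𝓘(ℝ, EuclideanSpace ℝ (Fin n) × EuclideanSpace ℝ (Fin n)) ∞
      (fun p : W × M ↦ e (σ p.1 p.2)) p₀ :=
    ContMDiffAt.comp (g := e) p₀ contMDiffAt_extChartAt (hσ p₀)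
  have hl : ContMDiffAt (𝓘(ℝ, W).prod (𝓡 n))
      𝓘(ℝ, EuclideanSpace ℝ (Fin n) × EuclideanSpace ℝ (Fin n) →L[ℝ] ℝ) ∞
      (fun p : W × M ↦ liouvilleInChart g v₀ (e (σ p.1 p.2))) p₀ := by
    refine ContMDiffAt.comp (g := liouvilleInChart g v₀) p₀ (ContDiffAt.contMDiffAt ?_) hE
    exact (contDiffOn_liouvilleInChart g v₀).contDiffAt
      ((isOpen_extChartAt_target v₀).mem_nhds (mem_extChartAt_target v₀))
  refine (hl.clm_comp (contMDiffAt_fderiv_param hE)).congr_of_eventuallyEq ?_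
  filter_upwards [hs] with p hp
  exact pullbackLiouville_eq g ((contMDiffAt_slice (hσ p)).mdifferentiableAt (by simp)) hp

/-- The differential of a function on the tangent bundle. -/
def differential (H : TangentBundle (𝓡 n) M → ℝ) (v : TangentBundle (𝓡 n) M) :
    TangentSpace (𝓡 n).tangent v →L[ℝ] ℝ :=
  mfderiv (𝓡 n).tangent 𝓘(ℝ, ℝ) H v

lemma differential_mfderiv {H : TangentBundle (𝓡 n) M → ℝ}
    (hH : ContMDiff (𝓡 n).tangent 𝓘(ℝ, ℝ) ∞ H) {τ : W → TangentBundle (𝓡 n) M} {z : W}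
    (hτ : MDifferentiableAt 𝓘(ℝ, W) (𝓡 n).tangent τ z) (w : W) :
    differential H (τ z) (mfderiv 𝓘(ℝ, W) (𝓡 n).tangent τ z w) =
      fderiv ℝ (fun z ↦ H (τ z)) z w := by
  have h1 : HasFDerivAt (fun z ↦ H (τ z))
      ((differential H (τ z) : EuclideanSpace ℝ (Fin n) × EuclideanSpace ℝ (Fin n) →L[ℝ] ℝ).comp
        (familyDeriv τ z)) z :=
    ((hH.mdifferentiable (by simp) (τ z)).hasMFDerivAt.comp z hτ.hasMFDerivAt).hasFDerivAt
  rw [h1.fderiv]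
  rfl

lemma fderiv_apply_const {A : W → W →L[ℝ] ℝ} {z : W} (hA : DifferentiableAt ℝ A z) (a b : W) :
    fderiv ℝ (fun z ↦ A z b) z a = fderiv ℝ A z a b := by
  rw [(hA.hasFDerivAt.clm_apply (hasFDerivAt_const b z)).fderiv]
  simp

/-- The integrand of `ω(∂₁σ, ∂₂σ) - dH(∂₂σ)` at the origin. -/
def hamDefect (g : Metric n M) (H : TangentBundle (𝓡 n) M → ℝ)
    (σ : ℝ × ℝ → M → TangentBundle (𝓡 n) M) (x : M) : ℝ :=
  symplecticForm g (σ 0 x) (mfderiv 𝓘(ℝ, ℝ × ℝ) (𝓡 n).tangent (fun z ↦ σ z x) 0 ((1, 0) : ℝ × ℝ))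
      (mfderiv 𝓘(ℝ, ℝ × ℝ) (𝓡 n).tangent (fun z ↦ σ z x) 0 ((0, 1) : ℝ × ℝ)) -
    differential H (σ 0 x)
      (mfderiv 𝓘(ℝ, ℝ × ℝ) (𝓡 n).tangent (fun z ↦ σ z x) 0 ((0, 1) : ℝ × ℝ))

lemma hamDefect_eq (g : Metric n M) {H : TangentBundle (𝓡 n) M → ℝ}
    (hH : ContMDiff (𝓡 n).tangent 𝓘(ℝ, ℝ) ∞ H) {σ : ℝ × ℝ → M → TangentBundle (𝓡 n) M}
    (hσ : ContMDiff (𝓘(ℝ, ℝ × ℝ).prod (𝓡 n)) (𝓡 n).tangent ∞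
      (fun p : (ℝ × ℝ) × M ↦ σ p.1 p.2)) (x : M) :
    hamDefect g H σ x =
      -(fderiv ℝ (fun z ↦ pullbackLiouville g (fun z ↦ σ z x) z (0, 1)) 0 (1, 0) -
        fderiv ℝ (fun z ↦ pullbackLiouville g (fun z ↦ σ z x) z (1, 0)) 0 (0, 1)) -
      fderiv ℝ (fun z ↦ H (σ z x)) 0 (0, 1) := by
  have hσx : ContMDiffAt 𝓘(ℝ, ℝ × ℝ) (𝓡 n).tangent ∞ (fun z ↦ σ z x) 0 :=
    contMDiffAt_slice (hσ (0, x))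
  have e1 : fderiv ℝ (pullbackLiouville g (fun z ↦ σ z x)) 0 (1, 0) (0, 1) -
      fderiv ℝ (pullbackLiouville g (fun z ↦ σ z x)) 0 (0, 1) (1, 0) =
      -symplecticForm g (σ 0 x)
        (mfderiv 𝓘(ℝ, ℝ × ℝ) (𝓡 n).tangent (fun z ↦ σ z x) 0 ((1, 0) : ℝ × ℝ))
        (mfderiv 𝓘(ℝ, ℝ × ℝ) (𝓡 n).tangent (fun z ↦ σ z x) 0 ((0, 1) : ℝ × ℝ)) :=
    oneFormDeriv_pullbackLiouville_eq_symplecticForm g (hσx.of_le (by norm_cast)) _ _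
  have hAx : DifferentiableAt ℝ (pullbackLiouville g (fun z ↦ σ z x)) 0 :=
    (contMDiffAt_slice (contMDiff_pullbackLiouville g hσ (0, x))).contDiffAt.differentiableAt
      (by simp)
  rw [fderiv_apply_const hAx, fderiv_apply_const hAx, e1, neg_neg, hamDefect,
    differential_mfderiv hH (hσx.mdifferentiableAt (by simp))]

/-! ### The symplectic form of `TD` as an integral over `M` -/

variable [CompactSpace M] [MeasurableSpace M] [BorelSpace M]

lemma integrable_fderiv_param [FiniteDimensional ℝ W] {μ : Measure M} [IsFiniteMeasure μ]
    {F : W × M → ℝ} (hF : ContMDiff (𝓘(ℝ, W).prod (𝓡 n)) 𝓘(ℝ, ℝ) ∞ F) (z a : W) :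
    Integrable (fun x ↦ fderiv ℝ (fun z ↦ F (z, x)) z a) μ := by
  have hD : Continuous fun p : W × M ↦ fderiv ℝ (fun z ↦ F (z, p.2)) p.1 :=
    ContMDiff.continuous (I := 𝓘(ℝ, W).prod (𝓡 n)) (I' := 𝓘(ℝ, W →L[ℝ] ℝ)) (n := ∞)
      fun p ↦ contMDiffAt_fderiv_param (hF p)
  have hD0 : Continuous fun x ↦ fderiv ℝ (fun z ↦ F (z, x)) z a :=
    (hD.comp (f := fun x : M ↦ (z, x)) (by fun_prop)).clm_apply continuous_const
  exact hD0.integrable_of_hasCompactSupport (HasCompactSupport.of_compactSpace _)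

omit [CompactSpace M] [MeasurableSpace M] [BorelSpace M] in
lemma contMDiff_pullbackLiouville_apply (g : Metric n M) {σ : W → M → TangentBundle (𝓡 n) M}
    (hσ : ContMDiff (𝓘(ℝ, W).prod (𝓡 n)) (𝓡 n).tangent ∞ (fun p : W × M ↦ σ p.1 p.2)) (b : W) :
    ContMDiff (𝓘(ℝ, W).prod (𝓡 n)) 𝓘(ℝ, ℝ) ∞
      (fun p : W × M ↦ pullbackLiouville g (fun z ↦ σ z p.2) p.1 b) :=
  (contMDiff_pullbackLiouville g hσ).clm_apply contMDiff_const

/-- The values of `θ` on the partial derivatives of `σ` are, by definition, integrals of the pulled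
back one-form of `TM`, so the outer derivatives may be taken under the integral. -/
lemma symplecticD_eq (g : Metric n M) (vol : VolumeForm n M)
    [IsFiniteMeasure vol.measure] {σ : ℝ × ℝ → M → TangentBundle (𝓡 n) M}
    (hσ : ContMDiff (𝓘(ℝ, ℝ × ℝ).prod (𝓡 n)) (𝓡 n).tangent ∞
      (fun p : (ℝ × ℝ) × M ↦ σ p.1 p.2)) :
    symplecticD g vol σ =
      -(∫ x, fderiv ℝ (fun z ↦ pullbackLiouville g (fun z ↦ σ z x) z (0, 1)) 0 (1, 0) ∂vol.measure -
        ∫ x, fderiv ℝ (fun z ↦ pullbackLiouville g (fun z ↦ σ z x) z (1, 0)) 0 (0, 1)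
          ∂vol.measure) := by
  have d1 := (hasDerivAt_integral_of_contMDiff (μ := vol.measure)
    (contMDiff_pullbackLiouville_apply g hσ (0, 1)) 0 (1, 0)).deriv
  have d2 := (hasDerivAt_integral_of_contMDiff (μ := vol.measure)
    (contMDiff_pullbackLiouville_apply g hσ (1, 0)) 0 (0, 1)).deriv
  simp only [zero_add, Prod.smul_mk, smul_eq_mul, mul_one, mul_zero] at d1 d2
  rw [← d1, ← d2]
  rfl

lemma integral_hamDefect (g : Metric n M) (vol : VolumeForm n M)
    [IsFiniteMeasure vol.measure] {H : TangentBundle (𝓡 n) M → ℝ}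
    (hH : ContMDiff (𝓡 n).tangent 𝓘(ℝ, ℝ) ∞ H) {σ : ℝ × ℝ → M → TangentBundle (𝓡 n) M}
    (hσ : ContMDiff (𝓘(ℝ, ℝ × ℝ).prod (𝓡 n)) (𝓡 n).tangent ∞
      (fun p : (ℝ × ℝ) × M ↦ σ p.1 p.2)) :
    ∫ x, hamDefect g H σ x ∂vol.measure =
      symplecticD g vol σ - ∫ x, fderiv ℝ (fun z ↦ H (σ z x)) 0 (0, 1) ∂vol.measure := by
  have i1 := integrable_fderiv_param (μ := vol.measure)
    (contMDiff_pullbackLiouville_apply g hσ (0, 1)) 0 (1, 0)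
  have i2 := integrable_fderiv_param (μ := vol.measure)
    (contMDiff_pullbackLiouville_apply g hσ (1, 0)) 0 (0, 1)
  have i3 := integrable_fderiv_param (μ := vol.measure) (hH.comp hσ) 0 (0, 1)
  simp only [hamDefect_eq g hH hσ]
  rw [symplecticD_eq g vol hσ, ← integral_sub i1 i2, ← integral_neg]
  exact integral_sub (i1.sub i2).neg i3

lemma hasDerivAt_averagedHamiltonian (vol : VolumeForm n M)
    [IsFiniteMeasure vol.measure] {H : TangentBundle (𝓡 n) M → ℝ}
    (hH : ContMDiff (𝓡 n).tangent 𝓘(ℝ, ℝ) ∞ H) {σ : ℝ × ℝ → M → TangentBundle (𝓡 n) M}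
    (hσ : ContMDiff (𝓘(ℝ, ℝ × ℝ).prod (𝓡 n)) (𝓡 n).tangent ∞
      (fun p : (ℝ × ℝ) × M ↦ σ p.1 p.2)) :
    HasDerivAt (fun t : ℝ ↦ averagedHamiltonian vol H (σ (0, t)))
      (∫ x, fderiv ℝ (fun z ↦ H (σ z x)) 0 (0, 1) ∂vol.measure) 0 := by
  have d3 := hasDerivAt_integral_of_contMDiff (μ := vol.measure) (hH.comp hσ) 0 (0, 1)
  simp only [zero_add, Prod.smul_mk, smul_eq_mul, mul_one, mul_zero] at d3
  exact d3

/-- `dK(∂₂σ) = ω(∂₁σ, ∂₂σ)` for the averaged Hamiltonian `K` iff the defect has integral zero. -/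
theorem hasDerivAt_averagedHamiltonian_iff (g : Metric n M) (vol : VolumeForm n M)
    [IsFiniteMeasure vol.measure] {H : TangentBundle (𝓡 n) M → ℝ}
    (hH : ContMDiff (𝓡 n).tangent 𝓘(ℝ, ℝ) ∞ H) {σ : ℝ × ℝ → M → TangentBundle (𝓡 n) M}
    (hσ : ContMDiff (𝓘(ℝ, ℝ × ℝ).prod (𝓡 n)) (𝓡 n).tangent ∞
      (fun p : (ℝ × ℝ) × M ↦ σ p.1 p.2)) :
    HasDerivAt (fun t : ℝ ↦ averagedHamiltonian vol H (σ (0, t))) (symplecticD g vol σ) 0 ↔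
      ∫ x, hamDefect g H σ x ∂vol.measure = 0 := by
  have h := hasDerivAt_averagedHamiltonian vol hH hσ
  rw [integral_hamDefect g vol hH hσ, sub_eq_zero]
  exact ⟨fun h' ↦ h'.unique h, fun h' ↦ h' ▸ h⟩

end Integrals

/-! ### Variations of trajectories in `TD` -/

section Variations

open Filter Topology

variable {W W' : Type*} [NormedAddCommGroup W] [NormedSpace ℝ W] [NormedAddCommGroup W']
  [NormedSpace ℝ W']

lemma familyDeriv_comp {τ : W → TangentBundle (𝓡 n) M} {r : W' → W} {z : W'} {y : W}
    {r' : W' →L[ℝ] W} (hτ : MDifferentiableAt 𝓘(ℝ, W) (𝓡 n).tangent τ y)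
    (hr : HasFDerivAt r r' z) (hy : r z = y) :
    familyDeriv (fun u ↦ τ (r u)) z = (familyDeriv τ y).comp r' :=
  (hasMFDerivAt_comp_of_eq hτ.hasMFDerivAt hr.hasMFDerivAt hy).mfderiv

lemma familyDeriv_congr {τ τ' : W → TangentBundle (𝓡 n) M} {z : W} (h : τ =ᶠ[𝓝 z] τ') :
    familyDeriv τ z = familyDeriv τ' z :=
  h.mfderiv_eq

lemma totalSpace_ext {v v' : TangentBundle (𝓡 n) M}
    {w w' : EuclideanSpace ℝ (Fin n) × EuclideanSpace ℝ (Fin n)} (h : v = v') (hw : w = w') :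
    (⟨v, w⟩ : TTM n M) = ⟨v', w'⟩ := by
  subst h hw
  rfl

/-- `ω(D(1, 0), D(0, 1)) - dH(D(0, 1))` at `v`. -/
def defectAt (g : Metric n M) (H : TangentBundle (𝓡 n) M → ℝ) (v : TangentBundle (𝓡 n) M)
    (D : ℝ × ℝ →L[ℝ] EuclideanSpace ℝ (Fin n) × EuclideanSpace ℝ (Fin n)) : ℝ :=
  symplecticForm g v (D (1, 0)) (D (0, 1)) - differential H v (D (0, 1))

lemma hamDefect_eq_defectAt (g : Metric n M) (H : TangentBundle (𝓡 n) M → ℝ)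
    (σ : ℝ × ℝ → M → TangentBundle (𝓡 n) M) (x : M) :
    hamDefect g H σ x = defectAt g H (σ 0 x) (familyDeriv (fun z ↦ σ z x) 0) := rfl

lemma defectAt_of_apply_eq_zero (g : Metric n M) (H : TangentBundle (𝓡 n) M → ℝ)
    (v : TangentBundle (𝓡 n) M)
    {D : ℝ × ℝ →L[ℝ] EuclideanSpace ℝ (Fin n) × EuclideanSpace ℝ (Fin n)} (hD : D (0, 1) = 0) :
    defectAt g H v D = 0 := by
  have h1 : symplecticForm g v (D (1, 0)) (0 : EuclideanSpace ℝ (Fin n) × _) = 0 := by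
    change -(fderiv ℝ (liouvilleInChart g v) (extChartAt (𝓡 n).tangent v v) (D (1, 0)) 0 -
      fderiv ℝ (liouvilleInChart g v) (extChartAt (𝓡 n).tangent v v) 0 (D (1, 0))) = 0
    simp
  have h2 : differential H v (0 : EuclideanSpace ℝ (Fin n) × EuclideanSpace ℝ (Fin n)) = 0 :=
    map_zero (differential H v)
  rw [defectAt, hD, h1, h2, sub_zero]

lemma defectAt_eq_chart (g : Metric n M) {H : TangentBundle (𝓡 n) M → ℝ}
    (hH : ContMDiff (𝓡 n).tangent 𝓘(ℝ, ℝ) ∞ H) {v₀ : TangentBundle (𝓡 n) M}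
    {τ : ℝ × ℝ → TangentBundle (𝓡 n) M} (hτ : MDifferentiableAt 𝓘(ℝ, ℝ × ℝ) (𝓡 n).tangent τ 0)
    (hv : τ 0 ∈ (extChartAt (𝓡 n).tangent v₀).source) :
    defectAt g H (τ 0) (familyDeriv τ 0) =
      symplecticFlat g v₀ (extChartAt (𝓡 n).tangent v₀ (τ 0))
        (fderiv ℝ (extChartAt (𝓡 n).tangent v₀ ∘ τ) 0 (1, 0))
        (fderiv ℝ (extChartAt (𝓡 n).tangent v₀ ∘ τ) 0 (0, 1)) -
      fderiv ℝ (H ∘ (extChartAt (𝓡 n).tangent v₀).symm) (extChartAt (𝓡 n).tangent v₀ (τ 0))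
        (fderiv ℝ (extChartAt (𝓡 n).tangent v₀ ∘ τ) 0 (0, 1)) := by
  rw [symplecticFlat_apply, (hasFDerivAt_extChartAt_comp hτ rfl hv).fderiv]
  exact congrArg₂ (· - ·) (symplecticForm_eq_chart g hv _ _)
    (mfderiv_eq_fderiv_chartDeriv (hH.mdifferentiable (by simp)) hv _)

/-- Hamiltonian vectors on `TD` are tested on families over all of `ℝ × ℝ`, whereas variations are
in `TD` only near `0`. A reparametrisation with values in a small ball and identity derivative at
`0` bridges the gap. -/
lemma exists_isSmoothFamily_univ [CompactSpace M] [T2Space M] (vol : VolumeForm n M)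
    {V : ℝ × ℝ → M → TangentBundle (𝓡 n) M}
    (hV : ∀ᶠ z in 𝓝 (0 : ℝ × ℝ), ∀ x, ContMDiffAt (𝓘(ℝ, ℝ × ℝ).prod (𝓡 n)) (𝓡 n).tangent ∞
      (fun p : (ℝ × ℝ) × M ↦ V p.1 p.2) (z, x)) (h₀ : V 0 ∈ TDiff vol) :
    ∃ r : ℝ × ℝ → ℝ × ℝ, r 0 = 0 ∧ HasFDerivAt r (ContinuousLinearMap.id ℝ (ℝ × ℝ)) 0 ∧
      IsSmoothFamily vol univ (fun z ↦ V (r z)) := by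
  obtain ⟨ε, hε, hball⟩ := Metric.eventually_nhds_iff_ball.1
    (hV.and (eventually_mem_tDiff vol hV h₀))
  set δ : ℝ := ε / 2 with hδ
  have hδ0 : 0 < δ := by positivity
  -- The function `δ sin(s / δ)` is smooth, bounded by `δ < ε`, and has derivative `1` at `0`.
  let k : ℝ → ℝ := fun s ↦ δ * Real.sin (s / δ)
  have hk : HasDerivAt k 1 0 := by
    have h1 : HasDerivAt (fun s : ℝ ↦ s / δ) (1 / δ) 0 := (hasDerivAt_id (0 : ℝ)).div_const δ
    have h2 := (h1.sin).const_mul δ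
    simpa [k, hδ0.ne'] using h2
  have hkb : ∀ s, |k s| < ε := fun s ↦ by
    have h1 : |k s| ≤ δ * 1 := by
      rw [abs_mul, abs_of_pos hδ0]
      exact mul_le_mul_of_nonneg_left (Real.abs_sin_le_one _) hδ0.le
    linarith
  let r : ℝ × ℝ → ℝ × ℝ := fun z ↦ (k z.1, k z.2)
  have hrs : ContDiff ℝ ∞ r := by
    simp only [r, k]
    fun_prop
  have hrb : ∀ z, r z ∈ Metric.ball (0 : ℝ × ℝ) ε := fun z ↦ by
    rw [mem_ball_zero_iff, Prod.norm_def]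
    exact max_lt (hkb z.1) (hkb z.2)
  refine ⟨r, by simp [r, k], ?_, ⟨fun z _ ↦ (hball _ (hrb z)).2, ?_⟩⟩
  · have h1 : HasFDerivAt (fun z : ℝ × ℝ ↦ k z.1) _ 0 :=
      HasFDerivAt.comp (0 : ℝ × ℝ) (g := k) (f := Prod.fst)
        (show HasFDerivAt k _ (0 : ℝ × ℝ).1 from hk.hasFDerivAt)
        (hasFDerivAt_fst (𝕜 := ℝ) (E := ℝ) (F := ℝ) (p := (0 : ℝ × ℝ)))
    have h2 : HasFDerivAt (fun z : ℝ × ℝ ↦ k z.2) _ 0 :=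
      HasFDerivAt.comp (0 : ℝ × ℝ) (g := k) (f := Prod.snd)
        (show HasFDerivAt k _ (0 : ℝ × ℝ).2 from hk.hasFDerivAt)
        (hasFDerivAt_snd (𝕜 := ℝ) (E := ℝ) (F := ℝ) (p := (0 : ℝ × ℝ)))
    refine (h1.prodMk h2).congr_fderiv ?_
    ext <;> simp
  · intro p _
    have h1 : ContMDiffAt (𝓘(ℝ, ℝ × ℝ).prod (𝓡 n)) (𝓘(ℝ, ℝ × ℝ).prod (𝓡 n)) ∞
        (fun p : (ℝ × ℝ) × M ↦ (r p.1, p.2)) p :=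
      (hrs.contMDiff.contMDiffAt.comp p contMDiffAt_fst).prodMk contMDiffAt_snd
    exact (ContMDiffAt.comp (g := fun p : (ℝ × ℝ) × M ↦ V p.1 p.2) p
      ((hball _ (hrb p.1)).1 p.2) h1).contMDiffWithinAt

variable [CompactSpace M] [MeasurableSpace M] [BorelSpace M]

omit [CompactSpace M] [MeasurableSpace M] [BorelSpace M] in
lemma IsSmoothFamily.contMDiff {vol : VolumeForm n M} {σ : W → M → TangentBundle (𝓡 n) M}
    (h : IsSmoothFamily vol univ σ) : ContMDiff (𝓘(ℝ, W).prod (𝓡 n)) (𝓡 n).tangent ∞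
      (fun p : W × M ↦ σ p.1 p.2) := by
  have := h.smooth
  rwa [univ_prod_univ, contMDiffOn_univ] at this

/-- The defect depends only on the value and first derivative of the family at `0`, which the
reparametrisation leaves unchanged. -/
lemma integral_hamDefect_eq_zero [T2Space M] (g : Metric n M) (vol : VolumeForm n M)
    [IsFiniteMeasure vol.measure] {H : TangentBundle (𝓡 n) M → ℝ}
    (hH : ContMDiff (𝓡 n).tangent 𝓘(ℝ, ℝ) ∞ H) {Z : M → TTM n M}
    (hZ : IsHamiltonianVectorD g vol (averagedHamiltonian vol H) Z)
    {V : ℝ × ℝ → M → TangentBundle (𝓡 n) M}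
    (hV : ∀ᶠ z in 𝓝 (0 : ℝ × ℝ), ∀ x, ContMDiffAt (𝓘(ℝ, ℝ × ℝ).prod (𝓡 n)) (𝓡 n).tangent ∞
      (fun p : (ℝ × ℝ) × M ↦ V p.1 p.2) (z, x)) (h₀ : V 0 ∈ TDiff vol)
    (hVZ : velocity V 0 (1, 0) = Z) : ∫ x, hamDefect g H V x ∂vol.measure = 0 := by
  obtain ⟨r, hr0, hr, hσ⟩ := exists_isSmoothFamily_univ vol hV h₀
  have hfd : ∀ x, familyDeriv (fun z ↦ V (r z) x) 0 = familyDeriv (fun z ↦ V z x) 0 := fun x ↦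
    familyDeriv_comp (τ := fun z ↦ V z x)
      ((contMDiffAt_slice (hV.self_of_nhds x)).mdifferentiableAt (by simp)) hr hr0
  have h1 := hZ _ hσ (by
    rw [← hVZ]
    funext x
    exact totalSpace_ext (by rw [← hr0]; rfl) (DFunLike.congr_fun (hfd x) _))
  rw [← (hasDerivAt_averagedHamiltonian_iff g vol hH (σ := fun z ↦ V (r z)) hσ.contMDiff).1 h1]
  congr 1
  funext x
  rw [hamDefect_eq_defectAt, hamDefect_eq_defectAt, hfd, hr0]

end Variations

/-! ### Trajectories in `TD` are trajectories in `TM` at every point -/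

section Localization

open Filter Topology

/-- The pairing of `ω(∂c, ·) - dH` at `c 0 x` with the vector that has components `w` in the chart
at `v₀`. -/
def chartDefect (g : Metric n M) (H : TangentBundle (𝓡 n) M → ℝ)
    (c : ℝ → M → TangentBundle (𝓡 n) M) (v₀ : TangentBundle (𝓡 n) M)
    (w : EuclideanSpace ℝ (Fin n) × EuclideanSpace ℝ (Fin n)) (x : M) : ℝ :=
  symplecticFlat g v₀ (extChartAt (𝓡 n).tangent v₀ (c 0 x))
    (fderiv ℝ (fun a ↦ extChartAt (𝓡 n).tangent v₀ (c a x)) 0 1) w -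
  fderiv ℝ (H ∘ (extChartAt (𝓡 n).tangent v₀).symm) (extChartAt (𝓡 n).tangent v₀ (c 0 x)) w

lemma continuousAt_flat_sub {X V : Type*} [TopologicalSpace X] [NormedAddCommGroup V]
    [NormedSpace ℝ V] {A : X → V →L[ℝ] V →L[ℝ] ℝ} {B : X → ℝ →L[ℝ] V} {C : X → V →L[ℝ] ℝ} {x : X}
    (hA : ContinuousAt A x) (hB : ContinuousAt B x) (hC : ContinuousAt C x) (w : V) :
    ContinuousAt (fun y ↦ A y (B y 1) w - C y w) x :=
  ((hA.clm_apply (hB.clm_apply continuousAt_const)).clm_apply continuousAt_const).sub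
    (hC.clm_apply continuousAt_const)

lemma continuousAt_fderiv_param {W V : Type*} [NormedAddCommGroup W] [NormedSpace ℝ W]
    [NormedAddCommGroup V] [NormedSpace ℝ V] {F : W × M → V} {z : W} {x : M}
    (hF : ContMDiffAt (𝓘(ℝ, W).prod (𝓡 n)) 𝓘(ℝ, V) ∞ F (z, x)) :
    ContinuousAt (fun y ↦ fderiv ℝ (fun a ↦ F (a, y)) z) x := by
  have hcur : ContinuousAt (fun y : M ↦ (z, y)) x := by fun_prop
  exact ContinuousAt.comp (g := fun p : W × M ↦ fderiv ℝ (fun a ↦ F (a, p.2)) p.1)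
    (contMDiffAt_fderiv_param hF).continuousAt hcur

lemma continuousAt_chartDefect (g : Metric n M) {H : TangentBundle (𝓡 n) M → ℝ}
    (hH : ContMDiff (𝓡 n).tangent 𝓘(ℝ, ℝ) ∞ H) {c : ℝ → M → TangentBundle (𝓡 n) M}
    {v₀ : TangentBundle (𝓡 n) M} (w : EuclideanSpace ℝ (Fin n) × EuclideanSpace ℝ (Fin n)) {x : M}
    (hc : ContMDiffAt (𝓘(ℝ, ℝ).prod (𝓡 n)) (𝓡 n).tangent ∞ (fun p : ℝ × M ↦ c p.1 p.2) (0, x))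
    (hx : c 0 x ∈ (extChartAt (𝓡 n).tangent v₀).source) :
    ContinuousAt (chartDefect g H c v₀ w) x := by
  set e := extChartAt (𝓡 n).tangent v₀
  have hq : ContMDiffAt (𝓘(ℝ, ℝ).prod (𝓡 n))
      𝓘(ℝ, EuclideanSpace ℝ (Fin n) × EuclideanSpace ℝ (Fin n)) ∞
      (fun p : ℝ × M ↦ e (c p.1 p.2)) (0, x) :=
    ContMDiffAt.comp (g := e) (0, x)
      (contMDiffAt_extChartAt' (by rwa [extChartAt_source] at hx)) hc
  have hcur : ContinuousAt (fun y : M ↦ ((0 : ℝ), y)) x := by fun_prop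
  have h1 : ContinuousAt (fun y ↦ e (c 0 y)) x :=
    ContinuousAt.comp (g := fun p : ℝ × M ↦ e (c p.1 p.2)) hq.continuousAt hcur
  have h2 : ContinuousAt (fun y ↦ fderiv ℝ (fun a ↦ e (c a y)) 0) x :=
    continuousAt_fderiv_param (F := fun p : ℝ × M ↦ e (c p.1 p.2)) hq
  have ht : e.target ∈ 𝓝 (e (c 0 x)) :=
    (isOpen_extChartAt_target v₀).mem_nhds (e.map_source hx)
  have h3 : ContinuousAt (fun y ↦ symplecticFlat g v₀ (e (c 0 y))) x :=
    ContinuousAt.comp (g := symplecticFlat g v₀)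
      ((contDiffOn_symplecticFlat g v₀).continuousOn.continuousAt ht) h1
  have hHe : ContDiffOn ℝ ∞ (H ∘ e.symm) e.target := by
    rw [← contMDiffOn_iff_contDiffOn]
    exact hH.comp_contMDiffOn (contMDiffOn_extChartAt_symm v₀)
  have h4 : ContinuousAt (fun y ↦ fderiv ℝ (H ∘ e.symm) (e (c 0 y))) x :=
    ContinuousAt.comp (g := fderiv ℝ (H ∘ e.symm))
      ((hHe.continuousOn_fderiv_of_isOpen (isOpen_extChartAt_target v₀) (by simp)).continuousAt ht)
      h1
  exact continuousAt_flat_sub h3 h2 h4 w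

/-- The variation of `c` in the direction `w` of the chart at `v₀`, cut off by `f`. -/
def chartVariation (c : ℝ → M → TangentBundle (𝓡 n) M) (v₀ : TangentBundle (𝓡 n) M)
    (w : EuclideanSpace ℝ (Fin n) × EuclideanSpace ℝ (Fin n)) (f : M → ℝ) (N : Set M)
    (z : ℝ × ℝ) (x : M) : TangentBundle (𝓡 n) M :=
  open Classical in
  if x ∈ N then
    (extChartAt (𝓡 n).tangent v₀).symm
      (extChartAt (𝓡 n).tangent v₀ (c z.1 x) + (z.2 * f x) • w)
  else c z.1 x

section

variable {c : ℝ → M → TangentBundle (𝓡 n) M} {v₀ : TangentBundle (𝓡 n) M}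
  {w : EuclideanSpace ℝ (Fin n) × EuclideanSpace ℝ (Fin n)} {f : M → ℝ} {N : Set M} {η : ℝ}

lemma chartVariation_of_eq_zero {z : ℝ × ℝ} {x : M}
    (hN : x ∈ N → c z.1 x ∈ (extChartAt (𝓡 n).tangent v₀).source) (h : z.2 * f x = 0) :
    chartVariation c v₀ w f N z x = c z.1 x := by
  by_cases hx : x ∈ N
  · rw [chartVariation, if_pos hx, h, zero_smul, add_zero]
    exact (extChartAt (𝓡 n).tangent v₀).left_inv (hN hx)
  · rw [chartVariation, if_neg hx]

variable (hη : 0 < η)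
  (hNs : ∀ a : ℝ, |a| < η → ∀ x ∈ N, c a x ∈ (extChartAt (𝓡 n).tangent v₀).source)

-- The open sets `N` and the complement of `tsupport f` cover `M`. On the first the chart formula is
-- smooth, and on the second the variation coincides with `c`.
include hNs in
lemma contMDiffAt_chartVariation (hNo : IsOpen N)
    (hNt : ∀ a : ℝ, |a| < η → ∀ x ∈ N, ∀ r : ℝ, |r| < η →
      extChartAt (𝓡 n).tangent v₀ (c a x) + r • w ∈ (extChartAt (𝓡 n).tangent v₀).target)
    (hf : ContMDiff (𝓡 n) 𝓘(ℝ, ℝ) ∞ f) (hf1 : ∀ x, |f x| ≤ 1) (hfN : tsupport f ⊆ N)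
    {z : ℝ × ℝ} (hz : |z.1| < η) (hz' : |z.2| < η) {x : M}
    (hc : ContMDiffAt (𝓘(ℝ, ℝ).prod (𝓡 n)) (𝓡 n).tangent ∞
      (fun p : ℝ × M ↦ c p.1 p.2) (z.1, x)) :
    ContMDiffAt (𝓘(ℝ, ℝ × ℝ).prod (𝓡 n)) (𝓡 n).tangent ∞
      (fun p : (ℝ × ℝ) × M ↦ chartVariation c v₀ w f N p.1 p.2) (z, x) := by
  set e := extChartAt (𝓡 n).tangent v₀
  have hfst : ContMDiffAt (𝓘(ℝ, ℝ × ℝ).prod (𝓡 n)) 𝓘(ℝ, ℝ) ∞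
      (fun p : (ℝ × ℝ) × M ↦ p.1.1) (z, x) :=
    contDiffAt_fst.contMDiffAt.comp (z, x) contMDiffAt_fst
  have hsnd : ContMDiffAt (𝓘(ℝ, ℝ × ℝ).prod (𝓡 n)) 𝓘(ℝ, ℝ) ∞
      (fun p : (ℝ × ℝ) × M ↦ p.1.2) (z, x) :=
    contDiffAt_snd.contMDiffAt.comp (z, x) contMDiffAt_fst
  have hc' : ContMDiffAt (𝓘(ℝ, ℝ × ℝ).prod (𝓡 n)) (𝓡 n).tangent ∞
      (fun p : (ℝ × ℝ) × M ↦ c p.1.1 p.2) (z, x) :=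
    ContMDiffAt.comp (g := fun p : ℝ × M ↦ c p.1 p.2) (z, x) hc (hfst.prodMk contMDiffAt_snd)
  by_cases hx : x ∈ N
  · have h1 : ContMDiffAt (𝓘(ℝ, ℝ × ℝ).prod (𝓡 n))
        𝓘(ℝ, EuclideanSpace ℝ (Fin n) × EuclideanSpace ℝ (Fin n)) ∞
        (fun p : (ℝ × ℝ) × M ↦ e (c p.1.1 p.2) + (p.1.2 * f p.2) • w) (z, x) := by
      refine ContMDiffAt.add (ContMDiffAt.comp (g := e) (z, x)
        (contMDiffAt_extChartAt' ?_) hc') ?_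
      · have := hNs z.1 hz x hx
        rwa [extChartAt_source] at this
      · refine ContMDiffAt.smul (hsnd.mul ?_) contMDiffAt_const
        exact (hf x).comp (z, x) contMDiffAt_snd
    have hr : |z.2 * f x| < η := by
      rw [abs_mul]
      exact (mul_le_of_le_one_right (abs_nonneg _) (hf1 x)).trans_lt hz'
    have h2 : ContMDiffAt (𝓘(ℝ, ℝ × ℝ).prod (𝓡 n)) (𝓡 n).tangent ∞
        (fun p : (ℝ × ℝ) × M ↦ e.symm (e (c p.1.1 p.2) + (p.1.2 * f p.2) • w)) (z, x) :=
      ContMDiffAt.comp (g := e.symm) (z, x) ((contMDiffOn_extChartAt_symm v₀).contMDiffAt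
        ((isOpen_extChartAt_target v₀).mem_nhds (hNt z.1 hz x hx _ hr))) h1
    refine h2.congr_of_eventuallyEq ?_
    filter_upwards [(continuous_snd.tendsto (z, x)).eventually (hNo.mem_nhds hx)] with p hp
    exact if_pos hp
  · have hx' : x ∈ (tsupport f)ᶜ := fun h ↦ hx (hfN h)
    refine hc'.congr_of_eventuallyEq ?_
    have h1 : ∀ᶠ p : (ℝ × ℝ) × M in 𝓝 (z, x), |p.1.1| < η :=
      ContinuousAt.eventually_lt (by fun_prop) continuousAt_const hz
    filter_upwards [h1, (continuous_snd.tendsto (z, x)).eventually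
      ((isClosed_tsupport f).isOpen_compl.mem_nhds hx')] with p hp1 hp2
    exact chartVariation_of_eq_zero (hNs p.1.1 hp1 p.2)
      (by rw [image_eq_zero_of_notMem_tsupport hp2, mul_zero])

include hη hNs in
lemma familyDeriv_chartVariation_apply_fst {x : M}
    (hV : MDifferentiableAt 𝓘(ℝ, ℝ × ℝ) (𝓡 n).tangent
      (fun z ↦ chartVariation c v₀ w f N z x) 0) :
    familyDeriv (fun z ↦ chartVariation c v₀ w f N z x) 0 (1, 0) =
      familyDeriv (fun a ↦ c a x) 0 1 := by
  have h1 := familyDeriv_comp (r := fun s : ℝ ↦ (s, (0 : ℝ))) (z := (0 : ℝ)) hV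
    (hasFDerivAt_prodMk_left 0 0) rfl
  have h2 : (fun s : ℝ ↦ chartVariation c v₀ w f N (s, 0) x) =ᶠ[𝓝 0] fun a ↦ c a x := by
    have h3 : ∀ᶠ s : ℝ in 𝓝 0, |s| < η :=
      ContinuousAt.eventually_lt (by fun_prop) continuousAt_const (by simpa using hη)
    filter_upwards [h3] with s hs
    exact chartVariation_of_eq_zero (hNs s hs x) (zero_mul _)
  rw [← familyDeriv_congr h2, h1]
  rfl

-- In the chart the two partial derivatives of the variation are the velocity of `c` and `f x • w`;
-- the defect is linear in the second, so `f x` factors out. Off `N` the variation does not depend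
-- on its second parameter and both sides are zero.
include hη hNs in
lemma hamDefect_chartVariation (g : Metric n M) {H : TangentBundle (𝓡 n) M → ℝ}
    (hH : ContMDiff (𝓡 n).tangent 𝓘(ℝ, ℝ) ∞ H) (hNt : ∀ a : ℝ, |a| < η → ∀ x ∈ N, ∀ r : ℝ, |r| < η →
      extChartAt (𝓡 n).tangent v₀ (c a x) + r • w ∈ (extChartAt (𝓡 n).tangent v₀).target)
    (hf1 : ∀ x, |f x| ≤ 1) (hfN : tsupport f ⊆ N) {x : M}
    (hc : MDifferentiableAt 𝓘(ℝ, ℝ) (𝓡 n).tangent (fun a ↦ c a x) 0)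
    (hV : MDifferentiableAt 𝓘(ℝ, ℝ × ℝ) (𝓡 n).tangent
      (fun z ↦ chartVariation c v₀ w f N z x) 0) :
    hamDefect g H (chartVariation c v₀ w f N) x = f x * chartDefect g H c v₀ w x := by
  set e := extChartAt (𝓡 n).tangent v₀
  rw [hamDefect_eq_defectAt]
  by_cases hx : x ∈ N
  · have h0 : chartVariation c v₀ w f N 0 x = c 0 x :=
      chartVariation_of_eq_zero (hNs 0 (by simpa using hη) x) (by simp)
    have hs : chartVariation c v₀ w f N 0 x ∈ e.source := by
      rw [h0]
      exact hNs 0 (by simpa using hη) x hx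
    have hq : HasFDerivAt (fun a ↦ e (c a x)) (fderiv ℝ (fun a ↦ e (c a x)) 0) 0 :=
      (hasFDerivAt_extChartAt_comp hc rfl (by rwa [h0] at hs)).differentiableAt.hasFDerivAt
    have hE : e ∘ (fun z ↦ chartVariation c v₀ w f N z x) =ᶠ[𝓝 0]
        fun z ↦ e (c z.1 x) + (z.2 * f x) • w := by
      have h1 : ∀ᶠ z : ℝ × ℝ in 𝓝 0, |z.1| < η :=
        ContinuousAt.eventually_lt (by fun_prop) continuousAt_const (by simpa using hη)
      have h2 : ∀ᶠ z : ℝ × ℝ in 𝓝 0, |z.2| < η :=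
        ContinuousAt.eventually_lt (by fun_prop) continuousAt_const (by simpa using hη)
      filter_upwards [h1, h2] with z hz1 hz2
      change e (chartVariation c v₀ w f N z x) = _
      rw [chartVariation, if_pos hx]
      refine e.right_inv (hNt z.1 hz1 x hx _ ?_)
      rw [abs_mul]
      exact (mul_le_of_le_one_right (abs_nonneg _) (hf1 x)).trans_lt hz2
    have hD : HasFDerivAt (fun z : ℝ × ℝ ↦ e (c z.1 x) + (z.2 * f x) • w)
        ((fderiv ℝ (fun a ↦ e (c a x)) 0).comp (ContinuousLinearMap.fst ℝ ℝ ℝ) +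
          ((f x • ContinuousLinearMap.snd ℝ ℝ ℝ).smulRight w)) 0 := by
      refine HasFDerivAt.add ?_ ?_
      · exact HasFDerivAt.comp (0 : ℝ × ℝ) (g := fun a ↦ e (c a x)) (f := Prod.fst) hq
          (hasFDerivAt_fst (𝕜 := ℝ) (E := ℝ) (F := ℝ) (p := (0 : ℝ × ℝ)))
      · exact ((hasFDerivAt_snd (𝕜 := ℝ) (E := ℝ) (F := ℝ) (p := (0 : ℝ × ℝ))).mul_const
          (f x)).smul_const w
    rw [defectAt_eq_chart g hH hV hs, hE.fderiv_eq, hD.fderiv, h0]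
    simp only [add_apply, ContinuousLinearMap.comp_apply, ContinuousLinearMap.coe_fst',
      ContinuousLinearMap.smulRight_apply, _root_.smul_apply, ContinuousLinearMap.coe_snd',
      smul_eq_mul, mul_zero, mul_one, zero_smul, add_zero, map_zero, zero_add, map_smul]
    rw [chartDefect, mul_sub]
  · have hfx : f x = 0 := image_eq_zero_of_notMem_tsupport fun h ↦ hx (hfN h)
    rw [hfx, zero_mul]
    refine defectAt_of_apply_eq_zero g H _ ?_
    have h1 : (fun z ↦ chartVariation c v₀ w f N z x) = fun z : ℝ × ℝ ↦ c z.1 x := by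
      funext z
      exact if_neg hx
    rw [h1, familyDeriv_comp (r := (Prod.fst : ℝ × ℝ → ℝ)) (z := (0 : ℝ × ℝ)) hc
      hasFDerivAt_fst rfl]
    simp

end

end Localization

/-! ### The fundamental lemma of the calculus of variations and the comparison of trajectories -/

section Pointwise

open Filter Topology

lemma exists_uniform_chart_nhd {c : ℝ → M → TangentBundle (𝓡 n) M} {x₀ : M}
    (hc : ContinuousAt (fun p : ℝ × M ↦ c p.1 p.2) (0, x₀))
    (w : EuclideanSpace ℝ (Fin n) × EuclideanSpace ℝ (Fin n)) :
    ∃ η > 0, ∃ N : Set M, IsOpen N ∧ x₀ ∈ N ∧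
      (∀ a : ℝ, |a| < η → ∀ x ∈ N, c a x ∈ (extChartAt (𝓡 n).tangent (c 0 x₀)).source) ∧
      ∀ a : ℝ, |a| < η → ∀ x ∈ N, ∀ r : ℝ, |r| < η →
        extChartAt (𝓡 n).tangent (c 0 x₀) (c a x) + r • w ∈
          (extChartAt (𝓡 n).tangent (c 0 x₀)).target := by
  set e := extChartAt (𝓡 n).tangent (c 0 x₀) with he
  have hs : ∀ᶠ p in 𝓝 ((0 : ℝ), x₀), c p.1 p.2 ∈ e.source :=
    hc.eventually_mem ((isOpen_extChartAt_source (c 0 x₀)).mem_nhds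
      (mem_extChartAt_source (c 0 x₀)))
  have hcont : ContinuousAt (fun u : (ℝ × M) × ℝ ↦ e (c u.1.1 u.1.2) + u.2 • w) ((0, x₀), 0) := by
    refine ContinuousAt.add ?_ (by fun_prop)
    refine ContinuousAt.comp (g := e) (continuousAt_extChartAt (c 0 x₀)) ?_
    exact ContinuousAt.comp (g := fun p : ℝ × M ↦ c p.1 p.2) (f := Prod.fst) hc continuousAt_fst
  have ht : ∀ᶠ u in 𝓝 (((0 : ℝ), x₀), (0 : ℝ)), e (c u.1.1 u.1.2) + u.2 • w ∈ e.target := by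
    refine hcont.eventually_mem ((isOpen_extChartAt_target (c 0 x₀)).mem_nhds ?_)
    simp only [zero_smul, add_zero]
    exact mem_extChartAt_target (c 0 x₀)
  rw [nhds_prod_eq, eventually_prod_iff] at ht
  obtain ⟨p₁, h₁, p₂, h₂, h₁₂⟩ := ht
  have h₃ := hs.and h₁
  rw [nhds_prod_eq, eventually_prod_iff] at h₃
  obtain ⟨q₁, k₁, q₂, k₂, k₁₂⟩ := h₃
  obtain ⟨η, hη, hball⟩ := Metric.eventually_nhds_iff.1 (h₂.and k₁)
  obtain ⟨N, hN, hNo, hxN⟩ := mem_nhds_iff.1 k₂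
  have hb : ∀ a : ℝ, |a| < η → p₂ a ∧ q₁ a := fun a ha ↦ hball (by simpa using ha)
  exact ⟨η, hη, N, hNo, hxN, fun a ha x hx ↦ (k₁₂ (hb a ha).2 (hN hx)).1,
    fun a ha x hx r hr ↦ h₁₂ (k₁₂ (hb a ha).2 (hN hx)).2 (hb r hr).1⟩

variable [CompactSpace M] [T2Space M] [MeasurableSpace M] [BorelSpace M]

/-- The neighbourhood `N` is fixed before the cut-off `f`, so `f` may later be concentrated as
closely to `x₀` as desired. -/
lemma integral_mul_chartDefect_eq_zero (g : Metric n M) (vol : VolumeForm n M)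
    [IsFiniteMeasure vol.measure] {H : TangentBundle (𝓡 n) M → ℝ}
    (hH : ContMDiff (𝓡 n).tangent 𝓘(ℝ, ℝ) ∞ H) {c : ℝ → M → TangentBundle (𝓡 n) M}
    (hc : ∀ᶠ a in 𝓝 (0 : ℝ), ∀ x, ContMDiffAt (𝓘(ℝ, ℝ).prod (𝓡 n)) (𝓡 n).tangent ∞
      (fun p : ℝ × M ↦ c p.1 p.2) (a, x)) (h₀ : c 0 ∈ TDiff vol)
    (hZ : IsHamiltonianVectorD g vol (averagedHamiltonian vol H) (velocity c 0 1)) (x₀ : M)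
    (w : EuclideanSpace ℝ (Fin n) × EuclideanSpace ℝ (Fin n)) :
    ∃ N : Set M, IsOpen N ∧ x₀ ∈ N ∧
      (∀ x ∈ N, c 0 x ∈ (extChartAt (𝓡 n).tangent (c 0 x₀)).source) ∧
      ∀ f : M → ℝ, ContMDiff (𝓡 n) 𝓘(ℝ, ℝ) ∞ f → (∀ x, |f x| ≤ 1) → tsupport f ⊆ N →
        ∫ x, f x * chartDefect g H c (c 0 x₀) w x ∂vol.measure = 0 := by
  have hc0 := hc.self_of_nhds
  obtain ⟨η, hη, N, hNo, hxN, hNs, hNt⟩ := exists_uniform_chart_nhd (hc0 x₀).continuousAt w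
  refine ⟨N, hNo, hxN, hNs 0 (by simpa using hη), fun f hf hf1 hfN ↦ ?_⟩
  have hcd : ∀ x, MDifferentiableAt 𝓘(ℝ, ℝ) (𝓡 n).tangent (fun a ↦ c a x) 0 := fun x ↦
    (contMDiffAt_slice (hc0 x)).mdifferentiableAt (by simp)
  have hV : ∀ᶠ z in 𝓝 (0 : ℝ × ℝ), ∀ x, ContMDiffAt (𝓘(ℝ, ℝ × ℝ).prod (𝓡 n)) (𝓡 n).tangent ∞
      (fun p : (ℝ × ℝ) × M ↦ chartVariation c (c 0 x₀) w f N p.1 p.2) (z, x) := by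
    have h1 : ∀ᶠ z : ℝ × ℝ in 𝓝 0, |z.1| < η :=
      ContinuousAt.eventually_lt (by fun_prop) continuousAt_const (by simpa using hη)
    have h2 : ∀ᶠ z : ℝ × ℝ in 𝓝 0, |z.2| < η :=
      ContinuousAt.eventually_lt (by fun_prop) continuousAt_const (by simpa using hη)
    filter_upwards [h1, h2, (continuous_fst.tendsto (0 : ℝ × ℝ)).eventually hc] with z h1 h2 h3 x
    exact contMDiffAt_chartVariation hNs hNo hNt hf hf1 hfN h1 h2 (h3 x)
  have hVd : ∀ x, MDifferentiableAt 𝓘(ℝ, ℝ × ℝ) (𝓡 n).tangent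
      (fun z ↦ chartVariation c (c 0 x₀) w f N z x) 0 := fun x ↦
    (contMDiffAt_slice (hV.self_of_nhds x)).mdifferentiableAt (by simp)
  have hV0 : ∀ x, chartVariation c (c 0 x₀) w f N 0 x = c 0 x := fun x ↦
    chartVariation_of_eq_zero (hNs 0 (by simpa using hη) x) (by simp)
  have key := integral_hamDefect_eq_zero g vol hH hZ hV (by rwa [funext hV0]) (by
    funext x
    exact totalSpace_ext (hV0 x) (familyDeriv_chartVariation_apply_fst hη hNs (hVd x)))
  refine Eq.trans ?_ key
  congr 1
  funext x
  exact (hamDefect_chartVariation hη hNs g hH hNt hf1 hfN (hcd x) (hVd x)).symm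

/-- If `k x₀ ≠ 0`, a bump function supported where `k x₀ * k x > 0` makes the integral strictly
positive, since the measure charges open sets. The factor `k x₀` spares a distinction of signs. -/
lemma chartDefect_eq_zero (g : Metric n M) (vol : VolumeForm n M)
    [IsFiniteMeasure vol.measure] {H : TangentBundle (𝓡 n) M → ℝ}
    (hH : ContMDiff (𝓡 n).tangent 𝓘(ℝ, ℝ) ∞ H) {c : ℝ → M → TangentBundle (𝓡 n) M}
    (hc : ∀ᶠ a in 𝓝 (0 : ℝ), ∀ x, ContMDiffAt (𝓘(ℝ, ℝ).prod (𝓡 n)) (𝓡 n).tangent ∞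
      (fun p : ℝ × M ↦ c p.1 p.2) (a, x)) (h₀ : c 0 ∈ TDiff vol)
    (hZ : IsHamiltonianVectorD g vol (averagedHamiltonian vol H) (velocity c 0 1)) (x₀ : M)
    (w : EuclideanSpace ℝ (Fin n) × EuclideanSpace ℝ (Fin n)) :
    chartDefect g H c (c 0 x₀) w x₀ = 0 := by
  obtain ⟨N, hNo, hxN, hNs, hint⟩ := integral_mul_chartDefect_eq_zero g vol hH hc h₀ hZ x₀ w
  by_contra hne
  set k := chartDefect g H c (c 0 x₀) w
  have hk : ∀ x ∈ N, ContinuousAt k x := fun x hx ↦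
    continuousAt_chartDefect g hH w (hc.self_of_nhds x) (hNs x hx)
  have hpos : ∀ᶠ x in 𝓝 x₀, 0 < k x₀ * k x :=
    continuousAt_const.eventually_lt (continuousAt_const.mul (hk x₀ hxN))
      (mul_self_pos.2 hne)
  obtain ⟨f, -, hf⟩ := (SmoothBumpFunction.nhds_basis_tsupport (I := 𝓡 n) x₀).mem_iff.1
    (hpos.and (hNo.mem_nhds hxN))
  have := vol.isOpenPosMeasure
  have hsupp : tsupport (fun x ↦ f x * (k x₀ * k x)) ⊆ tsupport f :=
    closure_mono fun x hx h ↦ hx (by simp [h])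
  -- Continuity of `k` is known on `N` only; the support of the bump function lies in `N`, which
  -- makes the product continuous on all of `M`.
  have hcont : Continuous fun x ↦ f x * (k x₀ * k x) :=
    continuous_of_tsupport fun x hx ↦
      f.continuous.continuousAt.mul (continuousAt_const.mul (hk x (hf (hsupp hx)).2))
  have hnn : 0 ≤ fun x ↦ f x * (k x₀ * k x) := fun x ↦ by
    by_cases hx : x ∈ tsupport f
    · exact mul_nonneg f.nonneg (hf hx).1.le
    · simp [image_eq_zero_of_notMem_tsupport hx]
  have h1 : 0 < ∫ x, f x * (k x₀ * k x) ∂vol.measure :=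
    hcont.integral_pos_of_hasCompactSupport_nonneg_nonzero (x := x₀)
      (HasCompactSupport.of_compactSpace _) hnn (by simpa [f.eq_one] using hne)
  have h2 : ∫ x, f x * (k x₀ * k x) ∂vol.measure = k x₀ * ∫ x, f x * k x ∂vol.measure := by
    rw [← integral_const_mul]
    congr 1
    funext x
    ring
  rw [h2, hint f f.contMDiff (fun x ↦ by rw [abs_of_nonneg f.nonneg]; exact f.le_one)
    fun x hx ↦ (hf hx).2, mul_zero] at h1
  exact lt_irrefl _ h1

theorem isHamiltonianVector_of_isHamiltonianVectorD (g : Metric n M) (vol : VolumeForm n M)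
    [IsFiniteMeasure vol.measure] {H : TangentBundle (𝓡 n) M → ℝ}
    (hH : ContMDiff (𝓡 n).tangent 𝓘(ℝ, ℝ) ∞ H) {c : ℝ → M → TangentBundle (𝓡 n) M}
    (hc : ∀ᶠ a in 𝓝 (0 : ℝ), ∀ x, ContMDiffAt (𝓘(ℝ, ℝ).prod (𝓡 n)) (𝓡 n).tangent ∞
      (fun p : ℝ × M ↦ c p.1 p.2) (a, x)) (h₀ : c 0 ∈ TDiff vol)
    (hZ : IsHamiltonianVectorD g vol (averagedHamiltonian vol H) (velocity c 0 1)) (x₀ : M) :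
    IsHamiltonianVector g H (velocity c 0 1 x₀) := by
  intro w
  have h := sub_eq_zero.1 (chartDefect_eq_zero g vol hH hc h₀ hZ x₀ w)
  have hs := mem_extChartAt_source (I := (𝓡 n).tangent) (c 0 x₀)
  have hcd : MDifferentiableAt 𝓘(ℝ, ℝ) (𝓡 n).tangent (fun a ↦ c a x₀) 0 :=
    (contMDiffAt_slice (hc.self_of_nhds x₀)).mdifferentiableAt (by simp)
  have e1 := symplecticForm_eq_chart g hs (velocity c 0 1 x₀).snd w
  have e2 := mfderiv_eq_fderiv_chartDeriv (hH.mdifferentiable (by simp)) hs w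
  have e3 : fderiv ℝ (fun a ↦ extChartAt (𝓡 n).tangent (c 0 x₀) (c a x₀)) 0 1 =
      chartDeriv (𝓡 n).tangent (c 0 x₀) (c 0 x₀) (velocity c 0 1 x₀).snd :=
    DFunLike.congr_fun (hasFDerivAt_extChartAt_comp hcd rfl hs).fderiv 1
  have e4 := symplecticFlat_apply g (c 0 x₀) (extChartAt (𝓡 n).tangent (c 0 x₀) (c 0 x₀))
    (fderiv ℝ (fun a ↦ extChartAt (𝓡 n).tangent (c 0 x₀) (c a x₀)) 0 1) w
  rw [← e3, chartDeriv_self (c 0 x₀) w] at e1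
  rw [chartDeriv_self (c 0 x₀) w] at e2
  exact e1.trans (e4.symm.trans (h.trans e2.symm))

omit [CompactSpace M] [T2Space M] [MeasurableSpace M] [BorelSpace M] in
lemma IsSmoothFamily.contMDiffAt {W : Type*} [NormedAddCommGroup W] [NormedSpace ℝ W]
    {vol : VolumeForm n M} {S : Set W} {c : W → M → TangentBundle (𝓡 n) M}
    (h : IsSmoothFamily vol S c) (hS : IsOpen S) {a : W} (ha : a ∈ S) (x : M) :
    ContMDiffAt (𝓘(ℝ, W).prod (𝓡 n)) (𝓡 n).tangent ∞ (fun p : W × M ↦ c p.1 p.2) (a, x) :=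
  h.smooth.contMDiffAt ((hS.prod isOpen_univ).mem_nhds ⟨ha, trivial⟩)

/-- Along a trajectory in `TD` every tangent vector moves along a trajectory in `TM`. -/
theorem IsTrajectoryD.isTrajectory {g : Metric n M} {vol : VolumeForm n M}
    [IsFiniteMeasure vol.measure] {H : TangentBundle (𝓡 n) M → ℝ}
    (hH : ContMDiff (𝓡 n).tangent 𝓘(ℝ, ℝ) ∞ H) {J : Set ℝ} (hJ : IsOpen J)
    {c : ℝ → M → TangentBundle (𝓡 n) M}
    (hc : IsTrajectoryD g vol (averagedHamiltonian vol H) J c) (x : M) :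
    IsTrajectory g H J (fun t ↦ c t x) := by
  intro t ht
  have hd : ∀ x, MDifferentiableAt 𝓘(ℝ, ℝ) (𝓡 n).tangent (fun t ↦ c t x) t := fun x ↦
    (contMDiffAt_slice (hc.1.contMDiffAt hJ ht x)).mdifferentiableAt (by simp)
  refine ⟨hd x, ?_⟩
  -- The pointwise result is stated at time `0`, so the curve is shifted by `t`.
  have hv : velocity (fun a ↦ c (t + a)) 0 1 = velocity c t 1 := by
    funext x
    refine totalSpace_ext (congrArg (c · x) (add_zero t)) ?_
    have h1 := familyDeriv_comp (τ := fun t ↦ c t x) (r := fun a : ℝ ↦ t + a) (z := 0) (hd x)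
      ((hasFDerivAt_id (0 : ℝ)).const_add t) (add_zero t)
    exact DFunLike.congr_fun h1 1
  have hev : ∀ᶠ a in 𝓝 (0 : ℝ), t + a ∈ J :=
    ContinuousAt.eventually_mem (by fun_prop) (hJ.mem_nhds (by simpa using ht))
  have h2 := isHamiltonianVector_of_isHamiltonianVectorD g vol hH (c := fun a ↦ c (t + a)) ?_
    (hc.1.mem _ (by simpa using ht)) (hv ▸ hc.2 t ht) x
  · rw [hv] at h2
    exact h2
  · filter_upwards [hev] with a ha x
    have h3 : ContMDiffAt (𝓘(ℝ, ℝ).prod (𝓡 n)) (𝓘(ℝ, ℝ).prod (𝓡 n)) ∞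
        (fun p : ℝ × M ↦ (t + p.1, p.2)) (a, x) :=
      (ContMDiffAt.add contMDiffAt_const contMDiffAt_fst).prodMk contMDiffAt_snd
    exact ContMDiffAt.comp (g := fun p : ℝ × M ↦ c p.1 p.2) (a, x)
      (hc.1.contMDiffAt hJ ha x) h3

omit [T2Space M] in
/-- A smooth curve in `TD` that is a trajectory in `TM` at every point is a trajectory in `TD`. -/
theorem isTrajectoryD_of_isTrajectory {g : Metric n M} {vol : VolumeForm n M}
    [IsFiniteMeasure vol.measure] {H : TangentBundle (𝓡 n) M → ℝ}
    (hH : ContMDiff (𝓡 n).tangent 𝓘(ℝ, ℝ) ∞ H) {J : Set ℝ}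
    {c : ℝ → M → TangentBundle (𝓡 n) M} (hc : IsSmoothFamily vol J c)
    (h : ∀ x, IsTrajectory g H J (fun t ↦ c t x)) :
    IsTrajectoryD g vol (averagedHamiltonian vol H) J c := by
  refine ⟨hc, fun t ht σ hσ hσv ↦ ?_⟩
  rw [hasDerivAt_averagedHamiltonian_iff g vol hH hσ.contMDiff]
  refine integral_eq_zero_of_ae (ae_of_all _ fun x ↦ ?_)
  have h1 : IsHamiltonianVector g H (velocity σ (0, 0) (1, 0) x) := by
    rw [hσv]
    exact (h x t ht).2
  exact sub_eq_zero.2 (h1 _)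

end Pointwise

/-! ### The flow on `TD` -/

section Flow

open Filter Topology

lemma flowsTo_zero {P : Type*} {trajectory : Set ℝ → (ℝ → P) → Prop} {p q : P}
    (h : FlowsTo trajectory 0 p q) : p = q := by
  obtain ⟨J, γ, -, -, -, -, -, rfl, rfl⟩ := h
  rfl

variable [T2Space M] {g : Metric n M} {H : TangentBundle (𝓡 n) M → ℝ}

lemma hamFlow_unique (hH : ContMDiff (𝓡 n).tangent 𝓘(ℝ, ℝ) ∞ H) {t : ℝ}
    {v w w' : TangentBundle (𝓡 n) M} (h : HamFlow g H t v w) (h' : HamFlow g H t v w') :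
    w = w' :=
  ((hamFlow_iff g hH t v w).1 h).unique (contMDiff_hamField g hH) ((hamFlow_iff g hH t v w').1 h')

omit [T2Space M] in
lemma hamFlow_zero_self (hH : ContMDiff (𝓡 n).tangent 𝓘(ℝ, ℝ) ∞ H)
    (v : TangentBundle (𝓡 n) M) : HamFlow g H 0 v v := by
  obtain ⟨ε, hε, U, -, hv, Φ, -, h⟩ := exists_local_flow (contMDiff_hamField g hH) v
  have h0 := (hamFlow_iff g hH 0 v _).2 (h v hv 0 ⟨by linarith, hε⟩)
  rwa [← flowsTo_zero h0] at h0

/-- Each value `γ s` comes with its own witnessing trajectory; uniqueness makes `γ` agree with that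
witness on a neighbourhood of `s`. -/
lemma isTrajectory_of_hamFlow (hH : ContMDiff (𝓡 n).tangent 𝓘(ℝ, ℝ) ∞ H) {J : Set ℝ}
    (hJ : IsOpen J) {v : TangentBundle (𝓡 n) M} {γ : ℝ → TangentBundle (𝓡 n) M}
    (h : ∀ s ∈ J, HamFlow g H s v (γ s)) : IsTrajectory g H J γ := by
  rw [isTrajectory_iff g hH hJ, isMIntegralCurveOn_of_isOpen hJ]
  intro s hs
  obtain ⟨J', γ', hJ', hc', h0', hs', hγ', hv, -⟩ := h s hs
  have heq : EqOn γ γ' (J ∩ J') := fun u hu ↦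
    hamFlow_unique hH (h u hu.1) ⟨J', γ', hJ', hc', h0', hu.2, hγ', hv, rfl⟩
  rw [isTrajectory_iff g hH hJ'] at hγ'
  exact (isMIntegralCurveOn_of_isOpen (hJ.inter hJ')).1 (isMIntegralCurveOn_congr_of_isOpen
    (hJ.inter hJ') (hγ'.mono inter_subset_right) heq) s ⟨hs, hs'⟩

/-- The pointwise flow of a smooth family of initial conditions on a compact manifold is smooth. -/
lemma eventually_hamFlow_of_forall [CompactSpace M]
    (hH : ContMDiff (𝓡 n).tangent 𝓘(ℝ, ℝ) ∞ H) {V : M → TangentBundle (𝓡 n) M}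
    (hV : ContMDiff (𝓡 n) (𝓡 n).tangent ∞ V) {c : ℝ → M → TangentBundle (𝓡 n) M}
    (hcc : ∀ s x w, HamFlow g H s (V x) w → HamFlow g H s (V x) (c s x)) {s : ℝ}
    (hs : ∀ x, HamFlow g H s (V x) (c s x)) :
    ∀ᶠ t in 𝓝 s, ∀ x, HamFlow g H t (V x) (c t x) ∧
      ContMDiffAt (𝓘(ℝ, ℝ).prod (𝓡 n)) (𝓡 n).tangent ∞ (fun p : ℝ × M ↦ c p.1 p.2) (t, x) := by
  have key : ∀ᶠ t in 𝓝 s, ∀ x ∈ (univ : Set M), HamFlow g H t (V x) (c t x) ∧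
      ContMDiffAt (𝓘(ℝ, ℝ).prod (𝓡 n)) (𝓡 n).tangent ∞ (fun p : ℝ × M ↦ c p.1 p.2) (t, x) := by
    refine isCompact_univ.eventually_forall_of_forall_eventually
      (P := fun t x ↦ HamFlow g H t (V x) (c t x) ∧ ContMDiffAt (𝓘(ℝ, ℝ).prod (𝓡 n))
        (𝓡 n).tangent ∞ (fun p : ℝ × M ↦ c p.1 p.2) (t, x)) fun x _ ↦ ?_
    obtain ⟨A, hA, hsA, U, hU, hxU, Φ, hΦ, hflow⟩ :=
      FieldFlowsTo.exists_smooth_flow (contMDiff_hamField g hH) ((hamFlow_iff g hH _ _ _).1 (hs x))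
    have hO : IsOpen (A ×ˢ (V ⁻¹' U)) := hA.prod (hU.preimage hV.continuous)
    have hfl : ∀ p ∈ A ×ˢ (V ⁻¹' U), HamFlow g H p.1 (V p.2) (Φ (p.1, V p.2)) := fun p hp ↦
      (hamFlow_iff g hH _ _ _).2 (hflow p.1 hp.1 (V p.2) hp.2)
    filter_upwards [hO.mem_nhds (⟨hsA, hxU⟩ : (s, x) ∈ A ×ˢ (V ⁻¹' U))] with p hp
    refine ⟨hcc _ _ _ (hfl p hp), ?_⟩
    have h1 : ContMDiffAt (𝓘(ℝ, ℝ).prod (𝓡 n)) (𝓡 n).tangent ∞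
        (fun p : ℝ × M ↦ Φ (p.1, V p.2)) p :=
      ContMDiffAt.comp (g := Φ) p
        (hΦ.contMDiffAt ((hA.prod hU).mem_nhds ⟨hp.1, hp.2⟩))
        (contMDiffAt_fst.prodMk ((hV p.2).comp p contMDiffAt_snd))
    refine h1.congr_of_eventuallyEq ?_
    -- The curve `c` is an arbitrary selection of flow values; uniqueness identifies it locally with
    -- the smooth flow.
    filter_upwards [hO.mem_nhds hp] with p' hp'
    exact hamFlow_unique hH (hcc _ _ _ (hfl p' hp')) (hfl p' hp')
  filter_upwards [key] with t ht x using ht x trivial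

variable [CompactSpace M] [MeasurableSpace M] [BorelSpace M] {vol : VolumeForm n M}
  [IsFiniteMeasure vol.measure]

/-- If the pointwise flow stays in `TD` up to time `t`, it is a trajectory in `TD`. -/
theorem exists_isTrajectoryD (hH : ContMDiff (𝓡 n).tangent 𝓘(ℝ, ℝ) ∞ H)
    {V : M → TangentBundle (𝓡 n) M} (hV : V ∈ TDiff vol) {t : ℝ}
    (h : ∀ s ∈ uIcc 0 t, ∃ U ∈ TDiff vol, ∀ x, HamFlow g H s (V x) (U x)) :
    ∃ (J : Set ℝ) (c : ℝ → M → TangentBundle (𝓡 n) M), IsOpen J ∧ J.OrdConnected ∧ 0 ∈ J ∧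
      t ∈ J ∧ IsTrajectoryD g vol (averagedHamiltonian vol H) J c ∧ c 0 = V := by
  classical
  -- The default `V x`, where the flow is undefined, is harmless: all times of the final interval
  -- lie in `G`, where the flow exists for every `x`.
  let c : ℝ → M → TangentBundle (𝓡 n) M := fun s x ↦
    if h : ∃ w, HamFlow g H s (V x) w then h.choose else V x
  have hcc : ∀ s x w, HamFlow g H s (V x) w → HamFlow g H s (V x) (c s x) := fun s x w hw ↦ by
    have hex : ∃ w, HamFlow g H s (V x) w := ⟨w, hw⟩
    simp only [c, dif_pos hex]
    exact hex.choose_spec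
  have hmem : ∀ s ∈ uIcc 0 t, (∀ x, HamFlow g H s (V x) (c s x)) ∧ c s ∈ TDiff vol := by
    intro s hs
    obtain ⟨U, hU, hUx⟩ := h s hs
    refine ⟨fun x ↦ hcc s x _ (hUx x), ?_⟩
    rwa [show c s = U from funext fun x ↦ hamFlow_unique hH (hcc s x _ (hUx x)) (hUx x)]
  let G : Set ℝ := {s | (∀ x, HamFlow g H s (V x) (c s x) ∧
    ContMDiffAt (𝓘(ℝ, ℝ).prod (𝓡 n)) (𝓡 n).tangent ∞ (fun p : ℝ × M ↦ c p.1 p.2) (s, x)) ∧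
    c s ∈ TDiff vol}
  -- Both conditions defining `G` are open at each time of the segment: the first by compactness of
  -- `M` and openness of the flow domain, the second by openness of `TD`.
  have hG : uIcc 0 t ⊆ interior G := by
    intro s hs
    have h1 := eventually_hamFlow_of_forall hH (contMDiff_of_mem_tDiff hV) hcc (hmem s hs).1
    have h2 := eventually_mem_tDiff vol (V := c) (a₀ := s)
      (h1.mono fun a ha x ↦ (ha x).2) (hmem s hs).2
    exact mem_interior_iff_mem_nhds.2 (h1.and h2)
  -- This component of the interior is an open interval around `0` and contains the whole segment up
  -- to `t`.
  have hJG : ordConnectedComponent (interior G) 0 ⊆ G :=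
    ordConnectedComponent_subset.trans interior_subset
  have hJo : IsOpen (ordConnectedComponent (interior G) 0) := by
    rw [isOpen_iff_mem_nhds]
    intro s hs
    rw [ordConnectedComponent_eq hs]
    exact ordConnectedComponent_mem_nhds.2
      (isOpen_interior.mem_nhds (ordConnectedComponent_subset hs))
  have h0 : (0 : ℝ) ∈ ordConnectedComponent (interior G) 0 :=
    self_mem_ordConnectedComponent.2 (hG left_mem_uIcc)
  refine ⟨ordConnectedComponent (interior G) 0, c, hJo, inferInstance, h0,
    mem_ordConnectedComponent.2 hG, ?_, ?_⟩
  · refine isTrajectoryD_of_isTrajectory hH ⟨fun s hs ↦ (hJG hs).2, fun p hp ↦ ?_⟩ fun x ↦ ?_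
    · exact ((hJG hp.1).1 p.2).2.contMDiffWithinAt
    · exact isTrajectory_of_hamFlow hH hJo fun s hs ↦ ((hJG hs).1 x).1
  · funext x
    exact (flowsTo_zero ((hJG h0).1 x).1).symm

lemma HamFlowD.hamFlow (hH : ContMDiff (𝓡 n).tangent 𝓘(ℝ, ℝ) ∞ H) {t : ℝ}
    {V W : M → TangentBundle (𝓡 n) M}
    (h : HamFlowD g vol (averagedHamiltonian vol H) t V W) (x : M) :
    HamFlow g H t (V x) (W x) := by
  obtain ⟨J, c, hJ, hc, h0, ht, hγ, rfl, rfl⟩ := h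
  exact ⟨J, fun s ↦ c s x, hJ, hc, h0, ht, hγ.isTrajectory hH hJ x, rfl, rfl⟩

/-- A trajectory in `TD` supplies the elements `U = c s` at all intermediate times; conversely the
trajectory built from the pointwise flow ends at `W` because values in `TM` are unique. -/
lemma hamFlowD_iff (hH : ContMDiff (𝓡 n).tangent 𝓘(ℝ, ℝ) ∞ H) {V : M → TangentBundle (𝓡 n) M}
    (hV : V ∈ TDiff vol) (t : ℝ) (W : M → TangentBundle (𝓡 n) M) :
    HamFlowD g vol (averagedHamiltonian vol H) t V W ↔
      (∀ s ∈ uIcc 0 t, ∃ U ∈ TDiff vol, ∀ x, HamFlow g H s (V x) (U x)) ∧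
      ∀ x, HamFlow g H t (V x) (W x) := by
  constructor
  · intro h
    refine ⟨fun s hs ↦ ?_, h.hamFlow hH⟩
    obtain ⟨J, c, hJ, hc, h0, ht, hγ, rfl, rfl⟩ := h
    have hsJ := hc.uIcc_subset h0 ht hs
    exact ⟨c s, hγ.1.mem s hsJ, fun x ↦
      HamFlowD.hamFlow hH ⟨J, c, hJ, hc, h0, hsJ, hγ, rfl, rfl⟩ x⟩
  · rintro ⟨h, hW⟩
    obtain ⟨J, c, hJ, hc, h0, ht, hγ, rfl⟩ := exists_isTrajectoryD hH hV h
    refine ⟨J, c, hJ, hc, h0, ht, hγ, rfl, funext fun x ↦ ?_⟩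
    exact hamFlow_unique hH
      (HamFlowD.hamFlow hH ⟨J, c, hJ, hc, h0, ht, hγ, rfl, rfl⟩ x) (hW x)

/-- For `t = 0` the only intermediate time is `0`, where `V` itself qualifies; the open interval
that `exists_isTrajectoryD` returns then contains a ball around `0`. -/
lemma exists_hamFlowD_short_time (hH : ContMDiff (𝓡 n).tangent 𝓘(ℝ, ℝ) ∞ H)
    {V : M → TangentBundle (𝓡 n) M} (hV : V ∈ TDiff vol) :
    ∃ ε > 0, ∀ t : ℝ, |t| < ε → ∃ W, HamFlowD g vol (averagedHamiltonian vol H) t V W := by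
  obtain ⟨J, c, hJ, hc, h0, -, hγ, rfl⟩ := exists_isTrajectoryD (g := g) (t := 0) hH hV
    (fun s hs ↦ ⟨V, hV, fun x ↦ by
      rw [uIcc_self, mem_singleton_iff] at hs
      rw [hs]
      exact hamFlow_zero_self hH _⟩)
  obtain ⟨ε, hε, hball⟩ := Metric.isOpen_iff.1 hJ 0 h0
  exact ⟨ε, hε, fun t ht ↦ ⟨c t, J, c, hJ, hc, h0, hball (by simpa using ht), hγ, rfl, rfl⟩⟩

end Flow

end

end AveragedHamiltonian

end

theorem mainTheorem9 {n : ℕ} {M : Type*} [TopologicalSpace M] [T2Space M] [CompactSpace M]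
    [ChartedSpace (EuclideanSpace ℝ (Fin n)) M] [IsManifold (𝓡 n) ∞ M]
    [MeasurableSpace M] [BorelSpace M]
    (g : AveragedHamiltonian.Metric n M) (vol : AveragedHamiltonian.VolumeForm n M)
    (hvol : vol.measure univ = 1)
    (H : TangentBundle (𝓡 n) M → ℝ) (hH : ContMDiff (𝓡 n).tangent 𝓘(ℝ, ℝ) ∞ H) :
    -- the two flows are single-valued
    (∀ t v w w', AveragedHamiltonian.HamFlow g H t v w →
      AveragedHamiltonian.HamFlow g H t v w' → w = w') ∧
    (∀ t V W W',
      AveragedHamiltonian.HamFlowD g vol (AveragedHamiltonian.averagedHamiltonian vol H) t V W →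
      AveragedHamiltonian.HamFlowD g vol (AveragedHamiltonian.averagedHamiltonian vol H) t V W' →
        W = W') ∧
    -- along a trajectory in `TD` every tangent vector moves along its own trajectory in `TM`
    (∀ (J : Set ℝ) (c : ℝ → M → TangentBundle (𝓡 n) M), IsOpen J →
      AveragedHamiltonian.IsTrajectoryD g vol (AveragedHamiltonian.averagedHamiltonian vol H) J c →
        ∀ x, AveragedHamiltonian.IsTrajectory g H J (fun t ↦ c t x)) ∧
    ∀ (X : AveragedHamiltonian.SmoothVectorField n M) (φ : M ≃ₘ^∞⟮𝓡 n, 𝓡 n⟯ M),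
      AveragedHamiltonian.IsOrientationPreserving vol φ →
      -- the flow on `TD` exists for short times
      (∃ ε > 0, ∀ t : ℝ, |t| < ε → ∃ W,
        AveragedHamiltonian.HamFlowD g vol (AveragedHamiltonian.averagedHamiltonian vol H) t
          (AveragedHamiltonian.rightTranslate X φ) W) ∧
      -- `Ψ_t(X ∘ φ)` is defined and equal to `W` iff the pointwise flow stays in `TD` up to time `t`
      -- and sends `X(φ(x))` to `W(x)` at time `t`
      ∀ (t : ℝ) (W : M → TangentBundle (𝓡 n) M),
        AveragedHamiltonian.HamFlowD g vol (AveragedHamiltonian.averagedHamiltonian vol H) t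
            (AveragedHamiltonian.rightTranslate X φ) W ↔
          (∀ s ∈ uIcc 0 t, ∃ U ∈ AveragedHamiltonian.TDiff vol, ∀ x,
            AveragedHamiltonian.HamFlow g H s ⟨φ x, X (φ x)⟩ (U x)) ∧
          ∀ x, AveragedHamiltonian.HamFlow g H t ⟨φ x, X (φ x)⟩ (W x) := by
  -- Finiteness of the volume is what makes continuous functions on `M` integrable and constants
  -- admissible as dominating functions.
  have : IsFiniteMeasure vol.measure := ⟨by rw [hvol]; exact ENNReal.one_lt_top⟩
  refine ⟨fun t v w w' h h' ↦ AveragedHamiltonian.hamFlow_unique hH h h',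
    fun t V W W' h h' ↦ funext fun x ↦
      AveragedHamiltonian.hamFlow_unique hH (h.hamFlow hH x) (h'.hamFlow hH x),
    fun J c hJ hc x ↦ hc.isTrajectory hH hJ x, fun X φ hφ ↦ ?_⟩
  have hV : AveragedHamiltonian.rightTranslate X φ ∈ AveragedHamiltonian.TDiff vol :=
    ⟨X, φ, hφ, rfl⟩
  exact ⟨AveragedHamiltonian.exists_hamFlowD_short_time hH hV,
    AveragedHamiltonian.hamFlowD_iff hH hV⟩
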